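/- Let $m\ge 2$, $c>0$ and $r\in\mathbb R$. Equip $\mathbb R^{m+2}$ with $\langle v,w\rangle=-v_0w_0+\sum_{i=1}^{m+1}v_iw_i$ and let $\mathbb S_1^{m+1}(c)=\{x\in\mathbb R^{m+2}:\langle x,x\rangle=1/c\}$ be de Sitter space. Let $M^m$ be a compact connected smooth $m$-manifold (without boundary) and let $\varphi:M^m\to\mathbb S_1^{m+1}(c)$ be a smooth spacelike hypersurface, i.e. the metric induced on $M$ by $\varphi$ is positive definite (so $\varphi$ is an immersion). For a smooth (local) unit normal field $\eta$ of $M$ in $\mathbb S_1^{m+1}(c)$, $\langle\eta,\eta\rangle=-1$, let $A$ be the shape operator, $d\eta(v)=-d\varphi(Av)$, and let $f=-\frac1m\operatorname{trace}A$ be the mean curvature. $M$ is called minimal if $f\equiv 0$, and biconservative if $A(\operatorname{grad}f)=\frac{mf}{2}\operatorname{grad}f$ on $M$; both conditions are independent of the choice of $\eta$. Suppose that $M$, with its induced metric, has constant scalar curvature $m(m-1)r$ and non-negative sectional curvature. If $M$ is not minimal and is biconservative, then there is a constant $c_1$ with $0<c_1<c$ such that $M$, with its induced metric, is isometric to the round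 sphere $\mathbb S^m(c_1)$ of constant curvature $c_1$, i.e. the sphere of radius $1/\sqrt{c_1}$ in the Euclidean space $\mathbb R^{m+1}$. -/

import Mathlib

open scoped Manifold ContDiff Matrix

noncomputable section

namespace DeSitterHypersurface

/-! ### Minkowski space and de Sitter space -/

/-- The Lorentzian inner product `-v₀w₀ + v₁w₁ + ⋯ + v_{n}w_{n}` on `ℝⁿ⁺¹`. The Euclidean norm of
`EuclideanSpace` is only used as the standard topology and smooth structure of `ℝⁿ⁺¹`. -/
def lorentz {n : ℕ} (v w : EuclideanSpace ℝ (Fin (n + 1))) : ℝ :=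
  -(v 0 * w 0) + ∑ i : Fin n, v i.succ * w i.succ

/-- The de Sitter space `𝕊₁ᵐ⁺¹(c)`, a hyperquadric in the Minkowski space `ℝ₁ᵐ⁺²`. -/
def deSitter (m : ℕ) (c : ℝ) : Set (EuclideanSpace ℝ (Fin (m + 2))) :=
  {x | lorentz x x = 1 / c}

/-! ### Curvature of a metric given by its coefficients in coordinates -/

/-- The partial derivative `∂ᵢ F` at `x`. -/
def partialDeriv {m : ℕ} {V : Type*} [NormedAddCommGroup V] [NormedSpace ℝ V]
    (F : EuclideanSpace ℝ (Fin m) → V) (i : Fin m) (x : EuclideanSpace ℝ (Fin m)) : V :=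
  fderiv ℝ F x (EuclideanSpace.single i 1)

/-- The Christoffel symbol `Γᵏᵢⱼ` of the Levi-Civita connection of the metric `(G x)ᵢⱼ`. -/
def christoffel {m : ℕ} (G : EuclideanSpace ℝ (Fin m) → Matrix (Fin m) (Fin m) ℝ)
    (k i j : Fin m) (x : EuclideanSpace ℝ (Fin m)) : ℝ :=
  1 / 2 * ∑ l, (G x)⁻¹ k l *
    (partialDeriv (fun y => G y j l) i x + partialDeriv (fun y => G y i l) j x
      - partialDeriv (fun y => G y i j) l x)

/-- The `l`-th component of `R(∂ᵢ, ∂ⱼ)∂ₖ`, where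
`R(X, Y)Z = ∇_X ∇_Y Z - ∇_Y ∇_X Z - ∇_[X, Y] Z`. -/
def riemann {m : ℕ} (G : EuclideanSpace ℝ (Fin m) → Matrix (Fin m) (Fin m) ℝ)
    (l k i j : Fin m) (x : EuclideanSpace ℝ (Fin m)) : ℝ :=
  partialDeriv (christoffel G l j k) i x - partialDeriv (christoffel G l i k) j x
    + ∑ s, (christoffel G s j k x * christoffel G l i s x
        - christoffel G s i k x * christoffel G l j s x)

/-- The inner product `∑ Gᵢⱼ vᵢ wⱼ` at `x`. -/
def coordInner {m : ℕ} (G : EuclideanSpace ℝ (Fin m) → Matrix (Fin m) (Fin m) ℝ)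
    (x v w : EuclideanSpace ℝ (Fin m)) : ℝ :=
  ∑ i, ∑ j, G x i j * v i * w j

/-- The sectional curvature `⟨R(v, w)w, v⟩ / (⟨v, v⟩⟨w, w⟩ - ⟨v, w⟩²)` of the plane spanned by
two linearly independent vectors `v`, `w` at `x`. -/
def coordSectional {m : ℕ} (G : EuclideanSpace ℝ (Fin m) → Matrix (Fin m) (Fin m) ℝ)
    (x v w : EuclideanSpace ℝ (Fin m)) : ℝ :=
  (∑ i, ∑ j, ∑ k, ∑ l, ∑ s, riemann G l k i j x * v i * w j * w k * (G x l s * v s)) /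
    (coordInner G x v v * coordInner G x w w - coordInner G x v w ^ 2)

/-- The Ricci curvature `Ric(∂ⱼ, ∂ₖ)`, the trace of `X ↦ R(X, ∂ⱼ)∂ₖ`. -/
def coordRicci {m : ℕ} (G : EuclideanSpace ℝ (Fin m) → Matrix (Fin m) (Fin m) ℝ)
    (j k : Fin m) (x : EuclideanSpace ℝ (Fin m)) : ℝ :=
  ∑ i, riemann G i k i j x

/-- The scalar curvature, the metric trace of the Ricci curvature. -/
def coordScalar {m : ℕ} (G : EuclideanSpace ℝ (Fin m) → Matrix (Fin m) (Fin m) ℝ)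
    (x : EuclideanSpace ℝ (Fin m)) : ℝ :=
  ∑ j, ∑ k, (G x)⁻¹ j k * coordRicci G j k x

/-! ### Spacelike hypersurfaces -/

section

variable {m : ℕ} {M : Type*} [TopologicalSpace M] [ChartedSpace (EuclideanSpace ℝ (Fin m)) M]

/-- The differential of a map from `M` to a normed space, with values in that space. -/
def diff {V : Type*} [NormedAddCommGroup V] [NormedSpace ℝ V] (F : M → V) (p : M)
    (v : TangentSpace (𝓡 m) p) : V :=
  mfderiv (𝓡 m) 𝓘(ℝ, V) F p v

/-- The metric on `M` induced by `φ` from the Lorentzian inner product (first fundamental form). -/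
def inducedMetric (φ : M → EuclideanSpace ℝ (Fin (m + 2))) (p : M)
    (v w : TangentSpace (𝓡 m) p) : ℝ :=
  lorentz (diff φ p v) (diff φ p w)

/-- `φ : M → 𝕊₁ᵐ⁺¹(c)` is a smooth spacelike hypersurface: `φ` is smooth, takes its values in
de Sitter space, and the induced metric is positive definite (so `φ` is an immersion). -/
structure IsSpacelikeHypersurface (c : ℝ) (φ : M → EuclideanSpace ℝ (Fin (m + 2))) : Prop where
  smooth : ContMDiff (𝓡 m) 𝓘(ℝ, EuclideanSpace ℝ (Fin (m + 2))) ∞ φ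
  mem_deSitter : ∀ p, φ p ∈ deSitter m c
  spacelike : ∀ (p : M) (v : TangentSpace (𝓡 m) p), v ≠ 0 → 0 < inducedMetric φ p v v

/-- The coefficients of the induced metric in the preferred chart at `p`, as functions on the
coordinate space. The tangent space of `M` at `p` is identified with the coordinate space
through this same chart. -/
def metricCoeff (φ : M → EuclideanSpace ℝ (Fin (m + 2))) (p : M)
    (x : EuclideanSpace ℝ (Fin m)) : Matrix (Fin m) (Fin m) ℝ :=
  Matrix.of fun i j =>
    lorentz (partialDeriv (φ ∘ (extChartAt (𝓡 m) p).symm) i x)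
      (partialDeriv (φ ∘ (extChartAt (𝓡 m) p).symm) j x)

/-- The sectional curvature of `M`, with its induced metric, at `p`. -/
def sectionalCurvature (φ : M → EuclideanSpace ℝ (Fin (m + 2))) (p : M)
    (v w : TangentSpace (𝓡 m) p) : ℝ :=
  coordSectional (metricCoeff φ p) (extChartAt (𝓡 m) p p) v w

/-- The sectional curvature of every tangent plane of `M` is non-negative. -/
def NonnegSectionalCurvature (φ : M → EuclideanSpace ℝ (Fin (m + 2))) : Prop :=
  ∀ (p : M) (v w : TangentSpace (𝓡 m) p), LinearIndependent ℝ ![v, w] →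
    0 ≤ sectionalCurvature φ p v w

/-- The scalar curvature of `M`, with its induced metric, at `p`. -/
def scalarCurvature (φ : M → EuclideanSpace ℝ (Fin (m + 2))) (p : M) : ℝ :=
  coordScalar (metricCoeff φ p) (extChartAt (𝓡 m) p p)

/-- The `i`-th vector of the coordinate basis of the tangent space at `p`. -/
def basisVec (p : M) (i : Fin m) : TangentSpace (𝓡 m) p :=
  EuclideanSpace.single i (1 : ℝ)

/-- The Gram matrix of the induced metric in the coordinate basis of the tangent space at `p`. -/
def gram (φ : M → EuclideanSpace ℝ (Fin (m + 2))) (p : M) : Matrix (Fin m) (Fin m) ℝ :=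
  Matrix.of fun i j => inducedMetric φ p (basisVec p i) (basisVec p j)

/-- The gradient of a function on `M` for the induced metric: `(grad f)ⁱ = ∑ⱼ gⁱʲ ∂ⱼf`. -/
def grad (φ : M → EuclideanSpace ℝ (Fin (m + 2))) (f : M → ℝ) (p : M) : TangentSpace (𝓡 m) p :=
  WithLp.toLp 2 ((gram φ p)⁻¹ *ᵥ fun j => diff f p (basisVec p j))

/-- `η` is a smooth unit normal vector field on the open set `U` of the spacelike hypersurface
`φ`: it is tangent to de Sitter space, i.e. orthogonal to the position vector `φ`,
it is orthogonal to `M`, and `⟨η, η⟩ = ε = -1`. -/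
structure IsUnitNormalOn (φ η : M → EuclideanSpace ℝ (Fin (m + 2))) (U : Set M) : Prop where
  smooth : ContMDiffOn (𝓡 m) 𝓘(ℝ, EuclideanSpace ℝ (Fin (m + 2))) ∞ η U
  tangent_deSitter : ∀ p ∈ U, lorentz (η p) (φ p) = 0
  normal : ∀ p ∈ U, ∀ v : TangentSpace (𝓡 m) p, lorentz (η p) (diff φ p v) = 0
  unit : ∀ p ∈ U, lorentz (η p) (η p) = -1

/-- The shape operator `A` of `φ` with respect to the unit normal field `η`, given by
`dη(v) = -dφ(A v)`, i.e. `⟨A v, w⟩ = -⟨dη(v), dφ(w)⟩`. (As `η` is orthogonal to `φ` and to `M`,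
the derivative of `η` in de Sitter space is the derivative `dη` in Minkowski space.) -/
def shapeOperator (φ η : M → EuclideanSpace ℝ (Fin (m + 2))) (p : M) :
    TangentSpace (𝓡 m) p →ₗ[ℝ] TangentSpace (𝓡 m) p :=
  Matrix.toEuclideanLin ((gram φ p)⁻¹ *
    Matrix.of fun i j => -lorentz (diff φ p (basisVec p i)) (diff η p (basisVec p j)))

/-- The mean curvature function `f`: the mean curvature vector is `fη`, and `trace A = -m f`
because `η` is timelike. -/
def meanCurvature (φ η : M → EuclideanSpace ℝ (Fin (m + 2))) (p : M) : ℝ :=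
  -LinearMap.trace ℝ (TangentSpace (𝓡 m) p) (shapeOperator φ η p) / m

/-- The spacelike hypersurface `φ` is minimal: its mean curvature vanishes identically. The
condition does not depend on the choice of the local unit normal. -/
def IsMinimal (φ : M → EuclideanSpace ℝ (Fin (m + 2))) : Prop :=
  ∀ (U : Set M) (η : M → EuclideanSpace ℝ (Fin (m + 2))), IsOpen U → IsUnitNormalOn φ η U →
    ∀ p ∈ U, meanCurvature φ η p = 0

/-- The spacelike hypersurface `φ` is biconservative: `A(grad f) + ε (m f / 2) grad f = 0` with
`ε = -1`. The condition is invariant under replacing `η` by `-η`, so it does not depend on the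
choice of the local unit normal. -/
def IsBiconservative (φ : M → EuclideanSpace ℝ (Fin (m + 2))) : Prop :=
  ∀ (U : Set M) (η : M → EuclideanSpace ℝ (Fin (m + 2))), IsOpen U → IsUnitNormalOn φ η U →
    ∀ p ∈ U, shapeOperator φ η p (grad φ (meanCurvature φ η) p)
      = ((m : ℝ) * meanCurvature φ η p / 2) • grad φ (meanCurvature φ η) p

/-- `M` with its induced metric is isometric to the round sphere `𝕊ᵐ(c₁)` of curvature `c₁`, the
sphere of radius `1 / √c₁` in `ℝᵐ⁺¹`: there is a smooth bijection of `M` onto this sphere that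
preserves the metrics (hence its differentials are invertible, and it is a diffeomorphism). -/
def IsometricToSphere (φ : M → EuclideanSpace ℝ (Fin (m + 2))) (c₁ : ℝ) : Prop :=
  ∃ F : M → EuclideanSpace ℝ (Fin (m + 1)),
    ContMDiff (𝓡 m) 𝓘(ℝ, EuclideanSpace ℝ (Fin (m + 1))) ∞ F ∧
    Function.Injective F ∧
    Set.range F = Metric.sphere 0 (1 / √c₁) ∧
    ∀ (p : M) (v w : TangentSpace (𝓡 m) p),
      inner ℝ (diff F p v) (diff F p w) = inducedMetric φ p v w

end

end DeSitterHypersurface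

end

noncomputable section

namespace DeSitterHypersurface

/-! ### Lorentzian linear algebra -/

section Lorentz

variable {n : ℕ}

/-! Write T for the trace of the shape operator A, so f = -T/m. Since the normal is timelike, the
Gauss equation gives the plane of two principal directions the sectional curvature c - λₛλₗ.
Constant scalar curvature becomes tr A² = T² + m(m-1)(r-c) (`coordScalar_eq`), and biconservativity
becomes A(grad T) = -(T/2) grad T.

T is constant. Take a maximum of T²; there T ≠ 0, as M is not minimal, and grad T = 0.
Differentiating the biconservative equation shows that the Hessian entry T_jj in a principal
direction vanishes unless λ_j = -T/2. Insert this in Simons' formula for Δ tr A² = Δ T² (`simons`).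
What remains is ∑(λₛ-λₗ)²(c-λₛλₗ) ≤ 3T ΔT ≤ 0, while every summand is non-negative by the curvature
hypothesis, so every summand vanishes. If some λᵢ were -T/2, a principal curvature λⱼ with the sign
of T would give λᵢλⱼ < 0 and a positive summand. Hence A + T/2 is invertible at the maximum
(`principal_ne`) and also nearby, where biconservativity forces grad T = 0. The level set of T
through the maximum is therefore open and closed, and M is connected (`exists_trace_eq`).

M is totally umbilical. With T = τ and tr A² = q constant, position and normal satisfy the linear
system Δφ = -mcφ - τη, Δη = cτφ + qη. If mq > τ², the system has an eigenvalue μ > 0 and some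
combination V has ΔV = μV. The maximum principle applied to each coordinate gives V = 0, which
contradicts the independence of φ and η. So mq = τ², the equality case of Cauchy-Schwarz, and A =
λ·1 (`mul_trace_sq_eq`). Then a = η + λφ is a constant vector. The maximum principle once more
excludes λ² ≥ c, so a is timelike (`exists_const_vector`).

M is a round sphere. The image of φ lies in a hyperplane orthogonal to a; a translation and a
Lorentz boost carry it into the Euclidean sphere of curvature c₁ = c - λ². The resulting local
isometry from compact M is a covering map, which is injective because a sphere of dimension m ≥ 2 is
simply connected (`injective_of_isCoveringMap_sphere`). -/

theorem lorentz_comm (v w : EuclideanSpace ℝ (Fin (n + 1))) : lorentz v w = lorentz w v := by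
  simp only [lorentz, mul_comm]

theorem lorentz_add_left (u v w : EuclideanSpace ℝ (Fin (n + 1))) :
    lorentz (u + v) w = lorentz u w + lorentz v w := by
  simp only [lorentz, PiLp.add_apply, add_mul, Finset.sum_add_distrib]; ring

theorem lorentz_smul_left (a : ℝ) (v w : EuclideanSpace ℝ (Fin (n + 1))) :
    lorentz (a • v) w = a * lorentz v w := by
  simp only [lorentz, PiLp.smul_apply, smul_eq_mul, mul_add, Finset.mul_sum]
  congr 1
  · ring
  · exact Finset.sum_congr rfl fun _ _ => by ring

/-- The Lorentzian inner product as a continuous bilinear map. -/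
def lorentzL (n : ℕ) :
    EuclideanSpace ℝ (Fin (n + 1)) →L[ℝ] EuclideanSpace ℝ (Fin (n + 1)) →L[ℝ] ℝ :=
  LinearMap.toContinuousLinearMap (LinearMap.toContinuousLinearMap.toLinearMap ∘ₗ
    LinearMap.mk₂ ℝ lorentz lorentz_add_left lorentz_smul_left
      (fun u v w => by
        rw [lorentz_comm, lorentz_add_left, lorentz_comm v, lorentz_comm w])
      (fun a v w => by rw [lorentz_comm, lorentz_smul_left, lorentz_comm, smul_eq_mul]))

theorem lorentzL_apply (v w : EuclideanSpace ℝ (Fin (n + 1))) :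
    lorentzL n v w = lorentz v w := rfl

theorem lorentz_add_right (u v w : EuclideanSpace ℝ (Fin (n + 1))) :
    lorentz u (v + w) = lorentz u v + lorentz u w := by
  simp only [← lorentzL_apply, map_add]

theorem lorentz_smul_right (a : ℝ) (v w : EuclideanSpace ℝ (Fin (n + 1))) :
    lorentz v (a • w) = a * lorentz v w := by
  simp only [← lorentzL_apply, map_smul, smul_eq_mul]

theorem lorentz_neg_left (v w : EuclideanSpace ℝ (Fin (n + 1))) :
    lorentz (-v) w = -lorentz v w := by
  simp only [← lorentzL_apply, map_neg, neg_apply]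

theorem lorentz_neg_right (v w : EuclideanSpace ℝ (Fin (n + 1))) :
    lorentz v (-w) = -lorentz v w := by
  simp only [← lorentzL_apply, map_neg]

theorem lorentz_sub_left (u v w : EuclideanSpace ℝ (Fin (n + 1))) :
    lorentz (u - v) w = lorentz u w - lorentz v w := by
  simp only [← lorentzL_apply, map_sub, sub_apply]

theorem lorentz_sub_right (u v w : EuclideanSpace ℝ (Fin (n + 1))) :
    lorentz u (v - w) = lorentz u v - lorentz u w := by
  simp only [← lorentzL_apply, map_sub]

theorem lorentz_zero_left (v : EuclideanSpace ℝ (Fin (n + 1))) : lorentz 0 v = 0 := by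
  simp [← lorentzL_apply]

theorem lorentz_zero_right (v : EuclideanSpace ℝ (Fin (n + 1))) : lorentz v 0 = 0 := by
  simp [← lorentzL_apply]

theorem lorentz_sum_left {ι : Type*} (s : Finset ι) (f : ι → EuclideanSpace ℝ (Fin (n + 1)))
    (w : EuclideanSpace ℝ (Fin (n + 1))) :
    lorentz (∑ i ∈ s, f i) w = ∑ i ∈ s, lorentz (f i) w := by
  simp only [← lorentzL_apply, map_sum, sum_apply]

theorem lorentz_sum_right {ι : Type*} (s : Finset ι) (f : ι → EuclideanSpace ℝ (Fin (n + 1)))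
    (w : EuclideanSpace ℝ (Fin (n + 1))) :
    lorentz w (∑ i ∈ s, f i) = ∑ i ∈ s, lorentz w (f i) := by
  simp only [← lorentzL_apply, map_sum]

theorem eq_zero_of_lorentz_eq_zero (v : EuclideanSpace ℝ (Fin (n + 1)))
    (h : ∀ w, lorentz v w = 0) : v = 0 := by
  ext i
  refine Fin.cases ?_ (fun j => ?_) i
  · have := h (EuclideanSpace.single 0 1)
    simpa [lorentz] using this
  · have := h (EuclideanSpace.single j.succ 1)
    simpa [lorentz, Fin.succ_inj, (Fin.succ_ne_zero j).symm] using this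

/-- The first basis vector, a future-pointing timelike vector. -/
theorem lorentz_single_zero (v : EuclideanSpace ℝ (Fin (n + 1))) :
    lorentz (EuclideanSpace.single 0 1) v = -v 0 := by
  simp [lorentz]

/-- A frame of `m` spacelike vectors together with two normal vectors spans Minkowski space. -/
theorem eq_zero_of_orthogonal_frame {m : ℕ} {t : Fin m → EuclideanSpace ℝ (Fin (m + 2))}
    {f n : EuclideanSpace ℝ (Fin (m + 2))}
    (ht : ∀ a : Fin m → ℝ, a ≠ 0 → 0 < lorentz (∑ i, a i • t i) (∑ i, a i • t i))
    (hf : 0 < lorentz f f) (hn : lorentz n n < 0) (hft : ∀ i, lorentz f (t i) = 0)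
    (hnt : ∀ i, lorentz n (t i) = 0) (hnf : lorentz n f = 0)
    {v : EuclideanSpace ℝ (Fin (m + 2))} (hvt : ∀ i, lorentz v (t i) = 0)
    (hvf : lorentz v f = 0) (hvn : lorentz v n = 0) : v = 0 := by
  let b : Fin (m + 2) → EuclideanSpace ℝ (Fin (m + 2)) := Fin.cons n (Fin.cons f t)
  have hli : LinearIndependent ℝ b := by
    rw [Fintype.linearIndependent_iff]
    intro a ha
    rw [Fin.sum_univ_succ, Fin.sum_univ_succ] at ha
    simp only [b, Fin.cons_zero, Fin.cons_succ] at ha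
    have h1 : a 0 = 0 := by
      have := congrArg (lorentz n) ha
      simp only [lorentz_add_right, lorentz_smul_right, lorentz_sum_right, hnf, hnt,
        lorentz_zero_right, mul_zero, Finset.sum_const_zero, add_zero] at this
      exact (mul_eq_zero.1 this).resolve_right hn.ne
    have h2 : a 1 = 0 := by
      have := congrArg (lorentz f) ha
      simp only [lorentz_add_right, lorentz_smul_right, lorentz_sum_right, hft, lorentz_comm f n,
        hnf, lorentz_zero_right, mul_zero, Finset.sum_const_zero, add_zero, zero_add] at this
      exact (mul_eq_zero.1 this).resolve_right hf.ne'
    have h3 : (fun i : Fin m => a i.succ.succ) = 0 := by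
      by_contra hne
      have := ht _ hne
      rw [h1, Fin.succ_zero_eq_one, h2, zero_smul, zero_smul, zero_add, zero_add] at ha
      rw [ha, lorentz_zero_left] at this
      exact lt_irrefl _ this
    intro i
    refine Fin.cases h1 (fun j => Fin.cases h2 (fun k => congrFun h3 k) j) i
  let B := basisOfLinearIndependentOfCardEqFinrank hli (by simp)
  apply eq_zero_of_lorentz_eq_zero
  intro w
  rw [← B.sum_repr w, lorentz_sum_right]
  refine Finset.sum_eq_zero fun i _ => ?_
  rw [lorentz_smul_right, coe_basisOfLinearIndependentOfCardEqFinrank]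
  refine mul_eq_zero_of_right _ ?_
  exact Fin.cases hvn (fun j => Fin.cases hvf (fun k => hvt k) j) i

end Lorentz

/-! ### Partial derivatives -/

section PartialDeriv

variable {m : ℕ} {W : Type*} [NormedAddCommGroup W] [NormedSpace ℝ W]
  {U : Set (EuclideanSpace ℝ (Fin m))} {x : EuclideanSpace ℝ (Fin m)}

theorem partialDeriv_congr {F G : EuclideanSpace ℝ (Fin m) → W} (hU : IsOpen U)
    (h : ∀ y ∈ U, F y = G y) (hx : x ∈ U) (i : Fin m) :
    partialDeriv F i x = partialDeriv G i x := by
  have : F =ᶠ[nhds x] G := Filter.eventually_of_mem (hU.mem_nhds hx) h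
  simp only [partialDeriv, this.fderiv_eq]

theorem partialDeriv_const (w : W) (i : Fin m) : partialDeriv (fun _ => w) i x = 0 := by
  simp [partialDeriv]

theorem partialDeriv_add {F G : EuclideanSpace ℝ (Fin m) → W} (hF : DifferentiableAt ℝ F x)
    (hG : DifferentiableAt ℝ G x) (i : Fin m) :
    partialDeriv (fun y => F y + G y) i x = partialDeriv F i x + partialDeriv G i x := by
  simp [partialDeriv, fderiv_fun_add hF hG]

theorem partialDeriv_sub {F G : EuclideanSpace ℝ (Fin m) → W} (hF : DifferentiableAt ℝ F x)
    (hG : DifferentiableAt ℝ G x) (i : Fin m) :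
    partialDeriv (fun y => F y - G y) i x = partialDeriv F i x - partialDeriv G i x := by
  simp [partialDeriv, fderiv_fun_sub hF hG]

theorem partialDeriv_neg (F : EuclideanSpace ℝ (Fin m) → W) (i : Fin m) :
    partialDeriv (fun y => -F y) i x = -partialDeriv F i x := by
  simp [partialDeriv, fderiv_fun_neg]

theorem partialDeriv_sum {ι : Type*} {s : Finset ι} {F : ι → EuclideanSpace ℝ (Fin m) → W}
    (hF : ∀ k ∈ s, DifferentiableAt ℝ (F k) x) (i : Fin m) :
    partialDeriv (fun y => ∑ k ∈ s, F k y) i x = ∑ k ∈ s, partialDeriv (F k) i x := by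
  simp only [partialDeriv, fderiv_fun_sum hF, sum_apply]

theorem partialDeriv_smul {a : EuclideanSpace ℝ (Fin m) → ℝ} {F : EuclideanSpace ℝ (Fin m) → W}
    (ha : DifferentiableAt ℝ a x) (hF : DifferentiableAt ℝ F x) (i : Fin m) :
    partialDeriv (fun y => a y • F y) i x = a x • partialDeriv F i x + partialDeriv a i x • F x := by
  simp [partialDeriv, fderiv_fun_smul ha hF]

theorem partialDeriv_mul {a b : EuclideanSpace ℝ (Fin m) → ℝ}
    (ha : DifferentiableAt ℝ a x) (hb : DifferentiableAt ℝ b x) (i : Fin m) :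
    partialDeriv (fun y => a y * b y) i x = a x * partialDeriv b i x + partialDeriv a i x * b x :=
  partialDeriv_smul ha hb i

theorem partialDeriv_clm {W' : Type*} [NormedAddCommGroup W'] [NormedSpace ℝ W']
    {F : EuclideanSpace ℝ (Fin m) → W} (hF : DifferentiableAt ℝ F x) (L : W →L[ℝ] W')
    (i : Fin m) : partialDeriv (fun y => L (F y)) i x = L (partialDeriv F i x) := by
  have := (L.hasFDerivAt.comp x hF.hasFDerivAt).fderiv
  simp only [partialDeriv]
  rw [show (fun y => L (F y)) = L ∘ F from rfl, this]; rfl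

theorem partialDeriv_lorentz {n : ℕ} {F G : EuclideanSpace ℝ (Fin m) → EuclideanSpace ℝ (Fin (n + 1))}
    (hF : DifferentiableAt ℝ F x) (hG : DifferentiableAt ℝ G x) (i : Fin m) :
    partialDeriv (fun y => lorentz (F y) (G y)) i x
      = lorentz (partialDeriv F i x) (G x) + lorentz (F x) (partialDeriv G i x) := by
  have := ((lorentzL n).hasFDerivAt_of_bilinear hF.hasFDerivAt hG.hasFDerivAt).fderiv
  simp only [partialDeriv]
  rw [show (fun y => lorentz (F y) (G y)) = fun y => lorentzL n (F y) (G y) from rfl, this]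
  simp [lorentzL_apply, add_comm]

theorem fderiv_eq_sum_partialDeriv (F : EuclideanSpace ℝ (Fin m) → W)
    (x v : EuclideanSpace ℝ (Fin m)) : fderiv ℝ F x v = ∑ i, v i • partialDeriv F i x := by
  conv_lhs => rw [← (EuclideanSpace.basisFun (Fin m) ℝ).sum_repr v, map_sum]
  simp [partialDeriv]

theorem _root_.ContDiffOn.partialDeriv {F : EuclideanSpace ℝ (Fin m) → W} (hF : ContDiffOn ℝ ∞ F U)
    (hU : IsOpen U) (i : Fin m) : ContDiffOn ℝ ∞ (DeSitterHypersurface.partialDeriv F i) U :=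
  (hF.fderiv_of_isOpen hU (m := ∞) (by simp)).clm_apply contDiffOn_const

theorem _root_.ContDiffOn.diffAt {F : EuclideanSpace ℝ (Fin m) → W} (hF : ContDiffOn ℝ ∞ F U)
    (hU : IsOpen U) (hx : x ∈ U) : DifferentiableAt ℝ F x :=
  (hF.contDiffAt (hU.mem_nhds hx)).differentiableAt (by simp)

theorem partialDeriv_comm {F : EuclideanSpace ℝ (Fin m) → W} (hF : ContDiffOn ℝ ∞ F U)
    (hU : IsOpen U) (hx : x ∈ U) (i j : Fin m) :
    partialDeriv (partialDeriv F i) j x = partialDeriv (partialDeriv F j) i x := by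
  have h2 : ∀ i j, partialDeriv (partialDeriv F i) j x
      = fderiv ℝ (fderiv ℝ F) x (EuclideanSpace.single j 1) (EuclideanSpace.single i 1) := by
    intro i j
    have hd : DifferentiableAt ℝ (fderiv ℝ F) x :=
      ((hF.fderiv_of_isOpen hU (m := ∞) (by simp)).contDiffAt (hU.mem_nhds hx)).differentiableAt
        (by simp)
    refine (congrArg (fun L => L (EuclideanSpace.single j 1))
      (fderiv_clm_apply hd (differentiableAt_const (EuclideanSpace.single i (1:ℝ))))).trans ?_
    simp
  rw [h2, h2]
  have := (hF.contDiffAt (hU.mem_nhds hx)).isSymmSndFDerivAt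
    (by simpa using (WithTop.coe_le_coe.2 le_top : ((2 : ℕ∞) : WithTop ℕ∞) ≤ ∞))
  exact this _ _

theorem _root_.ContDiffOn.lorentz {n : ℕ} {F G : EuclideanSpace ℝ (Fin m) → EuclideanSpace ℝ (Fin (n + 1))}
    (hF : ContDiffOn ℝ ∞ F U) (hG : ContDiffOn ℝ ∞ G U) :
    ContDiffOn ℝ ∞ (fun y => DeSitterHypersurface.lorentz (F y) (G y)) U :=
  ((lorentzL n).contDiff.comp_contDiffOn hF).clm_apply hG

theorem contDiffOn_det {ι : Type*} [Fintype ι] [DecidableEq ι]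
    {A : EuclideanSpace ℝ (Fin m) → Matrix ι ι ℝ}
    (hA : ∀ i j, ContDiffOn ℝ ∞ (fun y => A y i j) U) : ContDiffOn ℝ ∞ (fun y => (A y).det) U := by
  simp only [Matrix.det_apply]
  refine ContDiffOn.sum fun σ _ => ?_
  refine ContDiffOn.const_smul _ ?_
  exact contDiffOn_prod fun i _ => hA _ _

theorem contDiffOn_inv {ι : Type*} [Fintype ι] [DecidableEq ι]
    {A : EuclideanSpace ℝ (Fin m) → Matrix ι ι ℝ}
    (hA : ∀ i j, ContDiffOn ℝ ∞ (fun y => A y i j) U) (hdet : ∀ y ∈ U, (A y).det ≠ 0) (i j : ι) :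
    ContDiffOn ℝ ∞ (fun y => (A y)⁻¹ i j) U := by
  simp only [Matrix.inv_def, Ring.inverse_eq_inv', Matrix.smul_apply, Matrix.adjugate_apply,
    smul_eq_mul]
  refine ((contDiffOn_det hA).inv hdet).mul (contDiffOn_det fun k l => ?_)
  by_cases hk : k = j
  · subst hk; simp only [Matrix.updateRow_self]; exact contDiffOn_const
  · simp only [Matrix.updateRow_ne hk]; exact hA k l

end PartialDeriv

/-! ### Parametrized spacelike hypersurfaces -/

section Local

variable {m : ℕ} {c : ℝ} {ψ ν : EuclideanSpace ℝ (Fin m) → EuclideanSpace ℝ (Fin (m + 2))}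
  {U : Set (EuclideanSpace ℝ (Fin m))} {x : EuclideanSpace ℝ (Fin m)}

/-- A parametrized spacelike hypersurface `ψ` of de Sitter space. -/
structure IsLocalSpacelike (c : ℝ)
    (ψ : EuclideanSpace ℝ (Fin m) → EuclideanSpace ℝ (Fin (m + 2)))
    (U : Set (EuclideanSpace ℝ (Fin m))) : Prop where
  isOpen : IsOpen U
  smooth : ContDiffOn ℝ ∞ ψ U
  mem_deSitter : ∀ x ∈ U, lorentz (ψ x) (ψ x) = 1 / c
  spacelike : ∀ x ∈ U, ∀ v, v ≠ 0 → 0 < lorentz (fderiv ℝ ψ x v) (fderiv ℝ ψ x v)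

/-- A parametrized spacelike hypersurface `ψ` of de Sitter space with unit normal field `ν`. -/
structure IsLocalHypersurface (c : ℝ)
    (ψ ν : EuclideanSpace ℝ (Fin m) → EuclideanSpace ℝ (Fin (m + 2)))
    (U : Set (EuclideanSpace ℝ (Fin m))) : Prop extends IsLocalSpacelike c ψ U where
  smooth_normal : ContDiffOn ℝ ∞ ν U
  tangent_deSitter : ∀ x ∈ U, lorentz (ν x) (ψ x) = 0
  normal : ∀ x ∈ U, ∀ v, lorentz (ν x) (fderiv ℝ ψ x v) = 0
  unit : ∀ x ∈ U, lorentz (ν x) (ν x) = -1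

/-- The matrix of the first fundamental form. -/
def firstForm (ψ : EuclideanSpace ℝ (Fin m) → EuclideanSpace ℝ (Fin (m + 2)))
    (x : EuclideanSpace ℝ (Fin m)) : Matrix (Fin m) (Fin m) ℝ :=
  Matrix.of fun i j => lorentz (partialDeriv ψ i x) (partialDeriv ψ j x)

/-- The matrix of the second fundamental form. -/
def secondForm (ψ ν : EuclideanSpace ℝ (Fin m) → EuclideanSpace ℝ (Fin (m + 2)))
    (x : EuclideanSpace ℝ (Fin m)) : Matrix (Fin m) (Fin m) ℝ :=
  Matrix.of fun i j => -lorentz (partialDeriv ψ i x) (partialDeriv ν j x)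

/-- The matrix of the shape operator. -/
def weingarten (ψ ν : EuclideanSpace ℝ (Fin m) → EuclideanSpace ℝ (Fin (m + 2)))
    (x : EuclideanSpace ℝ (Fin m)) : Matrix (Fin m) (Fin m) ℝ :=
  (firstForm ψ x)⁻¹ * secondForm ψ ν x

theorem firstForm_apply (i j : Fin m) :
    firstForm ψ x i j = lorentz (partialDeriv ψ i x) (partialDeriv ψ j x) := rfl

theorem firstForm_symm (i j : Fin m) : firstForm ψ x i j = firstForm ψ x j i :=
  lorentz_comm _ _

theorem firstForm_transpose : (firstForm ψ x)ᵀ = firstForm ψ x :=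
  Matrix.ext fun i j => firstForm_symm j i

theorem lorentz_fderiv_fderiv (v w : EuclideanSpace ℝ (Fin m)) :
    lorentz (fderiv ℝ ψ x v) (fderiv ℝ ψ x w) = ∑ i, ∑ j, firstForm ψ x i j * v i * w j := by
  simp only [fderiv_eq_sum_partialDeriv ψ x, lorentz_sum_left, lorentz_smul_left]
  refine Finset.sum_congr rfl fun i _ => ?_
  rw [lorentz_sum_right, Finset.mul_sum]
  refine Finset.sum_congr rfl fun j _ => ?_
  rw [lorentz_smul_right, firstForm_apply]
  ring

namespace IsLocalSpacelike

variable (H : IsLocalSpacelike c ψ U)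

include H

theorem posDef (hx : x ∈ U) : (firstForm ψ x).PosDef := by
  refine Matrix.PosDef.of_dotProduct_mulVec_pos (firstForm_transpose) fun v hv => ?_
  have h := H.spacelike x hx (WithLp.toLp 2 v) (by simpa using hv)
  rw [lorentz_fderiv_fderiv] at h
  refine h.trans_eq (Eq.trans ?_ (Finset.sum_congr rfl fun i _ => rfl))
  refine Finset.sum_congr rfl fun i _ => ?_
  rw [Matrix.mulVec, dotProduct, Finset.mul_sum]
  refine Finset.sum_congr rfl fun j _ => ?_
  rw [Pi.star_apply, star_trivial]
  ring

theorem det_ne_zero (hx : x ∈ U) : (firstForm ψ x).det ≠ 0 := (H.posDef hx).det_pos.ne'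

theorem inv_mul (hx : x ∈ U) : (firstForm ψ x)⁻¹ * firstForm ψ x = 1 :=
  Matrix.nonsing_inv_mul _ (isUnit_iff_ne_zero.2 (H.det_ne_zero hx))

theorem mul_inv (hx : x ∈ U) : firstForm ψ x * (firstForm ψ x)⁻¹ = 1 :=
  Matrix.mul_nonsing_inv _ (isUnit_iff_ne_zero.2 (H.det_ne_zero hx))

theorem smooth_partial (i : Fin m) : ContDiffOn ℝ ∞ (partialDeriv ψ i) U :=
  H.smooth.partialDeriv H.isOpen i

theorem smooth_firstForm (i j : Fin m) : ContDiffOn ℝ ∞ (fun y => firstForm ψ y i j) U :=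
  (H.smooth_partial i).lorentz (H.smooth_partial j)

theorem smooth_inv (i j : Fin m) : ContDiffOn ℝ ∞ (fun y => (firstForm ψ y)⁻¹ i j) U :=
  contDiffOn_inv H.smooth_firstForm (fun _ hy => H.det_ne_zero hy) i j

theorem partial_position (hx : x ∈ U) (i : Fin m) : lorentz (partialDeriv ψ i x) (ψ x) = 0 := by
  have h := partialDeriv_congr H.isOpen H.mem_deSitter hx i
  rw [partialDeriv_lorentz (H.smooth.diffAt H.isOpen hx) (H.smooth.diffAt H.isOpen hx),
    partialDeriv_const, lorentz_comm (ψ x)] at h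
  linarith

theorem position_partial (hx : x ∈ U) (i : Fin m) : lorentz (ψ x) (partialDeriv ψ i x) = 0 := by
  rw [lorentz_comm, H.partial_position hx]

/-- The projection of the first basis vector to the normal line of the hypersurface. -/
theorem exists_timelike (hc : 0 < c) :
    ∃ P : EuclideanSpace ℝ (Fin m) → EuclideanSpace ℝ (Fin (m + 2)), ContDiffOn ℝ ∞ P U ∧
      ∀ x ∈ U, lorentz (P x) (ψ x) = 0 ∧ (∀ i, lorentz (P x) (partialDeriv ψ i x) = 0) ∧
        lorentz (P x) (P x) = -P x 0 ∧ 0 < P x 0 := by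
  let e : EuclideanSpace ℝ (Fin (m + 2)) := EuclideanSpace.single 0 1
  -- The factor c normalises ψ, since ⟨ψ,ψ⟩ = 1/c. The inverse first form gives the orthogonal
  -- projection to the tangent space.
  let P : EuclideanSpace ℝ (Fin m) → EuclideanSpace ℝ (Fin (m + 2)) := fun x =>
    e - (c * lorentz e (ψ x)) • ψ x - ∑ i, (∑ j, (firstForm ψ x)⁻¹ i j *
      lorentz e (partialDeriv ψ j x)) • partialDeriv ψ i x
  refine ⟨P, ?_, fun x hx => ?_⟩
  · exact (contDiffOn_const.sub ((contDiffOn_const.mul (contDiffOn_const.lorentz H.smooth)).smul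
      H.smooth)).sub (ContDiffOn.sum fun i _ => (ContDiffOn.sum fun j _ => (H.smooth_inv i j).mul
        (contDiffOn_const.lorentz (H.smooth_partial j))).smul (H.smooth_partial i))
  have h1 : lorentz (P x) (ψ x) = 0 := by
    simp only [P, lorentz_sub_left, lorentz_smul_left, lorentz_sum_left, H.partial_position hx,
      H.mem_deSitter x hx]
    field_simp
    simp
  have h2 : ∀ k, lorentz (P x) (partialDeriv ψ k x) = 0 := by
    intro k
    simp only [P, lorentz_sub_left, lorentz_smul_left, lorentz_sum_left, H.position_partial hx,
      mul_zero, sub_zero]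
    rw [sub_eq_zero]
    have h3 : (firstForm ψ x *ᵥ ((firstForm ψ x)⁻¹ *ᵥ fun j => lorentz e (partialDeriv ψ j x))) k
        = lorentz e (partialDeriv ψ k x) := by
      rw [Matrix.mulVec_mulVec, H.mul_inv hx, Matrix.one_mulVec]
    rw [← h3, Matrix.mulVec, dotProduct]
    refine Finset.sum_congr rfl fun i _ => ?_
    rw [firstForm_symm k i, firstForm_apply, mul_comm]
    rfl
  have h3 : lorentz e (P x) = -P x 0 := lorentz_single_zero _
  -- P - e lies in the span of ψ and the tangent vectors, all orthogonal to P.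
  have h4 : lorentz (P x) (P x) = lorentz e (P x) := by
    have : P x = e - (c * lorentz e (ψ x)) • ψ x - ∑ i, (∑ j, (firstForm ψ x)⁻¹ i j *
      lorentz e (partialDeriv ψ j x)) • partialDeriv ψ i x := rfl
    nth_rewrite 1 [this]
    rw [lorentz_sub_left, lorentz_sub_left, lorentz_smul_left, lorentz_comm (ψ x), h1,
      lorentz_sum_left, mul_zero, sub_zero, sub_eq_self]
    exact Finset.sum_eq_zero fun i _ => by
      rw [lorentz_smul_left, lorentz_comm (partialDeriv ψ i x), h2, mul_zero]
  refine ⟨h1, h2, by rw [h4, h3], ?_⟩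
  -- Expanding -⟨e, P⟩ gives 1 plus two non-negative terms, because the position direction and the
  -- tangent space are both spacelike.
  have h5 : P x 0 = 1 + c * lorentz e (ψ x) ^ 2 + (fun j => lorentz e (partialDeriv ψ j x)) ⬝ᵥ
      ((firstForm ψ x)⁻¹ *ᵥ fun j => lorentz e (partialDeriv ψ j x)) := by
    rw [← neg_eq_iff_eq_neg.2 h3]
    simp only [P, lorentz_sub_right, lorentz_smul_right, lorentz_sum_right]
    rw [show lorentz e e = -1 by rw [lorentz_single_zero]; simp [e]]
    have : ∑ i, (∑ j, (firstForm ψ x)⁻¹ i j * lorentz e (partialDeriv ψ j x)) *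
        lorentz e (partialDeriv ψ i x) = (fun j => lorentz e (partialDeriv ψ j x)) ⬝ᵥ
        ((firstForm ψ x)⁻¹ *ᵥ fun j => lorentz e (partialDeriv ψ j x)) :=
      Finset.sum_congr rfl fun i _ => mul_comm _ _
    rw [this]
    ring
  have h6 := (H.posDef hx).inv.posSemidef.dotProduct_mulVec_nonneg
    fun j => lorentz e (partialDeriv ψ j x)
  rw [star_trivial] at h6
  have : 0 ≤ c * lorentz e (ψ x) ^ 2 := by positivity
  linarith

end IsLocalSpacelike

namespace IsLocalHypersurface

variable (H : IsLocalHypersurface c ψ ν U)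

include H

theorem mul_weingarten (hx : x ∈ U) : firstForm ψ x * weingarten ψ ν x = secondForm ψ ν x := by
  rw [weingarten, ← Matrix.mul_assoc, H.mul_inv hx, Matrix.one_mul]

theorem smooth_partial_normal (i : Fin m) : ContDiffOn ℝ ∞ (partialDeriv ν i) U :=
  H.smooth_normal.partialDeriv H.isOpen i

theorem smooth_secondForm (i j : Fin m) : ContDiffOn ℝ ∞ (fun y => secondForm ψ ν y i j) U :=
  ((H.smooth_partial i).lorentz (H.smooth_partial_normal j)).neg

theorem smooth_weingarten (i j : Fin m) : ContDiffOn ℝ ∞ (fun y => weingarten ψ ν y i j) U := by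
  simp only [weingarten, Matrix.mul_apply]
  exact ContDiffOn.sum fun k _ => (H.smooth_inv i k).mul (H.smooth_secondForm k j)

theorem normal_partial (hx : x ∈ U) (i : Fin m) : lorentz (ν x) (partialDeriv ψ i x) = 0 :=
  H.normal x hx _

theorem partial_normal_position (hx : x ∈ U) (i : Fin m) :
    lorentz (partialDeriv ν i x) (ψ x) = 0 := by
  have h := partialDeriv_congr H.isOpen H.tangent_deSitter hx i
  rw [partialDeriv_lorentz (H.smooth_normal.diffAt H.isOpen hx) (H.smooth.diffAt H.isOpen hx),
    partialDeriv_const, H.normal_partial hx] at h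
  linarith

theorem partial_normal_normal (hx : x ∈ U) (i : Fin m) :
    lorentz (partialDeriv ν i x) (ν x) = 0 := by
  have h := partialDeriv_congr H.isOpen H.unit hx i
  rw [partialDeriv_lorentz (H.smooth_normal.diffAt H.isOpen hx)
    (H.smooth_normal.diffAt H.isOpen hx), partialDeriv_const, lorentz_comm (ν x)] at h
  linarith

theorem partial_normal (hx : x ∈ U) (i : Fin m) : lorentz (partialDeriv ψ i x) (ν x) = 0 := by
  rw [lorentz_comm, H.normal_partial hx]

theorem position_normal (hx : x ∈ U) : lorentz (ψ x) (ν x) = 0 := by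
  rw [lorentz_comm, H.tangent_deSitter x hx]

/-- This comes from differentiating ⟨ν, ∂ᵢψ⟩ = 0. It makes the second form symmetric, and shows that
at a point it depends on ν only through its value there. -/
theorem secondForm_eq (hx : x ∈ U) (i j : Fin m) :
    secondForm ψ ν x i j = lorentz (partialDeriv (partialDeriv ψ i) j x) (ν x) := by
  have h := partialDeriv_congr H.isOpen (fun y hy => H.normal_partial hy i) hx j
  rw [partialDeriv_lorentz (H.smooth_normal.diffAt H.isOpen hx)
    ((H.smooth_partial i).diffAt H.isOpen hx), partialDeriv_const, lorentz_comm _ (partialDeriv ψ i x),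
    lorentz_comm (ν x)] at h
  simp only [secondForm, Matrix.of_apply]
  linarith

theorem secondForm_symm (hx : x ∈ U) (i j : Fin m) :
    secondForm ψ ν x i j = secondForm ψ ν x j i := by
  rw [H.secondForm_eq hx, H.secondForm_eq hx, partialDeriv_comm H.smooth H.isOpen hx]

theorem secondForm_transpose (hx : x ∈ U) : (secondForm ψ ν x)ᵀ = secondForm ψ ν x :=
  Matrix.ext fun i j => H.secondForm_symm hx j i

/-- Tangent vectors, position and normal form a frame of Minkowski space, so vector identities such
as the Weingarten and Gauss formulas can be checked by pairing with it. -/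
theorem eq_zero_of_orthogonal (hc : 0 < c) (hx : x ∈ U) {v : EuclideanSpace ℝ (Fin (m + 2))}
    (h1 : ∀ i, lorentz v (partialDeriv ψ i x) = 0) (h2 : lorentz v (ψ x) = 0)
    (h3 : lorentz v (ν x) = 0) : v = 0 := by
  refine eq_zero_of_orthogonal_frame (t := fun i => partialDeriv ψ i x) (fun a ha => ?_)
    (by rw [H.mem_deSitter x hx]; positivity) (by rw [H.unit x hx]; norm_num)
    (fun i => by rw [lorentz_comm, H.partial_position hx])
    (fun i => H.normal_partial hx i) (H.tangent_deSitter x hx) h1 h2 h3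
  have := H.spacelike x hx (WithLp.toLp 2 a) (by simpa using ha)
  rwa [fderiv_eq_sum_partialDeriv] at this

/-- The Weingarten formula: differentiating ⟨ν,ψ⟩ = 0 and ⟨ν,ν⟩ = -1 shows that ∂ⱼν has no component
along ψ or ν. -/
theorem partialDeriv_normal (hc : 0 < c) (hx : x ∈ U) (j : Fin m) :
    partialDeriv ν j x = -∑ k, weingarten ψ ν x k j • partialDeriv ψ k x := by
  rw [eq_neg_iff_add_eq_zero]
  refine H.eq_zero_of_orthogonal hc hx (fun i => ?_) ?_ ?_
  · have h := congrFun (congrFun (H.mul_weingarten hx) i) j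
    rw [Matrix.mul_apply] at h
    have h2 : ∑ k, lorentz (weingarten ψ ν x k j • partialDeriv ψ k x) (partialDeriv ψ i x)
        = secondForm ψ ν x i j := by
      rw [← h]
      exact Finset.sum_congr rfl fun k _ => by
        rw [lorentz_smul_left, firstForm_apply, lorentz_comm, mul_comm]
    rw [lorentz_add_left, lorentz_sum_left, h2, lorentz_comm]
    simp [secondForm]
  · simp [lorentz_add_left, lorentz_sum_left, lorentz_smul_left, H.partial_position hx,
      H.partial_normal_position hx]
  · simp [lorentz_add_left, lorentz_sum_left, lorentz_smul_left, H.partial_normal_normal hx,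
      H.partial_normal hx]

theorem eq_smul_normal (hc : 0 < c) (hx : x ∈ U) {n : EuclideanSpace ℝ (Fin (m + 2))}
    (h1 : ∀ v, lorentz n (fderiv ℝ ψ x v) = 0) (h2 : lorentz n (ψ x) = 0) :
    n = -lorentz n (ν x) • ν x := by
  rw [← sub_eq_zero]
  refine H.eq_zero_of_orthogonal hc hx (fun i => ?_) ?_ ?_
  · rw [lorentz_sub_left, lorentz_smul_left, H.normal_partial hx, partialDeriv, h1]
    ring
  · rw [lorentz_sub_left, lorentz_smul_left, H.tangent_deSitter x hx, h2]
    ring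
  · rw [lorentz_sub_left, lorentz_smul_left, H.unit x hx]
    ring

/-- Two unit normal vectors differ by a sign. -/
theorem normal_eq_or_eq_neg (hc : 0 < c) (hx : x ∈ U) {n : EuclideanSpace ℝ (Fin (m + 2))}
    (h1 : ∀ v, lorentz n (fderiv ℝ ψ x v) = 0) (h2 : lorentz n (ψ x) = 0)
    (h3 : lorentz n n = -1) : n = ν x ∨ n = -ν x := by
  have h := H.eq_smul_normal hc hx h1 h2
  generalize -lorentz n (ν x) = t at h
  have ht : t ^ 2 = 1 := by
    rw [h, lorentz_smul_left, lorentz_smul_right, H.unit x hx] at h3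
    linarith
  rcases sq_eq_one_iff.1 ht with rfl | rfl
  · left; rw [h, one_smul]
  · right; rw [h, neg_one_smul]

/-- The positive time component selects one of the two unit normals. This lets normals found in
different charts be glued. -/
theorem normal_unique (hc : 0 < c) (hx : x ∈ U) {n : EuclideanSpace ℝ (Fin (m + 2))}
    (h1 : ∀ v, lorentz n (fderiv ℝ ψ x v) = 0) (h2 : lorentz n (ψ x) = 0)
    (h3 : lorentz n n = -1) (hn : 0 < n 0) (hν : 0 < ν x 0) : n = ν x := by
  refine (H.normal_eq_or_eq_neg hc hx h1 h2 h3).resolve_right fun h => ?_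
  rw [h, PiLp.neg_apply] at hn
  linarith

theorem lorentz_second_position (hx : x ∈ U) (i j : Fin m) :
    lorentz (partialDeriv (partialDeriv ψ i) j x) (ψ x) = -firstForm ψ x i j := by
  have h := partialDeriv_congr H.isOpen (fun y hy => H.partial_position hy i) hx j
  rw [partialDeriv_lorentz ((H.smooth_partial i).diffAt H.isOpen hx)
    (H.smooth.diffAt H.isOpen hx), partialDeriv_const] at h
  rw [firstForm_apply]
  linarith

theorem partialDeriv_firstForm (hx : x ∈ U) (i j k : Fin m) :
    partialDeriv (fun y => firstForm ψ y i j) k x =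
      lorentz (partialDeriv (partialDeriv ψ i) k x) (partialDeriv ψ j x)
        + lorentz (partialDeriv ψ i x) (partialDeriv (partialDeriv ψ j) k x) :=
  partialDeriv_lorentz ((H.smooth_partial i).diffAt H.isOpen hx)
    ((H.smooth_partial j).diffAt H.isOpen hx) k

/-- By symmetry of second partials, four of the six terms in the three metric derivatives cancel and
the other two agree. -/
theorem christoffel_eq (hx : x ∈ U) (k i j : Fin m) :
    christoffel (firstForm ψ) k i j x = ∑ l, (firstForm ψ x)⁻¹ k l *
      lorentz (partialDeriv (partialDeriv ψ i) j x) (partialDeriv ψ l x) := by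
  rw [christoffel, Finset.mul_sum]
  refine Finset.sum_congr rfl fun l _ => ?_
  rw [H.partialDeriv_firstForm hx, H.partialDeriv_firstForm hx, H.partialDeriv_firstForm hx,
    partialDeriv_comm H.smooth H.isOpen hx j i, partialDeriv_comm H.smooth H.isOpen hx l i,
    partialDeriv_comm H.smooth H.isOpen hx l j, lorentz_comm (partialDeriv ψ j x),
    lorentz_comm (partialDeriv ψ i x)]
  ring

/-- The Gauss formula. -/
theorem gauss_formula (hc : 0 < c) (hx : x ∈ U) (i j : Fin m) :
    partialDeriv (partialDeriv ψ i) j x =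
      ∑ k, christoffel (firstForm ψ) k i j x • partialDeriv ψ k x
        - (c * firstForm ψ x i j) • ψ x - secondForm ψ ν x i j • ν x := by
  rw [← sub_eq_zero]
  refine H.eq_zero_of_orthogonal hc hx (fun l => ?_) ?_ ?_
  · simp only [lorentz_sub_left, lorentz_smul_left, lorentz_sum_left, H.normal_partial hx,
      lorentz_comm (ψ x), H.partial_position hx, H.christoffel_eq hx, mul_zero, sub_zero,
      Finset.sum_mul]
    rw [Finset.sum_comm]
    -- Contracting the inverse metric with the metric recovers the tangential component of ∂ᵢ∂ⱼψ.
    have h1 : ∀ n, ∑ k, (firstForm ψ x)⁻¹ k n * firstForm ψ x k l = if n = l then 1 else 0 := by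
      intro n
      have := congrFun (congrFun (H.mul_inv hx) l) n
      rw [Matrix.mul_apply, Matrix.one_apply] at this
      simp only [eq_comm (a := n)]
      rw [← this]
      have hs : (firstForm ψ x)⁻¹ᵀ = (firstForm ψ x)⁻¹ := by
        rw [Matrix.transpose_nonsing_inv, firstForm_transpose]
      exact Finset.sum_congr rfl fun k _ => by
        rw [mul_comm, firstForm_symm]
    simp only [← firstForm_apply]
    calc _ = lorentz (partialDeriv (partialDeriv ψ i) j x) (partialDeriv ψ l x)
        - ∑ n, lorentz (partialDeriv (partialDeriv ψ i) j x) (partialDeriv ψ n x) *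
          ∑ k, (firstForm ψ x)⁻¹ k n * firstForm ψ x k l := by
          congr 1
          refine Finset.sum_congr rfl fun n _ => ?_
          rw [Finset.mul_sum]
          exact Finset.sum_congr rfl fun k _ => by ring
      _ = 0 := by simp [h1]
  · simp only [lorentz_sub_left, lorentz_smul_left, lorentz_sum_left, H.tangent_deSitter x hx,
      H.partial_position hx, H.lorentz_second_position hx, H.mem_deSitter x hx]
    field_simp
    simp
  · simp only [lorentz_sub_left, lorentz_smul_left, lorentz_sum_left, H.position_normal hx,
      H.partial_normal hx, H.unit x hx, H.secondForm_eq hx]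
    simp

end IsLocalHypersurface

/-- The vector `P x` has ⟨P,P⟩ = -P₀ < 0, so dividing by √P₀ yields a unit timelike vector that
still points to the future. -/
theorem IsLocalSpacelike.exists_normal (H : IsLocalSpacelike c ψ U) (hc : 0 < c) :
    ∃ ν, IsLocalHypersurface c ψ ν U ∧ ∀ x ∈ U, 0 < ν x 0 := by
  obtain ⟨P, hP, h⟩ := H.exists_timelike hc
  have hs : ∀ x ∈ U, 0 < √(P x 0) := fun x hx => Real.sqrt_pos.2 (h x hx).2.2.2
  have hP0 : ContDiffOn ℝ ∞ (fun x => P x 0) U :=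
    (EuclideanSpace.proj (𝕜 := ℝ) (0 : Fin (m + 2))).contDiff.comp_contDiffOn hP
  refine ⟨fun x => (√(P x 0))⁻¹ • P x, { H with
    smooth_normal := ((hP0.sqrt fun x hx => (h x hx).2.2.2.ne').inv fun x hx => (hs x hx).ne').smul hP
    tangent_deSitter := fun x hx => by rw [lorentz_smul_left, (h x hx).1, mul_zero]
    normal := fun x hx v => ?_
    unit := fun x hx => ?_ }, fun x hx => ?_⟩
  · rw [fderiv_eq_sum_partialDeriv, lorentz_sum_right]
    exact Finset.sum_eq_zero fun i _ => by
      rw [lorentz_smul_right, lorentz_smul_left, (h x hx).2.1, mul_zero, mul_zero]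
  · have h1 := hs x hx
    rw [lorentz_smul_left, lorentz_smul_right, (h x hx).2.2.1]
    field_simp
    rw [Real.sq_sqrt (h x hx).2.2.2.le]
  · exact mul_pos (inv_pos.2 (hs x hx)) (h x hx).2.2.2

end Local

/-! ### The Gauss equation -/

section Gauss

variable {m : ℕ} {c : ℝ} {ψ ν : EuclideanSpace ℝ (Fin m) → EuclideanSpace ℝ (Fin (m + 2))}
  {U : Set (EuclideanSpace ℝ (Fin m))} {x : EuclideanSpace ℝ (Fin m)}

theorem coordInner_eq (x v w : EuclideanSpace ℝ (Fin m)) :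
    coordInner (firstForm ψ) x v w = v ⬝ᵥ (firstForm ψ x *ᵥ w) := by
  rw [coordInner, dotProduct]
  refine Finset.sum_congr rfl fun i _ => ?_
  rw [Matrix.mulVec, dotProduct, Finset.mul_sum]
  exact Finset.sum_congr rfl fun j _ => by ring

namespace IsLocalHypersurface

variable (H : IsLocalHypersurface c ψ ν U)

include H

theorem smooth_second (i j : Fin m) : ContDiffOn ℝ ∞ (partialDeriv (partialDeriv ψ i) j) U :=
  (H.smooth_partial i).partialDeriv H.isOpen j

theorem christoffel_symm (hx : x ∈ U) (k i j : Fin m) :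
    christoffel (firstForm ψ) k i j x = christoffel (firstForm ψ) k j i x := by
  rw [H.christoffel_eq hx, H.christoffel_eq hx]
  simp only [partialDeriv_comm H.smooth H.isOpen hx i j]

theorem smooth_christoffel (k i j : Fin m) :
    ContDiffOn ℝ ∞ (christoffel (firstForm ψ) k i j) U := by
  refine ContDiffOn.congr ?_ fun y hy => H.christoffel_eq hy k i j
  exact ContDiffOn.sum fun l _ => (H.smooth_inv k l).mul
    ((H.smooth_second i j).lorentz (H.smooth_partial l))

/-- The Gauss equation is the integrability condition of the Gauss formula, and this is the symmetry
that expresses it. -/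
theorem third_symm (hx : x ∈ U) (i j k : Fin m) :
    partialDeriv (partialDeriv (partialDeriv ψ i) j) k x
      = partialDeriv (partialDeriv (partialDeriv ψ k) j) i x := by
  rw [partialDeriv_comm (H.smooth_partial i) H.isOpen hx j k,
    partialDeriv_congr H.isOpen
      (fun y hy => partialDeriv_comm H.smooth H.isOpen hy i k) hx j,
    partialDeriv_comm (H.smooth_partial k) H.isOpen hx i j]

/-- The tangential part of the differentiated Gauss formula. The position term contributes -c g and,
by the Weingarten formula, the normal term contributes +hA. The metric is kept as an outer factor so
that it can be cancelled afterwards. -/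
theorem lorentz_third (hc : 0 < c) (hx : x ∈ U) (i j k n : Fin m) :
    lorentz (partialDeriv (partialDeriv (partialDeriv ψ j) k) i x) (partialDeriv ψ n x) =
      ∑ l, firstForm ψ x n l * (partialDeriv (christoffel (firstForm ψ) l j k) i x
        + ∑ s, christoffel (firstForm ψ) s j k x * christoffel (firstForm ψ) l i s x
        - c * firstForm ψ x j k * (1 : Matrix (Fin m) (Fin m) ℝ) l i
        + secondForm ψ ν x j k * weingarten ψ ν x l i) := by
  have hd : ∀ s, DifferentiableAt ℝ (fun y => christoffel (firstForm ψ) s j k y •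
      partialDeriv ψ s y) x := fun s =>
    ((H.smooth_christoffel s j k).diffAt H.isOpen hx).smul ((H.smooth_partial s).diffAt H.isOpen hx)
  have hd1 : DifferentiableAt ℝ (fun y => ∑ s, christoffel (firstForm ψ) s j k y •
      partialDeriv ψ s y) x := DifferentiableAt.fun_sum fun s _ => hd s
  have hd3 : DifferentiableAt ℝ (fun y => c * firstForm ψ y j k) x :=
    ((H.smooth_firstForm j k).diffAt H.isOpen hx).const_mul c
  have hd2 : DifferentiableAt ℝ (fun y => (c * firstForm ψ y j k) • ψ y) x :=
    hd3.smul (H.smooth.diffAt H.isOpen hx)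
  have hd4 : DifferentiableAt ℝ (fun y => secondForm ψ ν y j k • ν y) x :=
    ((H.smooth_secondForm j k).diffAt H.isOpen hx).smul (H.smooth_normal.diffAt H.isOpen hx)
  have h1 : ∀ s, lorentz (partialDeriv (fun y => christoffel (firstForm ψ) s j k y •
      partialDeriv ψ s y) i x) (partialDeriv ψ n x)
      = partialDeriv (christoffel (firstForm ψ) s j k) i x * firstForm ψ x n s
        + ∑ l, firstForm ψ x n l *
          (christoffel (firstForm ψ) s j k x * christoffel (firstForm ψ) l i s x) := by
    intro s
    rw [partialDeriv_smul ((H.smooth_christoffel s j k).diffAt H.isOpen hx)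
      ((H.smooth_partial s).diffAt H.isOpen hx), H.gauss_formula hc hx]
    simp only [lorentz_add_left, lorentz_smul_left, lorentz_sub_left, lorentz_sum_left,
      H.position_partial hx, H.normal_partial hx]
    rw [firstForm_symm n s, ← firstForm_apply, mul_zero, mul_zero, sub_zero, sub_zero, add_comm,
      Finset.mul_sum]
    congr 1
    refine Finset.sum_congr rfl fun l _ => ?_
    rw [H.christoffel_symm hx l s i, firstForm_symm n l, firstForm_apply l n]
    ring
  have h2 : lorentz (partialDeriv (fun y => (c * firstForm ψ y j k) • ψ y) i x)
      (partialDeriv ψ n x) = c * firstForm ψ x j k * firstForm ψ x n i := by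
    rw [partialDeriv_smul hd3 (H.smooth.diffAt H.isOpen hx), lorentz_add_left, lorentz_smul_left,
      lorentz_smul_left, H.position_partial hx, firstForm_symm n i, firstForm_apply i n]
    ring
  have h3 : lorentz (partialDeriv (fun y => secondForm ψ ν y j k • ν y) i x)
      (partialDeriv ψ n x)
      = - ∑ l, firstForm ψ x n l * (secondForm ψ ν x j k * weingarten ψ ν x l i) := by
    rw [partialDeriv_smul ((H.smooth_secondForm j k).diffAt H.isOpen hx)
      (H.smooth_normal.diffAt H.isOpen hx), lorentz_add_left, lorentz_smul_left,
      lorentz_smul_left, H.normal_partial hx, H.partialDeriv_normal hc hx, lorentz_neg_left,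
      lorentz_sum_left, mul_zero, add_zero, mul_neg, Finset.mul_sum]
    congr 1
    refine Finset.sum_congr rfl fun l _ => ?_
    rw [lorentz_smul_left, firstForm_symm n l, firstForm_apply l n]
    ring
  rw [partialDeriv_congr H.isOpen (fun y hy => H.gauss_formula hc hy j k) hx i,
    partialDeriv_sub (hd1.fun_sub hd2) hd4, partialDeriv_sub hd1 hd2,
    partialDeriv_sum fun s _ => hd s, lorentz_sub_left, lorentz_sub_left, h2, h3,
    lorentz_sum_left, Finset.sum_congr rfl fun s _ => h1 s, Finset.sum_add_distrib]
  simp only [mul_add, mul_sub, Finset.sum_add_distrib, Finset.sum_sub_distrib, Finset.mul_sum]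
  rw [Finset.sum_comm (f := fun s l => firstForm ψ x n l *
    (christoffel (firstForm ψ) s j k x * christoffel (firstForm ψ) l i s x))]
  have h4 : ∑ l, firstForm ψ x n l * (c * firstForm ψ x j k * (1 : Matrix (Fin m) (Fin m) ℝ) l i)
      = c * firstForm ψ x j k * firstForm ψ x n i := by
    simp [Matrix.one_apply, mul_comm]
  rw [h4]
  simp only [mul_comm (partialDeriv _ i x)]
  ring

/-- The Gauss equation. -/
theorem gauss_equation (hc : 0 < c) (hx : x ∈ U) (l k i j : Fin m) :
    riemann (firstForm ψ) l k i j x =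
      c * (firstForm ψ x j k * (1 : Matrix (Fin m) (Fin m) ℝ) l i
        - firstForm ψ x i k * (1 : Matrix (Fin m) (Fin m) ℝ) l j)
      - (secondForm ψ ν x j k * weingarten ψ ν x l i
        - secondForm ψ ν x i k * weingarten ψ ν x l j) := by
  -- X is the defect of the identity as a vector in l. The symmetry of third derivatives says that
  -- the first form annihilates it, and the first form is invertible.
  let X : Fin m → ℝ := fun l => riemann (firstForm ψ) l k i j x -
      (c * (firstForm ψ x j k * (1 : Matrix (Fin m) (Fin m) ℝ) l i
        - firstForm ψ x i k * (1 : Matrix (Fin m) (Fin m) ℝ) l j)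
      - (secondForm ψ ν x j k * weingarten ψ ν x l i
        - secondForm ψ ν x i k * weingarten ψ ν x l j))
  have hX : firstForm ψ x *ᵥ X = 0 := by
    ext n
    have h1 := H.lorentz_third hc hx i j k n
    have h2 := H.lorentz_third hc hx j i k n
    rw [H.third_symm hx j k i, h2, ← sub_eq_zero, ← Finset.sum_sub_distrib] at h1
    rw [Matrix.mulVec, dotProduct, Pi.zero_apply, ← neg_eq_zero, ← h1, ← Finset.sum_neg_distrib]
    refine Finset.sum_congr rfl fun l _ => ?_
    simp only [X, riemann, Finset.sum_sub_distrib]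
    ring
  have := congrFun (Matrix.eq_zero_of_mulVec_eq_zero (H.det_ne_zero hx) hX) l
  simpa only [X, Pi.zero_apply, sub_eq_zero] using this

/-- Lowering the index l turns A into the second form, and the sum collapses to two Gram
determinants. The one of the second form is subtracted because ν is timelike. -/
theorem sectional_numerator (hc : 0 < c) (hx : x ∈ U) (v w : EuclideanSpace ℝ (Fin m)) :
    ∑ i, ∑ j, ∑ k, ∑ l, ∑ s, riemann (firstForm ψ) l k i j x * v i * w j * w k *
      (firstForm ψ x l s * v s) =
    c * ((v ⬝ᵥ (firstForm ψ x *ᵥ v)) * (w ⬝ᵥ (firstForm ψ x *ᵥ w))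
        - (v ⬝ᵥ (firstForm ψ x *ᵥ w)) ^ 2)
      - ((v ⬝ᵥ (secondForm ψ ν x *ᵥ v)) * (w ⬝ᵥ (secondForm ψ ν x *ᵥ w))
        - (v ⬝ᵥ (secondForm ψ ν x *ᵥ w)) ^ 2) := by
  have hl : ∀ i j k s, ∑ l, riemann (firstForm ψ) l k i j x * firstForm ψ x l s
      = c * (firstForm ψ x j k * firstForm ψ x i s - firstForm ψ x i k * firstForm ψ x j s)
      - (secondForm ψ ν x j k * secondForm ψ ν x i s
        - secondForm ψ ν x i k * secondForm ψ ν x j s) := by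
    intro i j k s
    have hW : ∀ i, ∑ l, weingarten ψ ν x l i * firstForm ψ x l s = secondForm ψ ν x i s := by
      intro i
      rw [H.secondForm_symm hx, ← H.mul_weingarten hx, Matrix.mul_apply]
      exact Finset.sum_congr rfl fun l _ => by rw [firstForm_symm l s, mul_comm]
    have h1 : ∀ i, ∑ l, (1 : Matrix (Fin m) (Fin m) ℝ) l i * firstForm ψ x l s
        = firstForm ψ x i s := fun i => by simp [Matrix.one_apply]
    rw [← hW i, ← hW j, ← h1 i, ← h1 j]
    simp only [Finset.mul_sum, ← Finset.sum_sub_distrib]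
    exact Finset.sum_congr rfl fun l _ => by rw [H.gauss_equation hc hx]; ring
  have hv : ∀ (A : Matrix (Fin m) (Fin m) ℝ) (u : Fin m → ℝ) i, (A *ᵥ u) i = ∑ s, A i s * u s :=
    fun A u i => rfl
  have h4 : ∀ i j k, ∑ l, ∑ s, riemann (firstForm ψ) l k i j x * v i * w j * w k *
      (firstForm ψ x l s * v s) = v i * w j * w k *
      (c * (firstForm ψ x j k * (firstForm ψ x *ᵥ v) i - firstForm ψ x i k *
        (firstForm ψ x *ᵥ v) j) - (secondForm ψ ν x j k * (secondForm ψ ν x *ᵥ v) i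
        - secondForm ψ ν x i k * (secondForm ψ ν x *ᵥ v) j)) := by
    intro i j k
    rw [Finset.sum_comm]
    simp only [hv, Finset.mul_sum, ← Finset.sum_sub_distrib]
    refine Finset.sum_congr rfl fun s _ => ?_
    rw [show ∑ l, riemann (firstForm ψ) l k i j x * v i * w j * w k * (firstForm ψ x l s * v s)
      = v i * w j * w k * v s * ∑ l, riemann (firstForm ψ) l k i j x * firstForm ψ x l s by
        rw [Finset.mul_sum]; exact Finset.sum_congr rfl fun l _ => by ring, hl]
    ring
  have h3 : ∀ i j, ∑ k, v i * w j * w k *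
      (c * (firstForm ψ x j k * (firstForm ψ x *ᵥ v) i - firstForm ψ x i k *
        (firstForm ψ x *ᵥ v) j) - (secondForm ψ ν x j k * (secondForm ψ ν x *ᵥ v) i
        - secondForm ψ ν x i k * (secondForm ψ ν x *ᵥ v) j))
      = v i * w j * (c * ((firstForm ψ x *ᵥ w) j * (firstForm ψ x *ᵥ v) i
        - (firstForm ψ x *ᵥ w) i * (firstForm ψ x *ᵥ v) j)
        - ((secondForm ψ ν x *ᵥ w) j * (secondForm ψ ν x *ᵥ v) i
        - (secondForm ψ ν x *ᵥ w) i * (secondForm ψ ν x *ᵥ v) j)) := by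
    intro i j
    rw [hv _ w, hv _ w, hv _ w, hv _ w]
    simp only [Finset.mul_sum, Finset.sum_mul, ← Finset.sum_sub_distrib]
    exact Finset.sum_congr rfl fun k _ => by ring
  have h2 : ∀ i, ∑ j, v i * w j * (c * ((firstForm ψ x *ᵥ w) j * (firstForm ψ x *ᵥ v) i
        - (firstForm ψ x *ᵥ w) i * (firstForm ψ x *ᵥ v) j)
        - ((secondForm ψ ν x *ᵥ w) j * (secondForm ψ ν x *ᵥ v) i
        - (secondForm ψ ν x *ᵥ w) i * (secondForm ψ ν x *ᵥ v) j))
      = v i * (c * ((w ⬝ᵥ (firstForm ψ x *ᵥ w)) * (firstForm ψ x *ᵥ v) i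
        - (firstForm ψ x *ᵥ w) i * (w ⬝ᵥ (firstForm ψ x *ᵥ v)))
        - ((w ⬝ᵥ (secondForm ψ ν x *ᵥ w)) * (secondForm ψ ν x *ᵥ v) i
        - (secondForm ψ ν x *ᵥ w) i * (w ⬝ᵥ (secondForm ψ ν x *ᵥ v)))) := by
    intro i
    simp only [dotProduct, Finset.mul_sum, Finset.sum_mul, ← Finset.sum_sub_distrib]
    exact Finset.sum_congr rfl fun k _ => by ring
  have hs : ∀ A : Matrix (Fin m) (Fin m) ℝ, Aᵀ = A →
      (w : Fin m → ℝ) ⬝ᵥ (A *ᵥ v) = (v : Fin m → ℝ) ⬝ᵥ (A *ᵥ w) := by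
    intro A hA
    rw [Matrix.dotProduct_mulVec, ← Matrix.mulVec_transpose, hA, dotProduct_comm]
  simp only [h4, h3, h2]
  rw [hs _ firstForm_transpose, hs _ (H.secondForm_transpose hx)]
  have h1 : ∀ (a b a' b' : ℝ) (X Y X' Y' : Fin m → ℝ), ∑ i, v i * (c * (a * X i - Y i * b)
      - (a' * X' i - Y' i * b')) = c * (((v : Fin m → ℝ) ⬝ᵥ X) * a - ((v : Fin m → ℝ) ⬝ᵥ Y) * b)
      - (((v : Fin m → ℝ) ⬝ᵥ X') * a' - ((v : Fin m → ℝ) ⬝ᵥ Y') * b') := by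
    intro a b a' b' X Y X' Y'
    simp only [dotProduct, Finset.mul_sum, Finset.sum_mul, ← Finset.sum_sub_distrib]
    exact Finset.sum_congr rfl fun k _ => by ring
  rw [h1, pow_two, pow_two]

/-- The Gauss equation contracted twice. For constant scalar curvature it fixes tr A² - (tr A)². -/
theorem coordScalar_eq (hc : 0 < c) (hx : x ∈ U) :
    coordScalar (firstForm ψ) x = c * (m * (m - 1))
      - ((weingarten ψ ν x).trace ^ 2 - (weingarten ψ ν x * weingarten ψ ν x).trace) := by
  have hR : ∀ j k, coordRicci (firstForm ψ) j k x = c * (m - 1) * firstForm ψ x j k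
      - (secondForm ψ ν x j k * (weingarten ψ ν x).trace
        - (secondForm ψ ν x * weingarten ψ ν x) k j) := by
    intro j k
    simp only [coordRicci, H.gauss_equation hc hx, Finset.sum_sub_distrib, ← Finset.mul_sum,
      Matrix.mul_apply, Matrix.one_apply, Matrix.trace, Matrix.diag_apply]
    simp only [if_true, Finset.sum_const, Finset.card_univ, Fintype.card_fin, nsmul_eq_mul, mul_one,
      mul_ite, mul_zero, Finset.sum_ite_eq', Finset.mem_univ, H.secondForm_symm hx _ k]
    simp
    ring
  have h1 : ∑ j, ∑ k, (firstForm ψ x)⁻¹ j k * firstForm ψ x j k = m := by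
    have := congrArg Matrix.trace (H.inv_mul hx)
    rw [Matrix.trace_one, Fintype.card_fin] at this
    rw [← this, Matrix.trace]
    refine Finset.sum_congr rfl fun j _ => ?_
    rw [Matrix.diag_apply, Matrix.mul_apply]
    exact Finset.sum_congr rfl fun k _ => by rw [firstForm_symm j k]
  have h2 : ∑ j, ∑ k, (firstForm ψ x)⁻¹ j k * secondForm ψ ν x j k = (weingarten ψ ν x).trace := by
    rw [weingarten, Matrix.trace]
    refine Finset.sum_congr rfl fun j _ => ?_
    rw [Matrix.diag_apply, Matrix.mul_apply]
    exact Finset.sum_congr rfl fun k _ => by rw [H.secondForm_symm hx j k]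
  have h3 : ∑ j, ∑ k, (firstForm ψ x)⁻¹ j k * (secondForm ψ ν x * weingarten ψ ν x) k j
      = (weingarten ψ ν x * weingarten ψ ν x).trace := by
    conv_rhs => rw [weingarten, Matrix.mul_assoc, Matrix.trace]
    exact Finset.sum_congr rfl fun j _ => by rw [Matrix.diag_apply, Matrix.mul_apply]; rfl
  simp only [coordScalar, hR]
  calc _ = c * (m - 1) * ∑ j, ∑ k, (firstForm ψ x)⁻¹ j k * firstForm ψ x j k
      - ((∑ j, ∑ k, (firstForm ψ x)⁻¹ j k * secondForm ψ ν x j k) * (weingarten ψ ν x).trace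
        - ∑ j, ∑ k, (firstForm ψ x)⁻¹ j k * (secondForm ψ ν x * weingarten ψ ν x) k j) := by
        simp only [Finset.mul_sum, Finset.sum_mul, ← Finset.sum_sub_distrib]
        exact Finset.sum_congr rfl fun j _ => Finset.sum_congr rfl fun k _ => by ring
    _ = _ := by rw [h1, h2, h3]; ring

end IsLocalHypersurface

end Gauss

/-! ### Calculus at a maximum -/

section Maximum

variable {m : ℕ} {U : Set (EuclideanSpace ℝ (Fin m))} {x : EuclideanSpace ℝ (Fin m)}
  {f : EuclideanSpace ℝ (Fin m) → ℝ}

theorem partialDeriv_eq_zero_of_isLocalMax (h : IsLocalMax f x) (i : Fin m) :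
    partialDeriv f i x = 0 := by
  rw [partialDeriv, h.fderiv_eq_zero]; rfl

theorem partialDeriv_partialDeriv_nonpos (hU : IsOpen U) (hf : ContDiffOn ℝ ∞ f U) (hx : x ∈ U)
    (h : IsLocalMax f x) (i : Fin m) : partialDeriv (partialDeriv f i) i x ≤ 0 := by
  by_contra! hpos
  let γ : ℝ → EuclideanSpace ℝ (Fin m) := fun t => x + t • EuclideanSpace.single i 1
  have hγ : ∀ t, HasDerivAt γ (EuclideanSpace.single i 1) t := fun t => by
    have := ((hasDerivAt_id t).smul_const (EuclideanSpace.single i (1:ℝ))).const_add x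
    rwa [one_smul] at this
  have hγ0 : γ 0 = x := by simp [γ]
  have hγc : ContinuousAt γ 0 := (hγ 0).continuousAt
  have hev : ∀ᶠ t in nhds 0, γ t ∈ U := hγc.eventually_mem (by rw [hγ0]; exact hU.mem_nhds hx)
  have hd : ∀ {g : EuclideanSpace ℝ (Fin m) → ℝ}, ContDiffOn ℝ ∞ g U → ∀ t, γ t ∈ U →
      HasDerivAt (g ∘ γ) (partialDeriv g i (γ t)) t := fun hg t ht =>
    (hg.diffAt hU ht).hasFDerivAt.comp_hasDerivAt t (hγ t)
  have h1 : deriv (f ∘ γ) =ᶠ[nhds 0] partialDeriv f i ∘ γ := by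
    filter_upwards [hev] with t ht using (hd hf t ht).deriv
  have h0 : γ 0 ∈ U := by rwa [hγ0]
  have h2 : deriv (deriv (f ∘ γ)) 0 = partialDeriv (partialDeriv f i) i x := by
    rw [h1.deriv_eq, (hd (hf.partialDeriv hU i) 0 h0).deriv, hγ0]
  have hmax : IsLocalMax (f ∘ γ) 0 := by
    have : IsLocalMax f (γ 0) := by rwa [hγ0]
    exact hγc.eventually this
  -- A positive second derivative would also make the point a minimum along the coordinate line, so
  -- f would be constant there and its second derivative zero.
  have hmin : IsLocalMin (f ∘ γ) 0 := isLocalMin_of_deriv_deriv_pos (by rwa [h2])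
    hmax.deriv_eq_zero (hd hf 0 h0).continuousAt
  have hconst : f ∘ γ =ᶠ[nhds 0] fun _ => (f ∘ γ) 0 := by
    filter_upwards [hmax, hmin] with t h1 h2 using le_antisymm h1 h2
  have h3 : deriv (f ∘ γ) =ᶠ[nhds 0] fun _ => 0 := by
    filter_upwards [hconst.eventuallyEq_nhds] with t ht
    rw [ht.deriv_eq, deriv_const]
  rw [h3.deriv_eq, deriv_const] at h2
  exact hpos.ne h2

end Maximum

/-! ### Graph coordinates -/

section Graph

variable {m : ℕ} {c : ℝ} {ψ ν : EuclideanSpace ℝ (Fin m) → EuclideanSpace ℝ (Fin (m + 2))}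
  {U : Set (EuclideanSpace ℝ (Fin m))} {x : EuclideanSpace ℝ (Fin m)} {lam : Fin m → ℝ}

/-- The parametrization `ψ` is that of a graph over its tangent space at `x`, parametrized by
orthonormal linear coordinates in the directions of the principal curvatures `lam` at `x`. -/
structure IsPrincipalGraph (c : ℝ)
    (ψ ν : EuclideanSpace ℝ (Fin m) → EuclideanSpace ℝ (Fin (m + 2)))
    (U : Set (EuclideanSpace ℝ (Fin m))) (x : EuclideanSpace ℝ (Fin m)) (lam : Fin m → ℝ) : Prop
    extends IsLocalHypersurface c ψ ν U where
  mem : x ∈ U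
  graph : ∀ y ∈ U, ∀ i s, lorentz (partialDeriv ψ i y) (partialDeriv ψ s x)
    = (1 : Matrix (Fin m) (Fin m) ℝ) i s
  principal : secondForm ψ ν x = Matrix.diagonal lam

namespace IsPrincipalGraph

variable (H : IsPrincipalGraph c ψ ν U x lam)

include H

theorem firstForm_eq_one : firstForm ψ x = 1 := Matrix.ext fun i j => H.graph x H.mem i j

theorem weingarten_eq : weingarten ψ ν x = Matrix.diagonal lam := by
  rw [weingarten, H.firstForm_eq_one, inv_one, Matrix.one_mul, H.principal]

/-- The products of ∂ᵢψ(y) with the tangent vectors at x do not depend on y, so all higher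
derivatives of ψ are orthogonal to the tangent space at x. In particular the Christoffel symbols
vanish at x. -/
theorem graph_second {y} (hy : y ∈ U) (i j s : Fin m) :
    lorentz (partialDeriv (partialDeriv ψ i) j y) (partialDeriv ψ s x) = 0 := by
  have h := partialDeriv_congr H.isOpen (fun y hy => H.graph y hy i s) hy j
  rw [partialDeriv_lorentz ((H.smooth_partial i).diffAt H.isOpen hy) (differentiableAt_const _),
    partialDeriv_const, partialDeriv_const, lorentz_zero_right, add_zero] at h
  exact h

theorem graph_third {y} (hy : y ∈ U) (i j k s : Fin m) :
    lorentz (partialDeriv (partialDeriv (partialDeriv ψ i) j) k y) (partialDeriv ψ s x) = 0 := by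
  have h := partialDeriv_congr H.isOpen (fun y hy => H.graph_second hy i j s) hy k
  rw [partialDeriv_lorentz ((H.smooth_second i j).diffAt H.isOpen hy) (differentiableAt_const _),
    partialDeriv_const, partialDeriv_const, lorentz_zero_right, add_zero] at h
  exact h

theorem second_eq (hc : 0 < c) (i j : Fin m) : partialDeriv (partialDeriv ψ i) j x =
    -((c * (1 : Matrix (Fin m) (Fin m) ℝ) i j) • ψ x)
      - (Matrix.diagonal lam i j) • ν x := by
  rw [H.gauss_formula hc H.mem, H.principal, H.firstForm_eq_one]
  have : ∀ k, christoffel (firstForm ψ) k i j x = 0 := fun k => by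
    rw [H.christoffel_eq H.mem]
    exact Finset.sum_eq_zero fun l _ => by rw [H.graph_second H.mem, mul_zero]
  simp [this]

theorem lorentz_second_second (hc : 0 < c) (i j k l : Fin m) :
    lorentz (partialDeriv (partialDeriv ψ i) j x) (partialDeriv (partialDeriv ψ k) l x)
      = c * ((1 : Matrix (Fin m) (Fin m) ℝ) i j * (1 : Matrix (Fin m) (Fin m) ℝ) k l)
        - Matrix.diagonal lam i j * Matrix.diagonal lam k l := by
  rw [H.second_eq hc, H.second_eq hc]
  simp only [lorentz_sub_left, lorentz_sub_right, lorentz_neg_left, lorentz_neg_right,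
    lorentz_smul_left, lorentz_smul_right, H.mem_deSitter x H.mem, H.unit x H.mem,
    H.tangent_deSitter x H.mem, H.position_normal H.mem]
  field_simp
  ring

theorem partialDeriv_firstForm_eq_zero (i j k : Fin m) :
    partialDeriv (fun y => firstForm ψ y i j) k x = 0 := by
  rw [H.partialDeriv_firstForm H.mem, H.graph_second H.mem, lorentz_comm, H.graph_second H.mem,
    add_zero]

/-- The third derivatives of ψ drop out by `graph_third`, so the second derivatives of the metric at
x involve only the two fundamental forms. -/
theorem second_firstForm (i j k l : Fin m) :
    partialDeriv (partialDeriv (fun y => firstForm ψ y i j) k) l x =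
      lorentz (partialDeriv (partialDeriv ψ i) k x) (partialDeriv (partialDeriv ψ j) l x)
      + lorentz (partialDeriv (partialDeriv ψ i) l x) (partialDeriv (partialDeriv ψ j) k x) := by
  have hd : ∀ i j, DifferentiableAt ℝ (partialDeriv (partialDeriv ψ i) j) x := fun i j =>
    (H.smooth_second i j).diffAt H.isOpen H.mem
  have hd1 : ∀ i, DifferentiableAt ℝ (partialDeriv ψ i) x := fun i =>
    (H.smooth_partial i).diffAt H.isOpen H.mem
  have hs : ∀ i j k, DifferentiableAt ℝ (fun y => lorentz (partialDeriv (partialDeriv ψ i) k y)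
      (partialDeriv ψ j y)) x := fun i j k =>
    ((H.smooth_second i k).lorentz (H.smooth_partial j)).diffAt H.isOpen H.mem
  have hs' : ∀ i j k, DifferentiableAt ℝ (fun y => lorentz (partialDeriv ψ i y)
      (partialDeriv (partialDeriv ψ j) k y)) x := fun i j k =>
    ((H.smooth_partial i).lorentz (H.smooth_second j k)).diffAt H.isOpen H.mem
  rw [partialDeriv_congr H.isOpen (fun y hy => H.partialDeriv_firstForm hy i j k) H.mem l,
    partialDeriv_add (hs i j k) (hs' i j k), partialDeriv_lorentz (hd i k) (hd1 j),
    partialDeriv_lorentz (hd1 i) (hd j k), H.graph_third H.mem,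
    lorentz_comm (partialDeriv ψ i x), H.graph_third H.mem]
  ring

/-- In graph coordinates the shape operator is a Jacobian matrix. -/
theorem weingarten_eq_lorentz (hc : 0 < c) {y} (hy : y ∈ U) (s j : Fin m) :
    weingarten ψ ν y s j = -lorentz (partialDeriv ν j y) (partialDeriv ψ s x) := by
  rw [H.partialDeriv_normal hc hy, lorentz_neg_left, lorentz_sum_left]
  simp [lorentz_smul_left, H.graph y hy, Matrix.one_apply]

theorem partialDeriv_weingarten (hc : 0 < c) {y} (hy : y ∈ U) (s j k : Fin m) :
    partialDeriv (fun z => weingarten ψ ν z s j) k y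
      = -lorentz (partialDeriv (partialDeriv ν j) k y) (partialDeriv ψ s x) := by
  rw [partialDeriv_congr H.isOpen (fun z hz => H.weingarten_eq_lorentz hc hz s j) hy k,
    partialDeriv_neg, partialDeriv_lorentz ((H.smooth_partial_normal j).diffAt H.isOpen hy)
      (differentiableAt_const _), partialDeriv_const, lorentz_zero_right, add_zero]

/-- The Codazzi equation. In graph coordinates A is the Jacobian matrix of -⟨ν, ∂ₛψ(x)⟩, so it
reduces to symmetry of second partials. It holds on all of U and may be differentiated again. -/
theorem partialDeriv_weingarten_comm (hc : 0 < c) {y} (hy : y ∈ U) (s j k : Fin m) :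
    partialDeriv (fun z => weingarten ψ ν z s j) k y
      = partialDeriv (fun z => weingarten ψ ν z s k) j y := by
  rw [H.partialDeriv_weingarten hc hy, H.partialDeriv_weingarten hc hy,
    partialDeriv_comm H.smooth_normal H.isOpen hy]

theorem mul_weingarten_symm {y} (hy : y ∈ U) (s j : Fin m) :
    ∑ k, firstForm ψ y s k * weingarten ψ ν y k j
      = ∑ k, firstForm ψ y j k * weingarten ψ ν y k s := by
  have := H.secondForm_symm hy s j
  rwa [← H.mul_weingarten hy, Matrix.mul_apply, Matrix.mul_apply] at this

theorem partialDeriv_mul_weingarten {y} (hy : y ∈ U) (s j l : Fin m) :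
    partialDeriv (fun z => ∑ k, firstForm ψ z s k * weingarten ψ ν z k j) l y
      = ∑ k, (firstForm ψ y s k * partialDeriv (fun z => weingarten ψ ν z k j) l y
        + partialDeriv (fun z => firstForm ψ z s k) l y * weingarten ψ ν y k j) := by
  rw [partialDeriv_sum fun k _ => ((H.smooth_firstForm s k).mul
    (H.smooth_weingarten k j)).diffAt H.isOpen hy]
  exact Finset.sum_congr rfl fun k _ => partialDeriv_mul
    ((H.smooth_firstForm s k).diffAt H.isOpen hy) ((H.smooth_weingarten k j).diffAt H.isOpen hy) l

/-- Differentiate the symmetry of gA at x, where g = 1 and dg = 0. Away from x the matrix of A need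
not be symmetric. -/
theorem partialDeriv_weingarten_symm (s j k : Fin m) :
    partialDeriv (fun z => weingarten ψ ν z s j) k x
      = partialDeriv (fun z => weingarten ψ ν z j s) k x := by
  have h := partialDeriv_congr H.isOpen (fun y hy => H.mul_weingarten_symm hy s j) H.mem k
  rw [H.partialDeriv_mul_weingarten H.mem, H.partialDeriv_mul_weingarten H.mem] at h
  simpa [H.partialDeriv_firstForm_eq_zero, H.firstForm_eq_one, Matrix.one_apply] using h

/-- The mixed products of first derivatives vanish because dg = 0 at x. -/
theorem second_mul_weingarten (s j k l : Fin m) :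
    partialDeriv (partialDeriv (fun z => ∑ k, firstForm ψ z s k * weingarten ψ ν z k j) k) l x
      = partialDeriv (partialDeriv (fun z => weingarten ψ ν z s j) k) l x
        + partialDeriv (partialDeriv (fun z => firstForm ψ z s j) k) l x * lam j := by
  have h1 : ∀ n, ContDiffOn ℝ ∞ (partialDeriv (fun z => weingarten ψ ν z n j) k) U := fun n =>
    (H.smooth_weingarten n j).partialDeriv H.isOpen k
  have h2 : ∀ n, ContDiffOn ℝ ∞ (partialDeriv (fun z => firstForm ψ z s n) k) U := fun n =>
    (H.smooth_firstForm s n).partialDeriv H.isOpen k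
  rw [partialDeriv_congr H.isOpen (fun y hy => H.partialDeriv_mul_weingarten hy s j k) H.mem l,
    partialDeriv_sum fun n _ => (((H.smooth_firstForm s n).mul (h1 n)).add
      ((h2 n).mul (H.smooth_weingarten n j))).diffAt H.isOpen H.mem]
  have h3 : ∀ n, partialDeriv (fun y => firstForm ψ y s n *
      partialDeriv (fun z => weingarten ψ ν z n j) k y +
      partialDeriv (fun z => firstForm ψ z s n) k y * weingarten ψ ν y n j) l x
      = (1 : Matrix (Fin m) (Fin m) ℝ) s n *
          partialDeriv (partialDeriv (fun z => weingarten ψ ν z n j) k) l x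
        + partialDeriv (partialDeriv (fun z => firstForm ψ z s n) k) l x *
          Matrix.diagonal lam n j := by
    intro n
    rw [partialDeriv_add (((H.smooth_firstForm s n).mul (h1 n)).diffAt H.isOpen H.mem)
      (((h2 n).mul (H.smooth_weingarten n j)).diffAt H.isOpen H.mem),
      partialDeriv_mul ((H.smooth_firstForm s n).diffAt H.isOpen H.mem)
        ((h1 n).diffAt H.isOpen H.mem),
      partialDeriv_mul ((h2 n).diffAt H.isOpen H.mem)
        ((H.smooth_weingarten n j).diffAt H.isOpen H.mem),
      H.partialDeriv_firstForm_eq_zero, H.partialDeriv_firstForm_eq_zero, H.weingarten_eq,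
      H.firstForm_eq_one]
    ring
  rw [Finset.sum_congr rfl fun n _ => h3 n, Finset.sum_add_distrib]
  congr 1
  · simp [Matrix.one_apply]
  · simp [Matrix.diagonal_apply]

/-- Simons' exchange formula for the second derivatives of the shape operator. -/
theorem second_weingarten_exchange (hc : 0 < c) (s l : Fin m) :
    partialDeriv (partialDeriv (fun z => weingarten ψ ν z s s) l) l x
      = partialDeriv (partialDeriv (fun z => weingarten ψ ν z l l) s) s x
        + (lam s - lam l) * (c - lam s * lam l) := by
  -- By Codazzi, a pure second derivative of a diagonal entry is a mixed second derivative of an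
  -- off-diagonal one.
  have h1 : ∀ a b, partialDeriv (partialDeriv (fun z => weingarten ψ ν z a a) b) b x
      = partialDeriv (partialDeriv (fun z => weingarten ψ ν z a b) b) a x := by
    intro a b
    rw [partialDeriv_congr H.isOpen
      (fun y hy => H.partialDeriv_weingarten_comm hc hy a a b) H.mem b,
      partialDeriv_comm (H.smooth_weingarten a b) H.isOpen H.mem]
  -- Differentiating the symmetry of gA twice compares the entries (s,l) and (l,s). The discrepancy
  -- is λₛ - λₗ times a second derivative of g, which is where the curvature enters.
  have h := partialDeriv_congr H.isOpen (fun y hy => partialDeriv_congr H.isOpen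
    (fun z hz => H.mul_weingarten_symm hz s l) hy l) H.mem s
  rw [H.second_mul_weingarten, H.second_mul_weingarten] at h
  rw [h1, h1, partialDeriv_comm (H.smooth_weingarten l s) H.isOpen H.mem s l]
  have hg : (fun z => firstForm ψ z l s) = fun z => firstForm ψ z s l :=
    funext fun z => firstForm_symm l s
  rw [hg] at h
  rcases eq_or_ne s l with rfl | hsl
  · ring_nf
  · have hG : partialDeriv (partialDeriv (fun z => firstForm ψ z s l) l) s x
        = c - lam s * lam l := by
      rw [H.second_firstForm, H.lorentz_second_second hc, H.lorentz_second_second hc]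
      simp [hsl, hsl.symm]
    rw [hG] at h
    linarith

theorem smooth_trace : ContDiffOn ℝ ∞ (fun y => (weingarten ψ ν y).trace) U :=
  ContDiffOn.sum fun i _ => H.smooth_weingarten i i

theorem partialDeriv_trace {y} (hy : y ∈ U) (k : Fin m) :
    partialDeriv (fun y => (weingarten ψ ν y).trace) k y
      = ∑ i, partialDeriv (fun y => weingarten ψ ν y i i) k y :=
  partialDeriv_sum (fun i _ => (H.smooth_weingarten i i).diffAt H.isOpen hy) k

theorem second_trace (k l : Fin m) :
    partialDeriv (partialDeriv (fun y => (weingarten ψ ν y).trace) k) l x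
      = ∑ i, partialDeriv (partialDeriv (fun y => weingarten ψ ν y i i) k) l x := by
  rw [partialDeriv_congr H.isOpen (fun y hy => H.partialDeriv_trace hy k) H.mem l]
  exact partialDeriv_sum (fun i _ => ((H.smooth_weingarten i i).partialDeriv H.isOpen k).diffAt
    H.isOpen H.mem) l

theorem trace_eq : (weingarten ψ ν x).trace = ∑ i, lam i := by
  rw [H.weingarten_eq, Matrix.trace_diagonal]

theorem trace_sq_eq : (weingarten ψ ν x * weingarten ψ ν x).trace = ∑ i, lam i ^ 2 := by
  rw [H.weingarten_eq, Matrix.diagonal_mul_diagonal, Matrix.trace_diagonal]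
  exact Finset.sum_congr rfl fun i _ => by ring

/-- The first derivatives of A are symmetric in the matrix indices at x, so the products of first
derivatives are squares. -/
theorem second_trace_sq (l : Fin m) :
    partialDeriv (partialDeriv (fun y => (weingarten ψ ν y * weingarten ψ ν y).trace) l) l x
      = 2 * ∑ s, lam s * partialDeriv (partialDeriv (fun y => weingarten ψ ν y s s) l) l x
        + 2 * ∑ s, ∑ j, partialDeriv (fun y => weingarten ψ ν y s j) l x ^ 2 := by
  have hA := H.smooth_weingarten
  have hA' : ∀ s j, ContDiffOn ℝ ∞ (partialDeriv (fun y => weingarten ψ ν y s j) l) U :=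
    fun s j => (hA s j).partialDeriv H.isOpen l
  have h1 : ∀ y ∈ U, partialDeriv (fun y => (weingarten ψ ν y * weingarten ψ ν y).trace) l y
      = ∑ s, ∑ j, (weingarten ψ ν y s j * partialDeriv (fun y => weingarten ψ ν y j s) l y
        + partialDeriv (fun y => weingarten ψ ν y s j) l y * weingarten ψ ν y j s) := by
    intro y hy
    simp only [Matrix.trace, Matrix.diag_apply, Matrix.mul_apply]
    rw [partialDeriv_sum fun s _ => (ContDiffOn.sum fun j _ =>
      (hA s j).mul (hA j s)).diffAt H.isOpen hy]
    refine Finset.sum_congr rfl fun s _ => ?_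
    rw [partialDeriv_sum fun j _ => ((hA s j).mul (hA j s)).diffAt H.isOpen hy]
    exact Finset.sum_congr rfl fun j _ =>
      partialDeriv_mul ((hA s j).diffAt H.isOpen hy) ((hA j s).diffAt H.isOpen hy) l
  have hs : ∀ s j, ContDiffOn ℝ ∞ (fun y => weingarten ψ ν y s j *
      partialDeriv (fun y => weingarten ψ ν y j s) l y
        + partialDeriv (fun y => weingarten ψ ν y s j) l y * weingarten ψ ν y j s) U :=
    fun s j => ((hA s j).mul (hA' j s)).add ((hA' s j).mul (hA j s))
  have h2 : ∀ s j, partialDeriv (fun y => weingarten ψ ν y s j *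
      partialDeriv (fun y => weingarten ψ ν y j s) l y
        + partialDeriv (fun y => weingarten ψ ν y s j) l y * weingarten ψ ν y j s) l x
      = Matrix.diagonal lam s j * (partialDeriv (partialDeriv (fun y => weingarten ψ ν y j s) l) l x
        + partialDeriv (partialDeriv (fun y => weingarten ψ ν y s j) l) l x)
        + 2 * partialDeriv (fun y => weingarten ψ ν y s j) l x ^ 2 := by
    intro s j
    have hsym : Matrix.diagonal lam j s = Matrix.diagonal lam s j := by
      conv_rhs => rw [← Matrix.diagonal_transpose lam]
      rfl
    rw [partialDeriv_add (((hA s j).mul (hA' j s)).diffAt H.isOpen H.mem)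
      (((hA' s j).mul (hA j s)).diffAt H.isOpen H.mem),
      partialDeriv_mul ((hA s j).diffAt H.isOpen H.mem) ((hA' j s).diffAt H.isOpen H.mem),
      partialDeriv_mul ((hA' s j).diffAt H.isOpen H.mem) ((hA j s).diffAt H.isOpen H.mem),
      H.partialDeriv_weingarten_symm j s, H.weingarten_eq, hsym]
    ring
  rw [partialDeriv_congr H.isOpen h1 H.mem l, partialDeriv_sum fun s _ =>
    (ContDiffOn.sum fun j _ => hs s j).diffAt H.isOpen H.mem, Finset.mul_sum, Finset.mul_sum,
    ← Finset.sum_add_distrib]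
  refine Finset.sum_congr rfl fun s _ => ?_
  rw [partialDeriv_sum fun j _ => (hs s j).diffAt H.isOpen H.mem,
    Finset.sum_congr rfl fun j _ => h2 s j, Finset.sum_add_distrib, ← Finset.mul_sum]
  congr 1
  simp [Matrix.diagonal_apply]
  ring

/-- Simons' inequality. -/
theorem simons (hc : 0 < c) :
    2 * ∑ s, lam s * partialDeriv (partialDeriv (fun y => (weingarten ψ ν y).trace) s) s x
      + ∑ s, ∑ l, (lam s - lam l) ^ 2 * (c - lam s * lam l) ≤
    ∑ l, partialDeriv (partialDeriv
      (fun y => (weingarten ψ ν y * weingarten ψ ν y).trace) l) l x := by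
  have h1 : ∑ l, ∑ s, lam s * partialDeriv (partialDeriv (fun y => weingarten ψ ν y s s) l) l x
      = ∑ s, lam s * partialDeriv (partialDeriv (fun y => (weingarten ψ ν y).trace) s) s x
      + ∑ s, ∑ l, lam s * ((lam s - lam l) * (c - lam s * lam l)) := by
    rw [Finset.sum_comm, ← Finset.sum_add_distrib]
    refine Finset.sum_congr rfl fun s _ => ?_
    rw [H.second_trace, Finset.mul_sum, ← Finset.sum_add_distrib]
    exact Finset.sum_congr rfl fun l _ => by rw [H.second_weingarten_exchange hc s l]; ring
  -- Adding the sum with s and l exchanged turns λₛ(λₛ-λₗ) into (λₛ-λₗ)².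
  have h2 : ∑ s, ∑ l, (lam s - lam l) ^ 2 * (c - lam s * lam l)
      = 2 * ∑ s, ∑ l, lam s * ((lam s - lam l) * (c - lam s * lam l)) := by
    rw [two_mul]
    nth_rewrite 3 [Finset.sum_comm]
    simp only [← Finset.sum_add_distrib]
    exact Finset.sum_congr rfl fun s _ => Finset.sum_congr rfl fun l _ => by ring
  -- This is |∇A|²; discarding it leaves an inequality.
  have h3 : 0 ≤ ∑ l, ∑ s, ∑ j, partialDeriv (fun y => weingarten ψ ν y s j) l x ^ 2 :=
    Finset.sum_nonneg fun l _ => Finset.sum_nonneg fun s _ => Finset.sum_nonneg fun j _ =>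
      sq_nonneg _
  rw [Finset.sum_congr rfl fun l _ => H.second_trace_sq l, Finset.sum_add_distrib,
    ← Finset.mul_sum, ← Finset.mul_sum, h1, h2]
  linarith

/-- At x the metric is the identity and its first derivatives vanish, so the sum of pure second
partials is the Laplace-Beltrami operator. -/
theorem laplacian_position (hc : 0 < c) : ∑ l, partialDeriv (partialDeriv ψ l) l x
    = -((m * c) • ψ x) - (∑ l, lam l) • ν x := by
  simp only [H.second_eq hc, Matrix.one_apply_eq, Matrix.diagonal_apply_eq,
    Finset.sum_sub_distrib, Finset.sum_smul]
  simp [mul_smul, Nat.cast_smul_eq_nsmul]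

/-- The tangential part is the divergence of A, which the Codazzi equation identifies with the
gradient of the trace; hence it vanishes under the hypothesis. -/
theorem laplacian_normal (hc : 0 < c)
    (h : ∀ k, partialDeriv (fun y => (weingarten ψ ν y).trace) k x = 0) :
    ∑ l, partialDeriv (partialDeriv ν l) l x
      = (c * ∑ l, lam l) • ψ x + (∑ l, lam l ^ 2) • ν x := by
  have h1 : ∀ l, partialDeriv (partialDeriv ν l) l x
      = -∑ k, partialDeriv (fun z => weingarten ψ ν z k l) l x • partialDeriv ψ k x
        + ((c * lam l) • ψ x + (lam l ^ 2) • ν x) := by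
    intro l
    have hd : ∀ k, ContDiffOn ℝ ∞ (fun y => weingarten ψ ν y k l • partialDeriv ψ k y) U :=
      fun k => (H.smooth_weingarten k l).smul (H.smooth_partial k)
    have h2 : ∀ k, partialDeriv (fun y => weingarten ψ ν y k l • partialDeriv ψ k y) l x
        = Matrix.diagonal lam k l • partialDeriv (partialDeriv ψ k) l x
          + partialDeriv (fun z => weingarten ψ ν z k l) l x • partialDeriv ψ k x := by
      intro k
      rw [partialDeriv_smul ((H.smooth_weingarten k l).diffAt H.isOpen H.mem)
        ((H.smooth_partial k).diffAt H.isOpen H.mem), H.weingarten_eq]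
    rw [partialDeriv_congr H.isOpen (fun y hy => H.partialDeriv_normal hc hy l) H.mem l,
      partialDeriv_neg, partialDeriv_sum fun k _ => (hd k).diffAt H.isOpen H.mem,
      Finset.sum_congr rfl fun k _ => h2 k, Finset.sum_add_distrib]
    have h3 : ∑ k, Matrix.diagonal lam k l • partialDeriv (partialDeriv ψ k) l x
        = -((c * lam l) • ψ x + (lam l ^ 2) • ν x) := by
      simp only [Matrix.diagonal_apply, ite_smul, zero_smul, Finset.sum_ite_eq', Finset.mem_univ,
        if_true, H.second_eq hc, Matrix.one_apply_eq, mul_one]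
      module
    rw [h3]
    abel
  have h4 : ∑ l, ∑ k, partialDeriv (fun z => weingarten ψ ν z k l) l x • partialDeriv ψ k x
      = 0 := by
    rw [Finset.sum_comm]
    refine Finset.sum_eq_zero fun k _ => ?_
    rw [← Finset.sum_smul]
    have : ∑ l, partialDeriv (fun z => weingarten ψ ν z k l) l x = 0 := by
      rw [← h k, H.partialDeriv_trace H.mem]
      exact Finset.sum_congr rfl fun l _ => by
        rw [H.partialDeriv_weingarten_symm, H.partialDeriv_weingarten_comm hc H.mem]
    rw [this, zero_smul]
  rw [Finset.sum_congr rfl fun l _ => h1 l, Finset.sum_add_distrib, Finset.sum_neg_distrib, h4,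
    Finset.sum_add_distrib, ← Finset.sum_smul, ← Finset.sum_smul, Finset.mul_sum]
  simp

/-- At a maximum of the squared mean curvature of a biconservative hypersurface of constant scalar
curvature and non-negative sectional curvature, the exceptional value is not a principal
curvature. -/
theorem principal_ne (hc : 0 < c) {a : ℝ}
    (hq : ∀ y ∈ U, (weingarten ψ ν y * weingarten ψ ν y).trace = (weingarten ψ ν y).trace ^ 2 + a)
    (hb : ∀ y ∈ U, ∀ j, ∑ k, partialDeriv (fun y => (weingarten ψ ν y).trace) k y *
      weingarten ψ ν y k j = -((weingarten ψ ν y).trace / 2) *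
        partialDeriv (fun y => (weingarten ψ ν y).trace) j y)
    (hmax : IsLocalMax (fun y => (weingarten ψ ν y).trace ^ 2) x)
    (hne : (weingarten ψ ν x).trace ≠ 0) (hK : ∀ s l, s ≠ l → 0 ≤ c - lam s * lam l) (i : Fin m) :
    lam i ≠ -((weingarten ψ ν x).trace / 2) := by
  have hS := H.simons hc
  have hs := H.smooth_trace
  have hq' : ∀ l, partialDeriv (partialDeriv
      (fun y => (weingarten ψ ν y * weingarten ψ ν y).trace) l) l x =
      partialDeriv (partialDeriv (fun y => (weingarten ψ ν y).trace ^ 2) l) l x := by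
    intro l
    refine partialDeriv_congr H.isOpen (fun y hy => ?_) H.mem l
    rw [partialDeriv_congr H.isOpen hq hy, partialDeriv_add ((hs.pow 2).diffAt H.isOpen hy)
      (differentiableAt_const a), partialDeriv_const, add_zero]
  generalize hT : (fun y => (weingarten ψ ν y).trace) = T at *
  have hTy : ∀ y, (weingarten ψ ν y).trace = T y := fun y => congrFun hT y
  have htr0 : T x = ∑ j, lam j := by rw [← H.trace_eq, hTy]
  simp only [hTy] at *
  have hsq : ∀ y ∈ U, ∀ l, partialDeriv (fun y => T y ^ 2) l y = 2 * (T y * partialDeriv T l y) := by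
    intro y hy l
    simp only [pow_two]
    rw [partialDeriv_mul (hs.diffAt H.isOpen hy) (hs.diffAt H.isOpen hy)]
    ring
  have h0 : ∀ l, partialDeriv T l x = 0 := by
    intro l
    have := partialDeriv_eq_zero_of_isLocalMax hmax l
    rw [hsq x H.mem] at this
    simpa [hne] using this
  have hT2 : ∀ l, ContDiffOn ℝ ∞ (partialDeriv T l) U := fun l => hs.partialDeriv H.isOpen l
  have h2 : ∀ l, partialDeriv (partialDeriv (fun y => T y ^ 2) l) l x
      = 2 * (T x * partialDeriv (partialDeriv T l) l x) := by
    intro l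
    rw [partialDeriv_congr H.isOpen (fun y hy => hsq y hy l) H.mem,
      partialDeriv_mul (differentiableAt_const _) ((hs.mul (hT2 l)).diffAt H.isOpen H.mem),
      partialDeriv_mul (hs.diffAt H.isOpen H.mem) ((hT2 l).diffAt H.isOpen H.mem), h0,
      partialDeriv_const]
    ring
  have h3 : ∀ l, T x * partialDeriv (partialDeriv T l) l x ≤ 0 := by
    intro l
    have := partialDeriv_partialDeriv_nonpos H.isOpen (hs.pow 2) H.mem hmax l
    rw [h2] at this
    linarith
  -- The j-th biconservative equation is differentiated in direction j. Since dT = 0 and A is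
  -- diagonal at x, only second derivatives with k = j survive.
  have h4 : ∀ j, lam j * partialDeriv (partialDeriv T j) j x
      = -(T x / 2) * partialDeriv (partialDeriv T j) j x := by
    intro j
    have := partialDeriv_congr H.isOpen (fun y hy => hb y hy j) H.mem j
    have hd : ContDiffOn ℝ ∞ (fun y => -(T y / 2)) U := (hs.div_const 2).neg
    rw [partialDeriv_sum fun k _ => ((hT2 k).mul (H.smooth_weingarten k j)).diffAt H.isOpen H.mem,
      partialDeriv_mul (hd.diffAt H.isOpen H.mem) ((hT2 j).diffAt H.isOpen H.mem), h0, mul_zero,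
      add_zero] at this
    rw [← this, Finset.sum_eq_single j]
    · rw [partialDeriv_mul ((hT2 j).diffAt H.isOpen H.mem)
        ((H.smooth_weingarten j j).diffAt H.isOpen H.mem), h0, H.weingarten_eq,
        Matrix.diagonal_apply_eq]
      ring
    · intro k _ hkj
      rw [partialDeriv_mul ((hT2 k).diffAt H.isOpen H.mem)
        ((H.smooth_weingarten k j).diffAt H.isOpen H.mem), h0, H.weingarten_eq,
        Matrix.diagonal_apply_ne _ hkj]
      ring
    · simp
  -- The left side equals 3T·∂ₗ∂ₗT: 2T·∂ₗ∂ₗT comes from tr A² = T² + a, and T·∂ₗ∂ₗT from the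
  -- preceding identity.
  have h5 : ∀ l, partialDeriv (partialDeriv
      (fun y => (weingarten ψ ν y * weingarten ψ ν y).trace) l) l x
      - 2 * (lam l * partialDeriv (partialDeriv T l) l x) ≤ 0 := by
    intro l
    rw [hq', h2, h4]
    linarith [h3 l]
  have hterm : ∀ s l, 0 ≤ (lam s - lam l) ^ 2 * (c - lam s * lam l) := by
    intro s l
    rcases eq_or_ne s l with rfl | hsl
    · simp
    · exact mul_nonneg (sq_nonneg _) (hK s l hsl)
  have hQ : ∑ s, ∑ l, (lam s - lam l) ^ 2 * (c - lam s * lam l) ≤ 0 := by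
    have := Finset.sum_nonpos fun l (_ : l ∈ Finset.univ) => h5 l
    rw [Finset.sum_sub_distrib, ← Finset.mul_sum] at this
    linarith
  have hzero : ∀ s l, (lam s - lam l) ^ 2 * (c - lam s * lam l) = 0 := by
    have h6 := le_antisymm hQ (Finset.sum_nonneg fun s _ => Finset.sum_nonneg fun l _ => hterm s l)
    rw [Finset.sum_eq_zero_iff_of_nonneg fun s _ => Finset.sum_nonneg fun l _ => hterm s l] at h6
    intro s l
    have := h6 s (Finset.mem_univ s)
    rw [Finset.sum_eq_zero_iff_of_nonneg fun l _ => hterm s l] at this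
    exact this l (Finset.mem_univ l)
  intro hi
  have htr : ∑ j, lam j * T x = T x ^ 2 := by
    rw [← Finset.sum_mul, ← htr0, pow_two]
  -- The numbers λⱼT add up to T² > 0, so some λⱼ has the sign of T, opposite to that of λᵢ.
  obtain ⟨j, -, hj⟩ : ∃ j ∈ Finset.univ, 0 < lam j * T x := by
    apply Finset.exists_lt_of_sum_lt
    rw [htr]
    simpa using pow_pos (abs_pos.2 hne) 2
  have hneg : lam i * lam j < 0 := by rw [hi]; linarith
  have hij : lam i - lam j ≠ 0 := by
    intro h
    rw [sub_eq_zero.1 h] at hneg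
    nlinarith
  have := hzero i j
  have hpos : 0 < (lam i - lam j) ^ 2 * (c - lam i * lam j) :=
    mul_pos (by positivity) (by linarith)
  exact hpos.ne' this

end IsPrincipalGraph

end Graph

/-! ### Changes of coordinates -/

section Coordinates

variable {m : ℕ} {c : ℝ} {ψ ν : EuclideanSpace ℝ (Fin m) → EuclideanSpace ℝ (Fin (m + 2))}
  {U U' : Set (EuclideanSpace ℝ (Fin m))} {x y : EuclideanSpace ℝ (Fin m)}
  {θ : EuclideanSpace ℝ (Fin m) → EuclideanSpace ℝ (Fin m)}

/-- The Jacobian matrix. -/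
def jacobian (θ : EuclideanSpace ℝ (Fin m) → EuclideanSpace ℝ (Fin m))
    (y : EuclideanSpace ℝ (Fin m)) : Matrix (Fin m) (Fin m) ℝ :=
  Matrix.of fun i j => partialDeriv θ j y i

theorem fderiv_apply_eq_mulVec (v : EuclideanSpace ℝ (Fin m)) (i : Fin m) :
    fderiv ℝ θ y v i = (jacobian θ y *ᵥ v) i := by
  rw [fderiv_eq_sum_partialDeriv, Matrix.mulVec, dotProduct]
  simp [jacobian, mul_comm]

theorem partialDeriv_comp {W : Type*} [NormedAddCommGroup W] [NormedSpace ℝ W]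
    {F : EuclideanSpace ℝ (Fin m) → W} (hF : DifferentiableAt ℝ F (θ y))
    (hθ : DifferentiableAt ℝ θ y) (j : Fin m) :
    partialDeriv (F ∘ θ) j y = ∑ i, jacobian θ y i j • partialDeriv F i (θ y) := by
  rw [partialDeriv, fderiv_comp y hF hθ, ContinuousLinearMap.comp_apply,
    fderiv_eq_sum_partialDeriv]
  rfl

theorem jacobian_comp {ρ : EuclideanSpace ℝ (Fin m) → EuclideanSpace ℝ (Fin m)}
    (hρ : DifferentiableAt ℝ ρ (θ y)) (hθ : DifferentiableAt ℝ θ y) :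
    jacobian (ρ ∘ θ) y = jacobian ρ (θ y) * jacobian θ y := by
  ext i j
  rw [Matrix.mul_apply]
  simp only [jacobian, Matrix.of_apply]
  rw [partialDeriv_comp hρ hθ]
  simp [jacobian, mul_comm]

theorem jacobian_id : jacobian (id : EuclideanSpace ℝ (Fin m) → EuclideanSpace ℝ (Fin m)) y = 1 := by
  ext i j
  simp [jacobian, partialDeriv, Matrix.one_apply]

theorem fderiv_ne_zero_of_det (h : (jacobian θ y).det ≠ 0) {v : EuclideanSpace ℝ (Fin m)}
    (hv : v ≠ 0) : fderiv ℝ θ y v ≠ 0 := by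
  intro h0
  refine hv (WithLp.ofLp_injective 2 (Matrix.eq_zero_of_mulVec_eq_zero h ?_))
  ext i
  rw [← fderiv_apply_eq_mulVec, h0]
  rfl

theorem exists_equiv_of_det (hθ : DifferentiableAt ℝ θ y) (h : (jacobian θ y).det ≠ 0) :
    ∃ e : EuclideanSpace ℝ (Fin m) ≃L[ℝ] EuclideanSpace ℝ (Fin m),
      HasFDerivAt θ (e : EuclideanSpace ℝ (Fin m) →L[ℝ] EuclideanSpace ℝ (Fin m)) y := by
  have hinj : Function.Injective (fderiv ℝ θ y).toLinearMap := by
    rw [← LinearMap.ker_eq_bot, LinearMap.ker_eq_bot']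
    intro v hv
    by_contra hne
    exact fderiv_ne_zero_of_det h hne hv
  refine ⟨(LinearEquiv.ofInjectiveEndo _ hinj).toContinuousLinearEquiv, ?_⟩
  convert hθ.hasFDerivAt using 1
  exact ContinuousLinearMap.ext fun v => rfl

theorem contDiffOn_jacobian (hU : IsOpen U) (hθ : ContDiffOn ℝ ∞ θ U) (i j : Fin m) :
    ContDiffOn ℝ ∞ (fun y => jacobian θ y i j) U :=
  (EuclideanSpace.proj (𝕜 := ℝ) i).contDiff.comp_contDiffOn (hθ.partialDeriv hU j)

theorem exists_orthogonal_diagonalization {A : Matrix (Fin m) (Fin m) ℝ} (hA : Aᵀ = A) :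
    ∃ (V : Matrix (Fin m) (Fin m) ℝ) (d : Fin m → ℝ), Vᵀ * V = 1 ∧ Vᵀ * A * V = Matrix.diagonal d := by
  have hA' : A.IsHermitian := hA
  refine ⟨hA'.eigenvectorUnitary, hA'.eigenvalues, ?_, ?_⟩
  · have := Unitary.coe_star_mul_self hA'.eigenvectorUnitary
    exact this
  · have := hA'.conjStarAlgAut_star_eigenvectorUnitary
    rw [Unitary.conjStarAlgAut_star_apply] at this
    exact this

/-- First S makes g the identity; the remaining orthogonal change preserves this and diagonalises
the transformed h. For the two fundamental forms the columns of T are orthonormal principal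
directions. -/
theorem exists_simultaneous_diagonalization {g h : Matrix (Fin m) (Fin m) ℝ} (hg : g.PosDef)
    (hh : hᵀ = h) : ∃ (T : Matrix (Fin m) (Fin m) ℝ) (lam : Fin m → ℝ),
      Tᵀ * g * T = 1 ∧ Tᵀ * h * T = Matrix.diagonal lam := by
  obtain ⟨V, d, hV, hVd⟩ := exists_orthogonal_diagonalization (A := g) hg.isHermitian
  have hd : ∀ i, 0 < d i := by
    intro i
    have hinj : Function.Injective V.mulVec := by
      intro v w hvw
      have := congrArg (Vᵀ *ᵥ ·) hvw
      simpa only [Matrix.mulVec_mulVec, hV, Matrix.one_mulVec] using this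
    have h1 := hg.conjTranspose_mul_mul_same hinj
    rw [Matrix.conjTranspose_eq_transpose_of_trivial, hVd, Matrix.posDef_diagonal_iff] at h1
    exact h1 i
  let S := V * Matrix.diagonal fun i => (√(d i))⁻¹
  have hS : Sᵀ * g * S = 1 := by
    have : Sᵀ * g * S = Matrix.diagonal (fun i => (√(d i))⁻¹) * (Vᵀ * g * V) *
        Matrix.diagonal fun i => (√(d i))⁻¹ := by
      simp only [S, Matrix.transpose_mul, Matrix.diagonal_transpose, Matrix.mul_assoc]
    rw [this, hVd, Matrix.diagonal_mul_diagonal, Matrix.diagonal_mul_diagonal,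
      ← Matrix.diagonal_one]
    congr 1
    ext i
    have := Real.sqrt_pos.2 (hd i)
    field_simp
    exact (Real.sq_sqrt (hd i).le).symm
  obtain ⟨V', lam, hV', hlam⟩ := exists_orthogonal_diagonalization (A := Sᵀ * h * S) (by
    simp only [Matrix.transpose_mul, Matrix.transpose_transpose, hh, Matrix.mul_assoc])
  refine ⟨S * V', lam, ?_, ?_⟩
  · calc (S * V')ᵀ * g * (S * V') = V'ᵀ * (Sᵀ * g * S) * V' := by
          simp only [Matrix.transpose_mul, Matrix.mul_assoc]
      _ = 1 := by rw [hS, Matrix.mul_one, hV']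
  · rw [← hlam]
    simp only [Matrix.transpose_mul, Matrix.mul_assoc]

namespace IsLocalHypersurface

theorem comp (H : IsLocalHypersurface c ψ ν U) (hU' : IsOpen U') (hθ : ContDiffOn ℝ ∞ θ U')
    (hmaps : Set.MapsTo θ U' U) (hdet : ∀ y ∈ U', (jacobian θ y).det ≠ 0) :
    IsLocalHypersurface c (ψ ∘ θ) (ν ∘ θ) U' where
  isOpen := hU'
  smooth := H.smooth.comp hθ hmaps
  smooth_normal := H.smooth_normal.comp hθ hmaps
  mem_deSitter y hy := H.mem_deSitter _ (hmaps hy)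
  tangent_deSitter y hy := H.tangent_deSitter _ (hmaps hy)
  normal y hy v := by
    rw [fderiv_comp y (H.smooth.diffAt H.isOpen (hmaps hy)) (hθ.diffAt hU' hy)]
    exact H.normal _ (hmaps hy) _
  unit y hy := H.unit _ (hmaps hy)
  spacelike y hy v hv := by
    rw [fderiv_comp y (H.smooth.diffAt H.isOpen (hmaps hy)) (hθ.diffAt hU' hy)]
    exact H.spacelike _ (hmaps hy) _ (fderiv_ne_zero_of_det (hdet y hy) hv)

variable (H : IsLocalHypersurface c ψ ν U) (hθ : DifferentiableAt ℝ θ y) (hy : θ y ∈ U)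

include H hθ hy

theorem firstForm_comp : firstForm (ψ ∘ θ) y
    = (jacobian θ y)ᵀ * firstForm ψ (θ y) * jacobian θ y := by
  ext i j
  have hd := H.smooth.diffAt H.isOpen hy
  rw [firstForm_apply, partialDeriv_comp hd hθ, partialDeriv_comp hd hθ, lorentz_sum_right,
    Matrix.mul_apply]
  refine Finset.sum_congr rfl fun k _ => ?_
  rw [Matrix.mul_apply, lorentz_sum_left, Finset.sum_mul]
  refine Finset.sum_congr rfl fun l _ => ?_
  rw [lorentz_smul_left, lorentz_smul_right, Matrix.transpose_apply, firstForm_apply]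
  ring

theorem secondForm_comp : secondForm (ψ ∘ θ) (ν ∘ θ) y
    = (jacobian θ y)ᵀ * secondForm ψ ν (θ y) * jacobian θ y := by
  ext i j
  have hd := H.smooth.diffAt H.isOpen hy
  have hd' := H.smooth_normal.diffAt H.isOpen hy
  simp only [secondForm, Matrix.of_apply]
  rw [partialDeriv_comp hd hθ, partialDeriv_comp hd' hθ, lorentz_sum_right,
    Matrix.mul_apply, ← Finset.sum_neg_distrib]
  refine Finset.sum_congr rfl fun k _ => ?_
  rw [Matrix.mul_apply, lorentz_sum_left, Finset.sum_mul, ← Finset.sum_neg_distrib]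
  refine Finset.sum_congr rfl fun l _ => ?_
  rw [lorentz_smul_left, lorentz_smul_right, Matrix.transpose_apply, Matrix.of_apply]
  ring

/-- Both forms transform by congruence, so the shape operator transforms by conjugation and its
traces do not depend on the coordinates. -/
theorem weingarten_comp (hdet : (jacobian θ y).det ≠ 0) : weingarten (ψ ∘ θ) (ν ∘ θ) y
    = (jacobian θ y)⁻¹ * weingarten ψ ν (θ y) * jacobian θ y := by
  have hu : IsUnit (jacobian θ y).det := isUnit_iff_ne_zero.2 hdet
  have hut : IsUnit ((jacobian θ y)ᵀ).det := by rwa [Matrix.det_transpose]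
  rw [weingarten, weingarten, H.firstForm_comp hθ hy, H.secondForm_comp hθ hy,
    Matrix.mul_inv_rev, Matrix.mul_inv_rev]
  simp only [Matrix.mul_assoc]
  rw [Matrix.nonsing_inv_mul_cancel_left _ _ hut]

theorem trace_weingarten_comp (hdet : (jacobian θ y).det ≠ 0) :
    (weingarten (ψ ∘ θ) (ν ∘ θ) y).trace = (weingarten ψ ν (θ y)).trace := by
  have hu : IsUnit (jacobian θ y).det := isUnit_iff_ne_zero.2 hdet
  rw [H.weingarten_comp hθ hy hdet, Matrix.mul_assoc, Matrix.trace_mul_comm, Matrix.mul_assoc,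
    Matrix.mul_nonsing_inv _ hu, Matrix.mul_one]

theorem trace_weingarten_sq_comp (hdet : (jacobian θ y).det ≠ 0) :
    (weingarten (ψ ∘ θ) (ν ∘ θ) y * weingarten (ψ ∘ θ) (ν ∘ θ) y).trace
      = (weingarten ψ ν (θ y) * weingarten ψ ν (θ y)).trace := by
  have hu : IsUnit (jacobian θ y).det := isUnit_iff_ne_zero.2 hdet
  rw [H.weingarten_comp hθ hy hdet]
  simp only [Matrix.mul_assoc]
  rw [Matrix.mul_nonsing_inv_cancel_left _ _ hu, Matrix.trace_mul_comm]
  simp only [Matrix.mul_assoc]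
  rw [Matrix.mul_nonsing_inv _ hu, Matrix.mul_one]

end IsLocalHypersurface

/-- Around every point there are graph coordinates in principal directions. -/
theorem IsLocalHypersurface.exists_principalGraph (H : IsLocalHypersurface c ψ ν U) (hx : x ∈ U) :
    ∃ (θ : EuclideanSpace ℝ (Fin m) → EuclideanSpace ℝ (Fin m))
      (U' : Set (EuclideanSpace ℝ (Fin m))) (lam : Fin m → ℝ),
      θ 0 = x ∧ ContDiffOn ℝ ∞ θ U' ∧ Set.MapsTo θ U' U ∧
      (∀ y ∈ U', (jacobian θ y).det ≠ 0) ∧ IsPrincipalGraph c (ψ ∘ θ) (ν ∘ θ) U' 0 lam := by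
  obtain ⟨T, lam, hT1, hT2⟩ := exists_simultaneous_diagonalization (H.posDef hx)
    (H.secondForm_transpose hx)
  -- These are the orthonormal principal directions at x, and ρ below gives the coordinates of the
  -- projection to the tangent space at x. The local inverse of ρ is the graph parametrization.
  let P : Fin m → EuclideanSpace ℝ (Fin (m + 2)) := fun s => ∑ i, T i s • partialDeriv ψ i x
  let ρ : EuclideanSpace ℝ (Fin m) → EuclideanSpace ℝ (Fin m) := fun y =>
    WithLp.toLp 2 fun s => lorentz (ψ y - ψ x) (P s)
  have hρ : ContDiffOn ℝ ∞ ρ U := by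
    rw [contDiffOn_euclidean]
    intro s
    exact (H.smooth.sub contDiffOn_const).lorentz contDiffOn_const
  have hρx : ρ x = 0 := by
    ext s
    simp [ρ, lorentz_zero_left]
  have hρd : ∀ y ∈ U, ∀ i s, partialDeriv ρ i y s = lorentz (partialDeriv ψ i y) (P s) := by
    intro y hy i s
    have h1 := partialDeriv_clm (hρ.diffAt H.isOpen hy) (EuclideanSpace.proj (𝕜 := ℝ) s) i
    refine h1.symm.trans ?_
    change partialDeriv (fun y => lorentz (ψ y - ψ x) (P s)) i y = _
    rw [partialDeriv_lorentz ((H.smooth.diffAt H.isOpen hy).sub_const _)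
      (differentiableAt_const _), partialDeriv_const, lorentz_zero_right, add_zero,
      partialDeriv_sub (H.smooth.diffAt H.isOpen hy) (differentiableAt_const _),
      partialDeriv_const, sub_zero]
  have hjx : jacobian ρ x = Tᵀ * firstForm ψ x := by
    ext s i
    rw [Matrix.mul_apply]
    simp only [jacobian, Matrix.of_apply]
    rw [hρd x hx, lorentz_sum_right]
    refine Finset.sum_congr rfl fun k _ => ?_
    rw [lorentz_smul_right, Matrix.transpose_apply, firstForm_symm, firstForm_apply]
  have hdetx : (jacobian ρ x).det ≠ 0 := by
    rw [hjx]
    intro h0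
    have := congrArg Matrix.det hT1
    rw [Matrix.det_mul, h0, zero_mul, Matrix.det_one] at this
    exact zero_ne_one this
  obtain ⟨e, he⟩ := exists_equiv_of_det (hρ.diffAt H.isOpen hx) hdetx
  have hρx' : ContDiffAt ℝ ∞ ρ x := hρ.contDiffAt (H.isOpen.mem_nhds hx)
  let Φ := hρx'.toOpenPartialHomeomorph ρ he (by simp)
  have hΦ : ∀ y, Φ y = ρ y := fun y => by
    rw [hρx'.toOpenPartialHomeomorph_coe he (by simp)]
  have hxs : x ∈ Φ.source := hρx'.mem_toOpenPartialHomeomorph_source he (by simp)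
  -- The inverse function theorem supplies an invertible derivative at x only; shrinking to S
  -- supplies it at every point used.
  let S : Set (EuclideanSpace ℝ (Fin m)) := U ∩ {z | (jacobian ρ z).det ≠ 0}
  have hS : IsOpen S := (contDiffOn_det (contDiffOn_jacobian H.isOpen hρ)).continuousOn.isOpen_inter_preimage
    H.isOpen isOpen_compl_singleton
  let U' := Φ.target ∩ Φ.symm ⁻¹' S
  have hU' : IsOpen U' := Φ.isOpen_inter_preimage_symm hS
  let θ : EuclideanSpace ℝ (Fin m) → EuclideanSpace ℝ (Fin m) := Φ.symm
  have hθ0 : θ 0 = x := by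
    rw [← hρx, ← hΦ]; exact Φ.left_inv hxs
  have hmaps : Set.MapsTo θ U' U := fun y hy => hy.2.1
  have hinv : ∀ y ∈ U', ρ (θ y) = y := fun y hy => by
    rw [← hΦ]; exact Φ.right_inv hy.1
  have hθ : ContDiffOn ℝ ∞ θ U' := by
    intro y hy
    obtain ⟨e', he'⟩ := exists_equiv_of_det (hρ.diffAt H.isOpen hy.2.1) hy.2.2
    have hΦe : (Φ : EuclideanSpace ℝ (Fin m) → EuclideanSpace ℝ (Fin m)) = ρ := funext hΦ
    refine (Φ.contDiffAt_symm hy.1 (f₀' := e') ?_ ?_).contDiffWithinAt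
    · rw [hΦe]; exact he'
    · rw [hΦe]; exact hρ.contDiffAt (H.isOpen.mem_nhds hy.2.1)
  have hj : ∀ y ∈ U', jacobian ρ (θ y) * jacobian θ y = 1 := by
    intro y hy
    rw [← jacobian_comp (hρ.diffAt H.isOpen (hmaps hy)) (hθ.diffAt hU' hy), ← jacobian_id (y := y)]
    ext i j
    simp only [jacobian, Matrix.of_apply]
    rw [partialDeriv_congr hU' (F := ρ ∘ θ) (G := id) hinv hy]
  have hdet : ∀ y ∈ U', (jacobian θ y).det ≠ 0 := by
    intro y hy h0
    have := congrArg Matrix.det (hj y hy)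
    rw [Matrix.det_mul, h0, mul_zero, Matrix.det_one] at this
    exact zero_ne_one this
  have h0 : (0 : EuclideanSpace ℝ (Fin m)) ∈ U' := by
    refine ⟨?_, ?_⟩
    · rw [← hρx, ← hΦ]; exact Φ.map_source hxs
    · change θ 0 ∈ S
      rw [hθ0]
      exact ⟨hx, hdetx⟩
  -- The Jacobian of ρ at x is Tᵀg, whose inverse is T because TᵀgT = 1.
  have hjT : jacobian θ 0 = T := by
    have h1 := hj 0 h0
    rw [hθ0, hjx] at h1
    have h2 := mul_eq_one_comm.1 hT1
    calc jacobian θ 0 = T * (Tᵀ * firstForm ψ x) * jacobian θ 0 := by rw [h2, Matrix.one_mul]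
      _ = T := by rw [Matrix.mul_assoc, h1, Matrix.mul_one]
  have H' := H.comp hU' hθ hmaps hdet
  refine ⟨θ, U', lam, hθ0, hθ, hmaps, hdet, { H' with mem := h0, graph := ?_, principal := ?_ }⟩
  · intro y hy i s
    have hP : partialDeriv (ψ ∘ θ) s 0 = P s := by
      rw [partialDeriv_comp (H.smooth.diffAt H.isOpen (hmaps h0)) (hθ.diffAt hU' h0), hjT, hθ0]
    rw [hP, partialDeriv_comp (H.smooth.diffAt H.isOpen (hmaps hy)) (hθ.diffAt hU' hy),
      lorentz_sum_left]
    have := congrFun (congrFun (hj y hy) s) i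
    rw [Matrix.mul_apply] at this
    rw [← Matrix.transpose_one, Matrix.transpose_apply, ← this]
    refine Finset.sum_congr rfl fun k _ => ?_
    rw [lorentz_smul_left, ← hρd _ (hmaps hy), mul_comm]
    rfl
  · rw [H.secondForm_comp (hθ.diffAt hU' h0) (hmaps h0), hjT, hθ0, hT2]

end Coordinates

/-! ### Transfer of the pointwise results from graph coordinates to arbitrary coordinates -/

section LocalMaximum

variable {m : ℕ} {c : ℝ} {ψ ν : EuclideanSpace ℝ (Fin m) → EuclideanSpace ℝ (Fin (m + 2))}
  {U : Set (EuclideanSpace ℝ (Fin m))} {x : EuclideanSpace ℝ (Fin m)}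

namespace IsLocalHypersurface

variable (H : IsLocalHypersurface c ψ ν U)

include H

/-- Sectional curvature of a plane spanned by orthonormal principal directions. -/
theorem le_of_sectional_nonneg (hc : 0 < c) (hx : x ∈ U)
    (hsec : ∀ v w : EuclideanSpace ℝ (Fin m), LinearIndependent ℝ ![v, w] →
      0 ≤ coordSectional (firstForm ψ) x v w)
    {T : Matrix (Fin m) (Fin m) ℝ} {lam : Fin m → ℝ} (hT : Tᵀ * firstForm ψ x * T = 1)
    (hlam : Tᵀ * secondForm ψ ν x * T = Matrix.diagonal lam) {s l : Fin m} (hsl : s ≠ l) :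
    0 ≤ c - lam s * lam l := by
  let v : Fin m → EuclideanSpace ℝ (Fin m) := fun s => WithLp.toLp 2 (T.col s)
  have hA : ∀ (A : Matrix (Fin m) (Fin m) ℝ) (i j : Fin m),
      (v i : Fin m → ℝ) ⬝ᵥ (A *ᵥ v j) = (Tᵀ * A * T) i j := by
    intro A i j
    rw [Matrix.mul_assoc, Matrix.mul_apply, dotProduct]
    refine Finset.sum_congr rfl fun k _ => ?_
    rw [Matrix.mul_apply]
    rfl
  have hg : ∀ i j, (v i : Fin m → ℝ) ⬝ᵥ (firstForm ψ x *ᵥ v j)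
      = (1 : Matrix (Fin m) (Fin m) ℝ) i j := fun i j => by rw [hA, hT]
  have hh : ∀ i j, (v i : Fin m → ℝ) ⬝ᵥ (secondForm ψ ν x *ᵥ v j)
      = Matrix.diagonal lam i j := fun i j => by rw [hA, hlam]
  have hli : LinearIndependent ℝ ![v s, v l] := by
    rw [LinearIndependent.pair_iff]
    intro a b hab
    have key : ∀ i, a * (1 : Matrix (Fin m) (Fin m) ℝ) i s
        + b * (1 : Matrix (Fin m) (Fin m) ℝ) i l = 0 := by
      intro i
      rw [← hg, ← hg, ← smul_eq_mul, ← smul_eq_mul, ← dotProduct_smul, ← dotProduct_smul,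
        ← dotProduct_add, ← Matrix.mulVec_smul, ← Matrix.mulVec_smul, ← Matrix.mulVec_add]
      have : a • (v s : Fin m → ℝ) + b • (v l : Fin m → ℝ) = 0 := congrArg WithLp.ofLp hab
      rw [this, Matrix.mulVec_zero, dotProduct_zero]
    have h1 := key s
    have h2 := key l
    simp only [Matrix.one_apply_eq, Matrix.one_apply_ne hsl, Matrix.one_apply_ne hsl.symm] at h1 h2
    exact ⟨by linarith, by linarith⟩
  have h := hsec _ _ hli
  rw [coordSectional, H.sectional_numerator hc hx, coordInner_eq, coordInner_eq, coordInner_eq] at h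
  simp only [hg, hh, Matrix.one_apply_eq, Matrix.one_apply_ne hsl, Matrix.diagonal_apply_eq,
    Matrix.diagonal_apply_ne _ hsl] at h
  simpa using h

/-- This is `principal_ne` in arbitrary coordinates. Invertibility of A + T/2 survives conjugation
by the Jacobian and, unlike a statement about eigenvalues at one point, is visibly an open
condition. -/
theorem det_weingarten_add_ne_zero (hc : 0 < c) (hx : x ∈ U) {a : ℝ}
    (hq : ∀ y ∈ U, (weingarten ψ ν y * weingarten ψ ν y).trace = (weingarten ψ ν y).trace ^ 2 + a)
    (hb : ∀ y ∈ U, (fun k => partialDeriv (fun y => (weingarten ψ ν y).trace) k y) ᵥ*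
      weingarten ψ ν y = -((weingarten ψ ν y).trace / 2) •
        fun k => partialDeriv (fun y => (weingarten ψ ν y).trace) k y)
    (hmax : IsLocalMax (fun y => (weingarten ψ ν y).trace ^ 2) x)
    (hne : (weingarten ψ ν x).trace ≠ 0)
    (hsec : ∀ v w : EuclideanSpace ℝ (Fin m), LinearIndependent ℝ ![v, w] →
      0 ≤ coordSectional (firstForm ψ) x v w) :
    (weingarten ψ ν x + ((weingarten ψ ν x).trace / 2) • 1).det ≠ 0 := by
  obtain ⟨θ, U', lam, rfl, hθ, hmaps, hdet, H'⟩ := H.exists_principalGraph hx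
  have hθd : ∀ y ∈ U', DifferentiableAt ℝ θ y := fun y hy => hθ.diffAt H'.isOpen hy
  have htr : ∀ y ∈ U', (weingarten (ψ ∘ θ) (ν ∘ θ) y).trace = (weingarten ψ ν (θ y)).trace :=
    fun y hy => H.trace_weingarten_comp (hθd y hy) (hmaps hy) (hdet y hy)
  have hsm : ContDiffOn ℝ ∞ (fun y => (weingarten ψ ν y).trace) U :=
    ContDiffOn.sum fun i _ => H.smooth_weingarten i i
  -- The differential of the trace transforms as a row vector by the Jacobian that conjugates A, so
  -- the row-vector form of biconservativity carries over.
  have hdtr : ∀ y ∈ U', (fun k => partialDeriv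
      (fun y => (weingarten (ψ ∘ θ) (ν ∘ θ) y).trace) k y)
      = (fun k => partialDeriv (fun y => (weingarten ψ ν y).trace) k (θ y)) ᵥ* jacobian θ y := by
    intro y hy
    ext k
    rw [partialDeriv_congr H'.isOpen htr hy]
    refine (partialDeriv_comp (hsm.diffAt H.isOpen (hmaps hy)) (hθd y hy) k).trans ?_
    exact Finset.sum_congr rfl fun i _ => mul_comm _ _
  have key : ∀ i, lam i ≠ -((weingarten (ψ ∘ θ) (ν ∘ θ) 0).trace / 2) := by
    refine H'.principal_ne hc (a := a) (fun y hy => ?_) (fun y hy j => ?_) ?_ ?_ ?_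
    · rw [htr y hy, H.trace_weingarten_sq_comp (hθd y hy) (hmaps hy) (hdet y hy),
        hq _ (hmaps hy)]
    · have hu : IsUnit (jacobian θ y).det := isUnit_iff_ne_zero.2 (hdet y hy)
      have h1 : (fun k => partialDeriv (fun y => (weingarten (ψ ∘ θ) (ν ∘ θ) y).trace) k y) ᵥ*
          weingarten (ψ ∘ θ) (ν ∘ θ) y = -((weingarten (ψ ∘ θ) (ν ∘ θ) y).trace / 2) •
          fun k => partialDeriv (fun y => (weingarten (ψ ∘ θ) (ν ∘ θ) y).trace) k y := by
        rw [hdtr y hy, H.weingarten_comp (hθd y hy) (hmaps hy) (hdet y hy), Matrix.vecMul_vecMul,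
          Matrix.mul_assoc, Matrix.mul_nonsing_inv_cancel_left _ _ hu, ← Matrix.vecMul_vecMul,
          hb _ (hmaps hy), Matrix.smul_vecMul, ← Matrix.mul_assoc,
          ← H.weingarten_comp (hθd y hy) (hmaps hy) (hdet y hy), htr y hy]
      exact congrFun h1 j
    · have h1 : IsLocalMax ((fun y => (weingarten ψ ν y).trace ^ 2) ∘ θ) 0 :=
        (hθd 0 H'.mem).continuousAt.eventually hmax
      refine h1.congr ?_
      filter_upwards [H'.isOpen.mem_nhds H'.mem] with y hy
      rw [htr y hy]
      rfl
    · rwa [htr 0 H'.mem]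
    · intro s l hsl
      exact H.le_of_sectional_nonneg hc hx hsec
        (by rw [← H.firstForm_comp (hθd 0 H'.mem) hx, H'.firstForm_eq_one])
        (by rw [← H.secondForm_comp (hθd 0 H'.mem) hx, H'.principal]) hsl
  rw [htr 0 H'.mem] at key
  have hu : IsUnit (jacobian θ 0).det := isUnit_iff_ne_zero.2 (hdet 0 H'.mem)
  generalize hτ : (weingarten ψ ν (θ 0)).trace / 2 = τ at *
  have h1 : (jacobian θ 0)⁻¹ * (weingarten ψ ν (θ 0) + τ • 1) * jacobian θ 0
      = Matrix.diagonal fun i => lam i + τ := by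
    rw [Matrix.mul_add, Matrix.add_mul, ← H.weingarten_comp (hθd 0 H'.mem) hx (hdet 0 H'.mem),
      H'.weingarten_eq, Matrix.mul_smul, Matrix.mul_one, Matrix.smul_mul,
      Matrix.nonsing_inv_mul _ hu, Matrix.smul_one_eq_diagonal, Matrix.diagonal_add]
  intro h0
  have h2 := congrArg Matrix.det h1
  rw [Matrix.det_mul, Matrix.det_mul, h0, mul_zero, zero_mul, Matrix.det_diagonal] at h2
  obtain ⟨i, -, hi⟩ := Finset.prod_eq_zero_iff.1 h2.symm
  exact key i (by linarith)

/-- At a maximum of a coordinate of a combination of position and normal vector, its Laplacian is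
non-positive. -/
theorem laplacian_nonpos (hc : 0 < c) (hx : x ∈ U)
    (h : ∀ y ∈ U, ∀ k, partialDeriv (fun y => (weingarten ψ ν y).trace) k y = 0) (α β : ℝ)
    (i : Fin (m + 2)) (hmax : IsLocalMax (fun y => (α • ψ y + β • ν y) i) x) :
    (α • (-((m * c) • ψ x) - (weingarten ψ ν x).trace • ν x)
      + β • ((c * (weingarten ψ ν x).trace) • ψ x
        + (weingarten ψ ν x * weingarten ψ ν x).trace • ν x)) i ≤ 0 := by
  obtain ⟨θ, U', lam, rfl, hθ, hmaps, hdet, H'⟩ := H.exists_principalGraph hx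
  have hθd : ∀ y ∈ U', DifferentiableAt ℝ θ y := fun y hy => hθ.diffAt H'.isOpen hy
  have htr : ∀ y ∈ U', (weingarten (ψ ∘ θ) (ν ∘ θ) y).trace = (weingarten ψ ν (θ y)).trace :=
    fun y hy => H.trace_weingarten_comp (hθd y hy) (hmaps hy) (hdet y hy)
  have hsm : ContDiffOn ℝ ∞ (fun y => (weingarten ψ ν y).trace) U :=
    ContDiffOn.sum fun i _ => H.smooth_weingarten i i
  have h0 : ∀ k, partialDeriv (fun y => (weingarten (ψ ∘ θ) (ν ∘ θ) y).trace) k 0 = 0 := by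
    intro k
    rw [partialDeriv_congr H'.isOpen htr H'.mem]
    refine (partialDeriv_comp (hsm.diffAt H.isOpen hx) (hθd 0 H'.mem) k).trans ?_
    exact Finset.sum_eq_zero fun i _ => by rw [h _ hx, smul_zero]
  have hmax' : IsLocalMax (fun y => (α • (ψ ∘ θ) y + β • (ν ∘ θ) y) i) 0 :=
    (hθd 0 H'.mem).continuousAt.eventually hmax
  let F : EuclideanSpace ℝ (Fin m) → EuclideanSpace ℝ (Fin (m + 2)) :=
    fun y => α • (ψ ∘ θ) y + β • (ν ∘ θ) y
  have hα : ContDiffOn ℝ ∞ (fun y => α • (ψ ∘ θ) y) U' := H'.smooth.const_smul α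
  have hβ : ContDiffOn ℝ ∞ (fun y => β • (ν ∘ θ) y) U' := H'.smooth_normal.const_smul β
  have hF : ContDiffOn ℝ ∞ F U' := hα.add hβ
  have hFi : ContDiffOn ℝ ∞ (fun y => F y i) U' :=
    (EuclideanSpace.proj (𝕜 := ℝ) i).contDiff.comp_contDiffOn hF
  have hp : ∀ (G : EuclideanSpace ℝ (Fin m) → EuclideanSpace ℝ (Fin (m + 2))),
      ContDiffOn ℝ ∞ G U' → ∀ l, ∀ y ∈ U', partialDeriv (fun y => G y i) l y
        = partialDeriv G l y i := fun G hG l y hy =>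
    partialDeriv_clm (hG.diffAt H'.isOpen hy) (EuclideanSpace.proj (𝕜 := ℝ) i) l
  have hs : ∀ (a : ℝ) (G : EuclideanSpace ℝ (Fin m) → EuclideanSpace ℝ (Fin (m + 2))),
      ContDiffOn ℝ ∞ G U' → ∀ l, ∀ y ∈ U', partialDeriv (fun y => a • G y) l y
        = a • partialDeriv G l y := fun a G hG l y hy => by
    rw [partialDeriv_smul (differentiableAt_const a) (hG.diffAt H'.isOpen hy),
      partialDeriv_const, zero_smul, add_zero]
  have h1 : ∀ l, ∀ y ∈ U', partialDeriv F l y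
      = α • partialDeriv (ψ ∘ θ) l y + β • partialDeriv (ν ∘ θ) l y := fun l y hy => by
    rw [partialDeriv_add (hα.diffAt H'.isOpen hy) (hβ.diffAt H'.isOpen hy),
      hs α _ H'.smooth l y hy, hs β _ H'.smooth_normal l y hy]
  have h2 : ∀ l, partialDeriv (partialDeriv (fun y => F y i) l) l 0
      = (α • partialDeriv (partialDeriv (ψ ∘ θ) l) l 0
        + β • partialDeriv (partialDeriv (ν ∘ θ) l) l 0) i := by
    intro l
    have e1 := H'.smooth_partial l
    have e2 := H'.smooth_partial_normal l
    rw [partialDeriv_congr H'.isOpen (fun y hy => hp F hF l y hy) H'.mem,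
      hp _ (hF.partialDeriv H'.isOpen l) l 0 H'.mem,
      partialDeriv_congr H'.isOpen (h1 l) H'.mem,
      partialDeriv_add ((e1.const_smul α).diffAt H'.isOpen H'.mem)
        ((e2.const_smul β).diffAt H'.isOpen H'.mem), hs α _ e1 l 0 H'.mem, hs β _ e2 l 0 H'.mem]
  -- At the centre of the graph coordinates the Laplacian is this sum of pure second derivatives,
  -- each non-positive at a maximum.
  have h3 := Finset.sum_nonpos fun l (_ : l ∈ Finset.univ) =>
    partialDeriv_partialDeriv_nonpos H'.isOpen hFi H'.mem hmax' l
  rw [Finset.sum_congr rfl fun l _ => h2 l] at h3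
  rw [← htr 0 H'.mem, ← H.trace_weingarten_sq_comp (hθd 0 H'.mem) hx (hdet 0 H'.mem), H'.trace_eq,
    H'.trace_sq_eq]
  have e1 := H'.laplacian_position hc
  have e2 := H'.laplacian_normal hc h0
  simp only [Function.comp_apply] at e1 e2
  rw [← e1, ← e2, Finset.smul_sum, Finset.smul_sum, ← Finset.sum_add_distrib]
  simpa using h3

/-- A is self-adjoint for the first form, hence diagonalisable with real eigenvalues, although its
coordinate matrix need not be symmetric. -/
theorem exists_weingarten_eq (hx : x ∈ U) :
    ∃ (T S : Matrix (Fin m) (Fin m) ℝ) (lam : Fin m → ℝ), T * S = 1 ∧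
      weingarten ψ ν x = T * Matrix.diagonal lam * S ∧ (weingarten ψ ν x).trace = ∑ i, lam i ∧
      (weingarten ψ ν x * weingarten ψ ν x).trace = ∑ i, lam i ^ 2 := by
  obtain ⟨T, lam, hT, hlam⟩ := exists_simultaneous_diagonalization (H.posDef hx)
    (H.secondForm_transpose hx)
  have hT2 : T * (Tᵀ * firstForm ψ x) = 1 := mul_eq_one_comm.1 hT
  have hW : weingarten ψ ν x = T * Matrix.diagonal lam * (Tᵀ * firstForm ψ x) := by
    have hTT : T * Tᵀ * firstForm ψ x = 1 := by rw [Matrix.mul_assoc, hT2]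
    have hinv : (firstForm ψ x)⁻¹ = T * Tᵀ := Matrix.inv_eq_left_inv hTT
    rw [weingarten, hinv, ← hlam]
    calc T * Tᵀ * secondForm ψ ν x = T * Tᵀ * secondForm ψ ν x * (T * (Tᵀ * firstForm ψ x)) := by
          rw [hT2, Matrix.mul_one]
      _ = _ := by simp only [Matrix.mul_assoc]
  refine ⟨T, Tᵀ * firstForm ψ x, lam, hT2, hW, ?_, ?_⟩
  · rw [hW, Matrix.mul_assoc, Matrix.trace_mul_comm, Matrix.mul_assoc, hT, Matrix.mul_one,
      Matrix.trace_diagonal]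
  · have : weingarten ψ ν x * weingarten ψ ν x
        = T * (Matrix.diagonal lam * Matrix.diagonal lam * (Tᵀ * firstForm ψ x)) := by
      rw [hW]
      calc _ = T * (Matrix.diagonal lam * (Tᵀ * firstForm ψ x * T) * Matrix.diagonal lam *
            (Tᵀ * firstForm ψ x)) := by simp only [Matrix.mul_assoc]
        _ = _ := by rw [hT, Matrix.mul_one]
    rw [this, Matrix.trace_mul_comm, Matrix.mul_assoc, hT, Matrix.mul_one,
      Matrix.diagonal_mul_diagonal, Matrix.trace_diagonal]
    exact Finset.sum_congr rfl fun i _ => (pow_two _).symm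

theorem sq_trace_le (hx : x ∈ U) :
    (weingarten ψ ν x).trace ^ 2 ≤ m * (weingarten ψ ν x * weingarten ψ ν x).trace := by
  obtain ⟨T, S, lam, -, -, h1, h2⟩ := H.exists_weingarten_eq hx
  rw [h1, h2]
  simpa using sq_sum_le_card_mul_sum_sq (s := Finset.univ) (f := lam)

/-- If the traceless part of the shape operator vanishes then it is a multiple of the identity. -/
theorem weingarten_eq_smul_one (hx : x ∈ U) (hm : m ≠ 0)
    (h : m * (weingarten ψ ν x * weingarten ψ ν x).trace = (weingarten ψ ν x).trace ^ 2) :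
    weingarten ψ ν x = ((weingarten ψ ν x).trace / m) • 1 := by
  obtain ⟨T, S, lam, hT2, hW, htr, htr2⟩ := H.exists_weingarten_eq hx
  rw [htr, htr2] at h
  have hm' : (m : ℝ) ≠ 0 := by exact_mod_cast hm
  -- The sum of squared deviations from the mean is tr A² - T²/m.
  have hsum : ∑ i, (lam i - (∑ j, lam j) / m) ^ 2 = 0 := by
    simp only [sub_sq, Finset.sum_add_distrib, Finset.sum_sub_distrib, ← Finset.sum_mul,
      ← Finset.mul_sum, Finset.sum_const, Finset.card_univ, Fintype.card_fin, nsmul_eq_mul]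
    generalize ∑ j, lam j = τ at *
    field_simp
    linarith
  have hlam' : ∀ i, lam i = (∑ j, lam j) / m := by
    intro i
    have := (Finset.sum_eq_zero_iff_of_nonneg fun i _ => sq_nonneg _).1 hsum i (Finset.mem_univ i)
    exact sub_eq_zero.1 (pow_eq_zero_iff two_ne_zero |>.1 this)
  have hdiag : Matrix.diagonal lam = ((∑ j, lam j) / m) • (1 : Matrix (Fin m) (Fin m) ℝ) := by
    rw [Matrix.smul_one_eq_diagonal]
    congr 1
    ext i
    exact hlam' i
  rw [htr, hW, hdiag, Matrix.mul_smul, Matrix.smul_mul, Matrix.mul_one, hT2]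

end IsLocalHypersurface

end LocalMaximum

/-! ### Hypersurfaces in charts -/

section Charts

variable {m : ℕ} {c : ℝ} {M : Type*} [TopologicalSpace M]
  [ChartedSpace (EuclideanSpace ℝ (Fin m)) M]
  {W : Type*} [NormedAddCommGroup W] [NormedSpace ℝ W]

/-- A function on `M` in the preferred chart at `p`. -/
def inChart {W : Type*} (F : M → W) (p : M) : EuclideanSpace ℝ (Fin m) → W :=
  F ∘ (extChartAt (𝓡 m) p).symm

theorem inChart_self {W : Type*} (F : M → W) (p : M) :
    inChart F p (extChartAt (𝓡 m) p p) = F p := by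
  rw [inChart, Function.comp_apply, extChartAt_to_inv]

/-- This applies only at the centre of the chart, since the tangent space at p is identified with
the coordinate space through the preferred chart at p. Other points need a coordinate change. -/
theorem diff_eq_fderiv {F : M → W} {p : M} (hF : MDifferentiableAt (𝓡 m) 𝓘(ℝ, W) F p)
    (v : TangentSpace (𝓡 m) p) :
    diff F p v = fderiv ℝ (inChart F p) (extChartAt (𝓡 m) p p) v := by
  have h : mfderiv (𝓡 m) 𝓘(ℝ, W) F p
      = fderivWithin ℝ (inChart F p) (Set.range (𝓡 m)) (extChartAt (𝓡 m) p p) := by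
    unfold mfderiv
    exact if_pos hF
  rw [ModelWithCorners.Boundaryless.range_eq_univ, fderivWithin_univ] at h
  rw [diff, h]
  rfl

theorem diff_basisVec {F : M → W} {p : M} (hF : MDifferentiableAt (𝓡 m) 𝓘(ℝ, W) F p) (i : Fin m) :
    diff F p (basisVec p i) = partialDeriv (inChart F p) i (extChartAt (𝓡 m) p p) :=
  diff_eq_fderiv hF _

theorem partialDeriv_congr_of_eventuallyEq {F G : EuclideanSpace ℝ (Fin m) → W}
    {x : EuclideanSpace ℝ (Fin m)} (h : F =ᶠ[nhds x] G) (i : Fin m) :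
    partialDeriv F i x = partialDeriv G i x := by
  simp only [partialDeriv, h.fderiv_eq]

theorem firstForm_congr {ψ ψ' : EuclideanSpace ℝ (Fin m) → EuclideanSpace ℝ (Fin (m + 2))}
    {x : EuclideanSpace ℝ (Fin m)} (h : ψ =ᶠ[nhds x] ψ') : firstForm ψ x = firstForm ψ' x := by
  ext i j
  simp only [firstForm_apply, partialDeriv_congr_of_eventuallyEq h]

theorem weingarten_congr {ψ ψ' ν ν' : EuclideanSpace ℝ (Fin m) → EuclideanSpace ℝ (Fin (m + 2))}
    {x : EuclideanSpace ℝ (Fin m)} (h : ψ =ᶠ[nhds x] ψ') (h' : ν =ᶠ[nhds x] ν') :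
    weingarten ψ ν x = weingarten ψ' ν' x := by
  rw [weingarten, weingarten, firstForm_congr h]
  congr 1
  ext i j
  simp only [secondForm, Matrix.of_apply, partialDeriv_congr_of_eventuallyEq h,
    partialDeriv_congr_of_eventuallyEq h']

theorem IsSpacelikeHypersurface.mdifferentiableAt {φ : M → EuclideanSpace ℝ (Fin (m + 2))}
    (hφ : IsSpacelikeHypersurface c φ) (p : M) :
    MDifferentiableAt (𝓡 m) 𝓘(ℝ, EuclideanSpace ℝ (Fin (m + 2))) φ p :=
  hφ.smooth.mdifferentiableAt (by simp)

variable [IsManifold (𝓡 m) ∞ M]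

theorem contDiffOn_inChart {F : M → W} {U : Set M} (hF : ContMDiffOn (𝓡 m) 𝓘(ℝ, W) ∞ F U) (p : M) :
    ContDiffOn ℝ ∞ (inChart F p)
      ((extChartAt (𝓡 m) p).target ∩ (extChartAt (𝓡 m) p).symm ⁻¹' U) := by
  rw [← contMDiffOn_iff_contDiffOn]
  exact hF.comp ((contMDiffOn_extChartAt_symm p).mono Set.inter_subset_left) fun x hx => hx.2

theorem contDiffOn_inChart_univ {F : M → W} (hF : ContMDiff (𝓡 m) 𝓘(ℝ, W) ∞ F) (p : M) :
    ContDiffOn ℝ ∞ (inChart F p) (extChartAt (𝓡 m) p).target := by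
  simpa using contDiffOn_inChart (U := Set.univ) hF.contMDiffOn p

/-- The coordinate change between preferred charts. -/
theorem exists_coordChange (p : M) {x : EuclideanSpace ℝ (Fin m)}
    (hx : x ∈ (extChartAt (𝓡 m) p).target) :
    ∃ θ : EuclideanSpace ℝ (Fin m) → EuclideanSpace ℝ (Fin m),
      θ x = extChartAt (𝓡 m) ((extChartAt (𝓡 m) p).symm x) ((extChartAt (𝓡 m) p).symm x) ∧
      DifferentiableAt ℝ θ x ∧ (jacobian θ x).det ≠ 0 ∧
      ∀ {W : Type} (F : M → W), inChart F p =ᶠ[nhds x]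
        inChart F ((extChartAt (𝓡 m) p).symm x) ∘ θ := by
  set q := (extChartAt (𝓡 m) p).symm x with hq
  have hqp : q ∈ (extChartAt (𝓡 m) p).source := (extChartAt (𝓡 m) p).map_target hx
  have key : ∀ (a b : M) (z : EuclideanSpace ℝ (Fin m)), z ∈ (extChartAt (𝓡 m) a).target →
      (extChartAt (𝓡 m) a).symm z ∈ (extChartAt (𝓡 m) b).source →
      DifferentiableAt ℝ (extChartAt (𝓡 m) b ∘ (extChartAt (𝓡 m) a).symm) z ∧
      ∀ᶠ y in nhds z, (extChartAt (𝓡 m) b).symm ((extChartAt (𝓡 m) b)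
        ((extChartAt (𝓡 m) a).symm y)) = (extChartAt (𝓡 m) a).symm y := by
    intro a b z hz hzb
    constructor
    · have h := contDiffWithinAt_ext_coord_change (I := 𝓡 m) (n := ∞) b a (y := z)
        (by rw [PartialEquiv.trans_source]; exact ⟨hz, hzb⟩)
      rw [ModelWithCorners.Boundaryless.range_eq_univ, contDiffWithinAt_univ] at h
      exact h.differentiableAt (by simp)
    · have hc : ContinuousAt (extChartAt (𝓡 m) a).symm z := continuousAt_extChartAt_symm'' hz
      filter_upwards [hc.eventually_mem ((isOpen_extChartAt_source b).mem_nhds hzb)] with y hy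
      exact (extChartAt (𝓡 m) b).left_inv hy
  obtain ⟨h1, h2⟩ := key p q x hx (mem_extChartAt_source q)
  obtain ⟨h3, h4⟩ := key q p (extChartAt (𝓡 m) q q) (mem_extChartAt_target q)
    (by rw [extChartAt_to_inv]; exact hqp)
  refine ⟨extChartAt (𝓡 m) q ∘ (extChartAt (𝓡 m) p).symm, rfl, h1, ?_, fun F => ?_⟩
  · have hcomp : (extChartAt (𝓡 m) p ∘ (extChartAt (𝓡 m) q).symm) ∘
        (extChartAt (𝓡 m) q ∘ (extChartAt (𝓡 m) p).symm) =ᶠ[nhds x] id := by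
      filter_upwards [h2, extChartAt_target_mem_nhds' hx] with y hy hy'
      simp only [Function.comp_apply, hy, id]
      exact (extChartAt (𝓡 m) p).right_inv hy'
    have hj := jacobian_comp (θ := extChartAt (𝓡 m) q ∘ (extChartAt (𝓡 m) p).symm)
      (ρ := extChartAt (𝓡 m) p ∘ (extChartAt (𝓡 m) q).symm) (y := x) h3 h1
    have : jacobian ((extChartAt (𝓡 m) p ∘ (extChartAt (𝓡 m) q).symm) ∘
        (extChartAt (𝓡 m) q ∘ (extChartAt (𝓡 m) p).symm)) x = 1 := by
      rw [← jacobian_id (y := x)]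
      ext i j
      simp only [jacobian, Matrix.of_apply, partialDeriv_congr_of_eventuallyEq hcomp]
    rw [this] at hj
    intro h0
    have := congrArg Matrix.det hj
    rw [Matrix.det_mul, h0, mul_zero, Matrix.det_one] at this
    exact one_ne_zero this
  · filter_upwards [h2] with y hy
    simp only [inChart, Function.comp_apply, hy]

variable {φ η : M → EuclideanSpace ℝ (Fin (m + 2))}

/-- T is the derivative of the coordinate change. Its injectivity suffices to carry positivity and
orthogonality from the tangent spaces to every point of a fixed chart. -/
theorem fderiv_inChart {V : Type} [NormedAddCommGroup V] [NormedSpace ℝ V] {F : M → V}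
    (hF : ContMDiff (𝓡 m) 𝓘(ℝ, V) ∞ F) (p : M) {x : EuclideanSpace ℝ (Fin m)}
    (hx : x ∈ (extChartAt (𝓡 m) p).target) :
    ∃ T : EuclideanSpace ℝ (Fin m) → EuclideanSpace ℝ (Fin m), (∀ v, v ≠ 0 → T v ≠ 0) ∧
      ∀ v, fderiv ℝ (inChart F p) x v = diff F ((extChartAt (𝓡 m) p).symm x) (T v) := by
  obtain ⟨θ, h0, h1, h2, h3⟩ := exists_coordChange p hx
  refine ⟨fderiv ℝ θ x, fun v hv => fderiv_ne_zero_of_det h2 hv, fun v => ?_⟩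
  have hd : DifferentiableAt ℝ (inChart F ((extChartAt (𝓡 m) p).symm x)) (θ x) := by
    rw [h0]
    exact (contDiffOn_inChart_univ hF _).diffAt (isOpen_extChartAt_target _)
      (mem_extChartAt_target _)
  rw [(h3 F).fderiv_eq, fderiv_comp x hd h1, h0]
  exact (diff_eq_fderiv (hF.mdifferentiableAt (by simp)) _).symm

namespace IsSpacelikeHypersurface

variable (hφ : IsSpacelikeHypersurface c φ)

include hφ

theorem isLocalSpacelike (p : M) :
    IsLocalSpacelike c (inChart φ p) (extChartAt (𝓡 m) p).target where
  isOpen := isOpen_extChartAt_target p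
  smooth := contDiffOn_inChart_univ hφ.smooth p
  mem_deSitter x hx := hφ.mem_deSitter _
  spacelike x hx v hv := by
    obtain ⟨T, hT, h⟩ := fderiv_inChart hφ.smooth p hx
    rw [h]
    exact hφ.spacelike _ _ (hT v hv)

theorem isLocalHypersurface {U : Set M} (hU : IsOpen U) (hη : IsUnitNormalOn φ η U) (p : M) :
    IsLocalHypersurface c (inChart φ p) (inChart η p)
      ((extChartAt (𝓡 m) p).target ∩ (extChartAt (𝓡 m) p).symm ⁻¹' U) where
  isOpen := (continuousOn_extChartAt_symm p).isOpen_inter_preimage (isOpen_extChartAt_target p) hU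
  smooth := (hφ.isLocalSpacelike p).smooth.mono Set.inter_subset_left
  mem_deSitter x hx := hφ.mem_deSitter _
  spacelike x hx := (hφ.isLocalSpacelike p).spacelike x hx.1
  smooth_normal := contDiffOn_inChart hη.smooth p
  tangent_deSitter x hx := hη.tangent_deSitter _ hx.2
  normal x hx v := by
    obtain ⟨T, -, h⟩ := fderiv_inChart hφ.smooth p hx.1
    rw [h]
    exact hη.normal _ hx.2 _
  unit x hx := hη.unit _ hx.2

/-- The future-pointing unit normal field. -/
theorem exists_unitNormal (hc : 0 < c) :
    ∃ η : M → EuclideanSpace ℝ (Fin (m + 2)), IsUnitNormalOn φ η Set.univ := by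
  choose ν hν hpos using fun p : M => (hφ.isLocalSpacelike p).exists_normal hc
  let η : M → EuclideanSpace ℝ (Fin (m + 2)) := fun p => ν p (extChartAt (𝓡 m) p p)
  have hηd : ∀ p, ∀ v : TangentSpace (𝓡 m) p, lorentz (η p) (diff φ p v) = 0 := fun p v => by
    rw [diff_eq_fderiv (hφ.mdifferentiableAt p)]
    exact (hν p).normal _ (mem_extChartAt_target p) v
  have hηt : ∀ p, lorentz (η p) (φ p) = 0 := fun p => by
    have := (hν p).tangent_deSitter _ (mem_extChartAt_target p)
    rwa [inChart_self] at this
  have hηu : ∀ p, lorentz (η p) (η p) = -1 := fun p => (hν p).unit _ (mem_extChartAt_target p)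
  -- η is built from a separate choice at each point, yet in the chart at p it agrees with the
  -- smooth field `ν p`, because the future-pointing unit normal is unique.
  have hloc : ∀ p, ∀ x ∈ (extChartAt (𝓡 m) p).target, inChart η p x = ν p x := by
    intro p x hx
    refine (hν p).normal_unique hc hx (fun v => ?_) (hηt _) (hηu _) ?_ (hpos p x hx)
    · obtain ⟨T, -, h⟩ := fderiv_inChart hφ.smooth p hx
      rw [h]
      exact hηd _ _
    · exact hpos _ _ (mem_extChartAt_target _)
  refine ⟨η, ⟨?_, fun p _ => hηt p, fun p _ => hηd p, fun p _ => hηu p⟩⟩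
  rw [contMDiffOn_univ]
  intro p
  have h1 : ContMDiffAt (𝓡 m) 𝓘(ℝ, EuclideanSpace ℝ (Fin (m + 2))) ∞
      (ν p ∘ extChartAt (𝓡 m) p) p :=
    (((hν p).smooth_normal.contDiffAt (extChartAt_target_mem_nhds p)).contMDiffAt).comp p
      contMDiffAt_extChartAt
  refine h1.congr_of_eventuallyEq ?_
  filter_upwards [extChartAt_source_mem_nhds (I := 𝓡 m) p] with q hq
  rw [Function.comp_apply, ← hloc p _ ((extChartAt (𝓡 m) p).map_source hq), inChart,
    Function.comp_apply, (extChartAt (𝓡 m) p).left_inv hq]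

end IsSpacelikeHypersurface

/-- The matrix of the shape operator in the coordinate basis. -/
def shapeMatrix (φ η : M → EuclideanSpace ℝ (Fin (m + 2))) (p : M) : Matrix (Fin m) (Fin m) ℝ :=
  weingarten (inChart φ p) (inChart η p) (extChartAt (𝓡 m) p p)

theorem gram_eq (hφ : IsSpacelikeHypersurface c φ) (p : M) :
    gram φ p = firstForm (inChart φ p) (extChartAt (𝓡 m) p p) := by
  ext i j
  simp only [gram, inducedMetric, Matrix.of_apply, diff_basisVec (hφ.mdifferentiableAt p)]
  rfl

theorem shapeOperator_eq (hφ : IsSpacelikeHypersurface c φ) {p : M}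
    (hη : MDifferentiableAt (𝓡 m) 𝓘(ℝ, EuclideanSpace ℝ (Fin (m + 2))) η p) :
    shapeOperator φ η p = Matrix.toEuclideanLin (shapeMatrix φ η p) := by
  rw [shapeOperator, gram_eq hφ, shapeMatrix, weingarten]
  congr 3
  ext i j
  simp only [diff_basisVec (hφ.mdifferentiableAt p), diff_basisVec hη]

theorem meanCurvature_eq (hφ : IsSpacelikeHypersurface c φ) {p : M}
    (hη : MDifferentiableAt (𝓡 m) 𝓘(ℝ, EuclideanSpace ℝ (Fin (m + 2))) η p) :
    meanCurvature φ η p = -(shapeMatrix φ η p).trace / m := by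
  rw [meanCurvature, shapeOperator_eq hφ hη]
  congr 2
  exact Matrix.trace_toLin_eq _ (PiLp.basisFun 2 ℝ (Fin m))

end Charts

/-! ### The mean curvature is constant -/

section MeanCurvature

variable {m : ℕ} {c : ℝ} {M : Type*} [TopologicalSpace M]
  [ChartedSpace (EuclideanSpace ℝ (Fin m)) M] [IsManifold (𝓡 m) ∞ M]
  {φ η : M → EuclideanSpace ℝ (Fin (m + 2))}

theorem _root_.ContMDiff.of_inChart {W : Type*} [NormedAddCommGroup W] [NormedSpace ℝ W]
    {F : M → W} (h : ∀ p, ContDiffOn ℝ ∞ (inChart F p) (extChartAt (𝓡 m) p).target) :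
    ContMDiff (𝓡 m) 𝓘(ℝ, W) ∞ F := by
  intro p
  have h1 : ContMDiffAt (𝓡 m) 𝓘(ℝ, W) ∞ (inChart F p ∘ extChartAt (𝓡 m) p) p :=
    (((h p).contDiffAt (extChartAt_target_mem_nhds p)).contMDiffAt).comp p contMDiffAt_extChartAt
  refine h1.congr_of_eventuallyEq ?_
  filter_upwards [extChartAt_source_mem_nhds (I := 𝓡 m) p] with q hq
  rw [Function.comp_apply, inChart, Function.comp_apply, (extChartAt (𝓡 m) p).left_inv hq]

theorem continuous_of_inChart {W : Type*} [NormedAddCommGroup W] [NormedSpace ℝ W]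
    {F : M → W} (h : ∀ p, ContDiffOn ℝ ∞ (inChart F p) (extChartAt (𝓡 m) p).target) :
    Continuous F := (ContMDiff.of_inChart h).continuous

theorem IsUnitNormalOn.contMDiff (hη : IsUnitNormalOn φ η Set.univ) :
    ContMDiff (𝓡 m) 𝓘(ℝ, EuclideanSpace ℝ (Fin (m + 2))) ∞ η :=
  contMDiffOn_univ.1 hη.smooth

theorem isLocalMax_inChart {f : M → ℝ} {p : M} (h : ∀ q, f q ≤ f p) :
    IsLocalMax (inChart f p) (extChartAt (𝓡 m) p p) :=
  Filter.Eventually.of_forall fun x => by rw [inChart_self]; exact h _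

variable (hφ : IsSpacelikeHypersurface c φ) (hη : IsUnitNormalOn φ η Set.univ)

include hφ hη

theorem IsSpacelikeHypersurface.inChart (p : M) :
    IsLocalHypersurface c (inChart φ p) (inChart η p) (extChartAt (𝓡 m) p).target := by
  simpa using hφ.isLocalHypersurface isOpen_univ hη p

/-- `shapeMatrix` uses a different chart at each point. A single J relates it to a fixed chart: it
conjugates A, preserves the traces, and transforms differentials of functions as row vectors. -/
theorem exists_weingarten_inChart (p : M) {x : EuclideanSpace ℝ (Fin m)}
    (hx : x ∈ (extChartAt (𝓡 m) p).target) :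
    ∃ J : Matrix (Fin m) (Fin m) ℝ, J.det ≠ 0 ∧
      weingarten (inChart φ p) (inChart η p) x
        = J⁻¹ * shapeMatrix φ η ((extChartAt (𝓡 m) p).symm x) * J ∧
      (weingarten (inChart φ p) (inChart η p) x).trace
        = (shapeMatrix φ η ((extChartAt (𝓡 m) p).symm x)).trace ∧
      (weingarten (inChart φ p) (inChart η p) x * weingarten (inChart φ p) (inChart η p) x).trace
        = (shapeMatrix φ η ((extChartAt (𝓡 m) p).symm x) *
            shapeMatrix φ η ((extChartAt (𝓡 m) p).symm x)).trace ∧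
      ∀ f : M → ℝ, (∀ q, ContDiffOn ℝ ∞ (inChart f q) (extChartAt (𝓡 m) q).target) →
        (fun k => partialDeriv (inChart f p) k x)
          = (fun k => partialDeriv (inChart f ((extChartAt (𝓡 m) p).symm x)) k
            (extChartAt (𝓡 m) ((extChartAt (𝓡 m) p).symm x) ((extChartAt (𝓡 m) p).symm x))) ᵥ* J := by
  obtain ⟨θ, h0, h1, h2, h3⟩ := exists_coordChange p hx
  have H := hφ.inChart hη ((extChartAt (𝓡 m) p).symm x)
  have hm : θ x ∈ (extChartAt (𝓡 m) ((extChartAt (𝓡 m) p).symm x)).target := by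
    rw [h0]; exact mem_extChartAt_target _
  refine ⟨jacobian θ x, h2, ?_, ?_, ?_, fun f hf => ?_⟩
  · rw [weingarten_congr (h3 φ) (h3 η), H.weingarten_comp h1 hm h2, h0, shapeMatrix]
  · rw [weingarten_congr (h3 φ) (h3 η), H.trace_weingarten_comp h1 hm h2, h0, shapeMatrix]
  · rw [weingarten_congr (h3 φ) (h3 η), H.trace_weingarten_sq_comp h1 hm h2, h0, shapeMatrix]
  · ext k
    rw [partialDeriv_congr_of_eventuallyEq (h3 f)]
    have hd := (hf ((extChartAt (𝓡 m) p).symm x)).diffAt (isOpen_extChartAt_target _) hm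
    refine (partialDeriv_comp hd h1 k).trans ?_
    rw [h0]
    exact Finset.sum_congr rfl fun i _ => mul_comm _ _

theorem trace_inChart (p : M) {x : EuclideanSpace ℝ (Fin m)}
    (hx : x ∈ (extChartAt (𝓡 m) p).target) :
    inChart (fun q => (shapeMatrix φ η q).trace) p x
      = (weingarten (inChart φ p) (inChart η p) x).trace := by
  obtain ⟨J, -, -, h, -⟩ := exists_weingarten_inChart hφ hη p hx
  exact h.symm

theorem smooth_trace_inChart (p : M) :
    ContDiffOn ℝ ∞ (inChart (fun q => (shapeMatrix φ η q).trace) p)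
      (extChartAt (𝓡 m) p).target :=
  ContDiffOn.congr (ContDiffOn.sum fun i _ => (hφ.inChart hη p).smooth_weingarten i i)
    fun _ hx => trace_inChart hφ hη p hx

theorem trace_sq_eq (hc : 0 < c) {r : ℝ}
    (hscal : ∀ p : M, scalarCurvature φ p = (m : ℝ) * ((m : ℝ) - 1) * r) (p : M) :
    (shapeMatrix φ η p * shapeMatrix φ η p).trace
      = (shapeMatrix φ η p).trace ^ 2 + (m : ℝ) * ((m : ℝ) - 1) * (r - c) := by
  have h := (hφ.inChart hη p).coordScalar_eq hc (mem_extChartAt_target p)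
  have h2 : coordScalar (firstForm (inChart φ p)) (extChartAt (𝓡 m) p p)
    = (m : ℝ) * ((m : ℝ) - 1) * r := hscal p
  rw [h2] at h
  simp only [shapeMatrix]
  linarith

/-- The condition on the gradient becomes one on the differential dT. Lowering the index with g
turns A g⁻¹ dT into h g⁻¹ dT, and by symmetry of g and h this is the row vector dT times A. -/
theorem vecMul_shapeMatrix (hm : m ≠ 0) (hbic : IsBiconservative φ) (p : M) :
    (fun k => partialDeriv (inChart (fun q => (shapeMatrix φ η q).trace) p) k
      (extChartAt (𝓡 m) p p)) ᵥ* shapeMatrix φ η p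
    = -((shapeMatrix φ η p).trace / 2) •
      fun k => partialDeriv (inChart (fun q => (shapeMatrix φ η q).trace) p) k
        (extChartAt (𝓡 m) p p) := by
  have hm' : (m : ℝ) ≠ 0 := by exact_mod_cast hm
  have hηd : ∀ q, MDifferentiableAt (𝓡 m) 𝓘(ℝ, EuclideanSpace ℝ (Fin (m + 2))) η q :=
    fun q => hη.contMDiff.mdifferentiableAt (by simp)
  have hmean : meanCurvature φ η = fun q => (-(1 / (m : ℝ))) * (shapeMatrix φ η q).trace := by
    ext q
    rw [meanCurvature_eq hφ (hηd q)]
    ring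
  have hsm : ∀ q, ContDiffOn ℝ ∞ (DeSitterHypersurface.inChart (meanCurvature φ η) q)
      (extChartAt (𝓡 m) q).target := by
    intro q
    rw [hmean]
    exact contDiffOn_const.mul (smooth_trace_inChart hφ hη q)
  have hmd : MDifferentiableAt (𝓡 m) 𝓘(ℝ, ℝ) (meanCurvature φ η) p :=
    (ContMDiff.of_inChart hsm).mdifferentiableAt (by simp)
  have H := hφ.inChart hη p
  have hxp : extChartAt (𝓡 m) p p ∈ (extChartAt (𝓡 m) p).target := mem_extChartAt_target p
  set d : Fin m → ℝ := fun k => partialDeriv (DeSitterHypersurface.inChart (fun q => (shapeMatrix φ η q).trace) p) k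
        (extChartAt (𝓡 m) p p) with hd
  have hdf : (fun j => diff (meanCurvature φ η) p (basisVec p j)) = (-(1 / (m : ℝ))) • d := by
    ext j
    rw [diff_basisVec hmd, hmean]
    change partialDeriv (fun y => (-(1 / (m : ℝ))) *
      DeSitterHypersurface.inChart (fun q => (shapeMatrix φ η q).trace) p y) j _ = _
    rw [partialDeriv_mul (differentiableAt_const _) ((smooth_trace_inChart hφ hη p).diffAt
      (isOpen_extChartAt_target p) hxp), partialDeriv_const, zero_mul, add_zero]
    rfl
  have hg : grad φ (meanCurvature φ η) p = WithLp.toLp 2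
      ((firstForm (DeSitterHypersurface.inChart φ p) (extChartAt (𝓡 m) p p))⁻¹ *ᵥ ((-(1 / (m : ℝ))) • d)) := by
    rw [grad, hdf, gram_eq hφ]
  have hb := hbic Set.univ η isOpen_univ hη p (Set.mem_univ p)
  rw [hg, shapeOperator_eq hφ (hηd p), Matrix.mulVec_smul] at hb
  have hb2 := congrArg WithLp.ofLp hb
  have hb3 : shapeMatrix φ η p *ᵥ ((-(1 / (m : ℝ))) •
      ((firstForm (DeSitterHypersurface.inChart φ p) (extChartAt (𝓡 m) p p))⁻¹ *ᵥ d))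
      = ((m : ℝ) * meanCurvature φ η p / 2) • ((-(1 / (m : ℝ))) •
      ((firstForm (DeSitterHypersurface.inChart φ p) (extChartAt (𝓡 m) p p))⁻¹ *ᵥ d)) := hb2
  have hmf : (m : ℝ) * meanCurvature φ η p / 2 = -((shapeMatrix φ η p).trace / 2) := by
    rw [hmean]
    field_simp
  rw [hmf, Matrix.mulVec_smul, smul_comm] at hb3
  -- The factor -1/m relating f to the trace is non-zero and cancels.
  have hb4 := smul_right_injective (Fin m → ℝ) (r := -(1 / (m : ℝ)))
    (by simpa using hm') hb3
  generalize -((shapeMatrix φ η p).trace / 2) = t at hb4 ⊢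
  have hsm' : shapeMatrix φ η p = weingarten (DeSitterHypersurface.inChart φ p)
    (DeSitterHypersurface.inChart η p) (extChartAt (𝓡 m) p p) := rfl
  have hb5 := congrArg
    (firstForm (DeSitterHypersurface.inChart φ p) (extChartAt (𝓡 m) p p) *ᵥ ·) hb4
  simp only [Matrix.mulVec_smul, Matrix.mulVec_mulVec] at hb5
  rw [hsm', ← Matrix.mul_assoc, H.mul_weingarten hxp, H.mul_inv hxp, Matrix.one_mulVec] at hb5
  rw [← hb5, hsm', weingarten, ← Matrix.mulVec_transpose, Matrix.transpose_mul,
    H.secondForm_transpose hxp, Matrix.transpose_nonsing_inv, firstForm_transpose]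

theorem vecMul_weingarten_inChart (hm : m ≠ 0) (hbic : IsBiconservative φ) (p : M)
    {x : EuclideanSpace ℝ (Fin m)} (hx : x ∈ (extChartAt (𝓡 m) p).target) :
    (fun k => partialDeriv (fun y => (weingarten (inChart φ p) (inChart η p) y).trace) k x) ᵥ*
      weingarten (inChart φ p) (inChart η p) x
    = -((weingarten (inChart φ p) (inChart η p) x).trace / 2) • fun k => partialDeriv
      (fun y => (weingarten (inChart φ p) (inChart η p) y).trace) k x := by
  obtain ⟨J, hJ, hW, htr, -, hf⟩ := exists_weingarten_inChart hφ hη p hx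
  have h1 : (fun k => partialDeriv (fun y => (weingarten (inChart φ p) (inChart η p) y).trace) k x)
      = fun k => partialDeriv (inChart (fun q => (shapeMatrix φ η q).trace) p) k x :=
    funext fun k => (partialDeriv_congr (isOpen_extChartAt_target p)
      (fun y hy => trace_inChart hφ hη p hy) hx k).symm
  rw [h1, htr, hf _ (smooth_trace_inChart hφ hη), hW, Matrix.vecMul_vecMul, Matrix.mul_assoc,
    Matrix.mul_nonsing_inv_cancel_left _ _ (isUnit_iff_ne_zero.2 hJ), ← Matrix.vecMul_vecMul,
    vecMul_shapeMatrix hφ hη hm hbic, Matrix.smul_vecMul]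

/-- Biconservativity says that dT annihilates A + T/2. This matrix is invertible at the maximum,
hence on a ball around it, so dT = 0 on that ball. -/
theorem isLocallyConstant_trace (hc : 0 < c) (hm : m ≠ 0) {r : ℝ}
    (hscal : ∀ p : M, scalarCurvature φ p = (m : ℝ) * ((m : ℝ) - 1) * r)
    (hsec : NonnegSectionalCurvature φ) (hbic : IsBiconservative φ) {p : M}
    (hp : ∀ q, (shapeMatrix φ η q).trace ^ 2 ≤ (shapeMatrix φ η p).trace ^ 2)
    (hne : (shapeMatrix φ η p).trace ≠ 0) :
    ∀ᶠ q in nhds p, (shapeMatrix φ η q).trace = (shapeMatrix φ η p).trace := by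
  have H := hφ.inChart hη p
  have hxp : extChartAt (𝓡 m) p p ∈ (extChartAt (𝓡 m) p).target := mem_extChartAt_target p
  have hdet := H.det_weingarten_add_ne_zero hc hxp (a := (m : ℝ) * ((m : ℝ) - 1) * (r - c))
    (fun y hy => by
      obtain ⟨J, -, -, h1, h2, -⟩ := exists_weingarten_inChart hφ hη p hy
      rw [h2, h1, trace_sq_eq hφ hη hc hscal])
    (fun y hy => vecMul_weingarten_inChart hφ hη hm hbic p hy)
    (by
      refine (isLocalMax_inChart hp).congr ?_
      filter_upwards [extChartAt_target_mem_nhds p] with y hy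
      rw [← trace_inChart hφ hη p hy]
      rfl)
    hne (hsec p)
  set S : Set (EuclideanSpace ℝ (Fin m)) := (extChartAt (𝓡 m) p).target ∩
    {x | (weingarten (inChart φ p) (inChart η p) x +
      ((weingarten (inChart φ p) (inChart η p) x).trace / 2) • 1).det ≠ 0} with hSdef
  have hcont : ContinuousOn (fun x => (weingarten (DeSitterHypersurface.inChart φ p)
      (DeSitterHypersurface.inChart η p) x +
      ((weingarten (DeSitterHypersurface.inChart φ p)
      (DeSitterHypersurface.inChart η p) x).trace / 2) • (1 : Matrix (Fin m) (Fin m) ℝ)).det)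
      (extChartAt (𝓡 m) p).target := by
    refine (contDiffOn_det fun i j => ?_).continuousOn
    exact (H.smooth_weingarten i j).add (((ContDiffOn.sum fun i _ =>
      H.smooth_weingarten i i).div_const 2).mul contDiffOn_const)
  have hS : IsOpen S :=
    hcont.isOpen_inter_preimage (isOpen_extChartAt_target p) isOpen_compl_singleton
  have hxS : extChartAt (𝓡 m) p p ∈ S := ⟨hxp, hdet⟩
  have hzero : ∀ x ∈ S, fderiv ℝ (DeSitterHypersurface.inChart
      (fun q => (shapeMatrix φ η q).trace) p) x = 0 := by
    intro x hx
    have h1 : (fun k => partialDeriv (fun y => (weingarten (DeSitterHypersurface.inChart φ p)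
        (DeSitterHypersurface.inChart η p) y).trace) k x) = 0 := by
      refine Matrix.eq_zero_of_vecMul_eq_zero hx.2 ?_
      rw [Matrix.vecMul_add, vecMul_weingarten_inChart hφ hη hm hbic p hx.1, Matrix.vecMul_smul,
        Matrix.vecMul_one, neg_smul, neg_add_cancel]
    ext v
    rw [fderiv_eq_sum_partialDeriv]
    refine Finset.sum_eq_zero fun k _ => ?_
    rw [partialDeriv_congr (isOpen_extChartAt_target p) (fun y hy => trace_inChart hφ hη p hy) hx.1,
      congrFun h1 k, Pi.zero_apply, smul_zero]
  obtain ⟨ε, hε, hball⟩ := Metric.isOpen_iff.1 hS _ hxS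
  have hconst : ∀ x ∈ Metric.ball (extChartAt (𝓡 m) p p) ε, DeSitterHypersurface.inChart
      (fun q => (shapeMatrix φ η q).trace) p x = (shapeMatrix φ η p).trace := by
    intro x hx
    rw [← inChart_self (m := m) (fun q => (shapeMatrix φ η q).trace) p]
    exact Metric.isOpen_ball.is_const_of_fderiv_eq_zero (convex_ball _ ε).isPreconnected
      ((smooth_trace_inChart hφ hη p).differentiableOn (by simp) |>.mono
        fun y hy => (hball hy).1) (fun y hy => hzero y (hball hy)) hx (Metric.mem_ball_self hε)
  filter_upwards [extChartAt_source_mem_nhds (I := 𝓡 m) p,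
    (continuousAt_extChartAt (I := 𝓡 m) p).eventually_mem (Metric.ball_mem_nhds _ hε)] with q hq hq2
  rw [← hconst _ hq2, inChart, Function.comp_apply, (extChartAt (𝓡 m) p).left_inv hq]

/-- Each point of the level set through a maximum of T² is again a maximum, so the level set is open
as well as closed. -/
theorem exists_trace_eq [CompactSpace M] [ConnectedSpace M] (hc : 0 < c) (hm : m ≠ 0) {r : ℝ}
    (hscal : ∀ p : M, scalarCurvature φ p = (m : ℝ) * ((m : ℝ) - 1) * r)
    (hsec : NonnegSectionalCurvature φ) (hbic : IsBiconservative φ)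
    (hne : ∃ p, (shapeMatrix φ η p).trace ≠ 0) :
    ∃ τ, τ ≠ 0 ∧ ∀ p, (shapeMatrix φ η p).trace = τ := by
  have hcont : Continuous fun q => (shapeMatrix φ η q).trace :=
    continuous_of_inChart (smooth_trace_inChart hφ hη)
  obtain ⟨p, -, hp⟩ := isCompact_univ.exists_isMaxOn Set.univ_nonempty
    (hcont.pow 2).continuousOn
  have hp' : ∀ q, (shapeMatrix φ η q).trace ^ 2 ≤ (shapeMatrix φ η p).trace ^ 2 :=
    fun q => hp (Set.mem_univ q)
  have hpne : (shapeMatrix φ η p).trace ≠ 0 := by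
    obtain ⟨q, hq⟩ := hne
    intro h0
    have := hp' q
    rw [h0] at this
    have : 0 < (shapeMatrix φ η q).trace ^ 2 := by positivity
    linarith
  let S : Set M := {q | (shapeMatrix φ η q).trace = (shapeMatrix φ η p).trace}
  have hS : IsClopen S := by
    refine ⟨isClosed_eq hcont continuous_const, isOpen_iff_mem_nhds.2 fun q hq => ?_⟩
    have hq' : (shapeMatrix φ η q).trace = (shapeMatrix φ η p).trace := hq
    have := isLocallyConstant_trace hφ hη hc hm hscal hsec hbic (p := q)
      (by rw [hq']; exact hp') (by rwa [hq'])
    rw [hq'] at this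
    exact this
  have := hS.eq_univ ⟨p, rfl⟩
  exact ⟨_, hpne, fun q => this.symm.subset (Set.mem_univ q)⟩

end MeanCurvature

/-! ### The hypersurface is totally umbilical -/

section Umbilical

variable {m : ℕ} {c : ℝ} {M : Type*} [TopologicalSpace M]
  [ChartedSpace (EuclideanSpace ℝ (Fin m)) M] [IsManifold (𝓡 m) ∞ M]
  {φ η : M → EuclideanSpace ℝ (Fin (m + 2))}

theorem IsSpacelikeHypersurface.lorentz_position_diff (hφ : IsSpacelikeHypersurface c φ) (p : M)
    (v : TangentSpace (𝓡 m) p) : lorentz (φ p) (diff φ p v) = 0 := by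
  have h := (hφ.isLocalSpacelike p).position_partial (mem_extChartAt_target p)
  rw [inChart_self] at h
  have key : ∀ w : EuclideanSpace ℝ (Fin m),
      lorentz (φ p) (fderiv ℝ (DeSitterHypersurface.inChart φ p) (extChartAt (𝓡 m) p p) w) = 0 := fun w => by
    rw [fderiv_eq_sum_partialDeriv, lorentz_sum_right]
    refine Finset.sum_eq_zero fun i _ => ?_
    rw [lorentz_smul_right, h, mul_zero]
  rw [diff_eq_fderiv (hφ.mdifferentiableAt p)]
  exact key v

/-- Minimality tests every local unit normal. At each point such a normal is η or -η, so by
`secondForm_eq` its trace agrees with that of η up to sign. -/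
theorem exists_trace_ne_zero (hc : 0 < c) (hφ : IsSpacelikeHypersurface c φ)
    (hη : IsUnitNormalOn φ η Set.univ) (hmin : ¬ IsMinimal φ) :
    ∃ p, (shapeMatrix φ η p).trace ≠ 0 := by
  by_contra! h0
  refine hmin fun U η' hU hη' p hp => ?_
  have H := hφ.inChart hη p
  have H' := hφ.isLocalHypersurface hU hη' p
  have hx : extChartAt (𝓡 m) p p ∈ (extChartAt (𝓡 m) p).target := mem_extChartAt_target p
  have hx' : extChartAt (𝓡 m) p p ∈ (extChartAt (𝓡 m) p).target ∩
      (extChartAt (𝓡 m) p).symm ⁻¹' U :=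
    ⟨hx, by rw [Set.mem_preimage, extChartAt_to_inv]; exact hp⟩
  have hd : MDifferentiableAt (𝓡 m) 𝓘(ℝ, EuclideanSpace ℝ (Fin (m + 2))) η' p :=
    ((hη'.smooth.contMDiffAt (hU.mem_nhds hp))).mdifferentiableAt (by simp)
  have hp0 : (shapeMatrix φ η p).trace = 0 := h0 p
  rw [shapeMatrix] at hp0
  rw [meanCurvature_eq hφ hd, shapeMatrix]
  have key : (weingarten (DeSitterHypersurface.inChart φ p) (DeSitterHypersurface.inChart η' p)
      (extChartAt (𝓡 m) p p)).trace = 0 := by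
    rcases H.normal_eq_or_eq_neg hc hx (H'.normal _ hx') (H'.tangent_deSitter _ hx')
      (H'.unit _ hx') with h | h
    · rw [← hp0, weingarten, weingarten]
      congr 2
      ext i j
      rw [H.secondForm_eq hx, H'.secondForm_eq hx', h]
    · rw [← neg_eq_zero, ← hp0, weingarten, weingarten, ← Matrix.trace_neg, ← Matrix.mul_neg]
      congr 2
      ext i j
      rw [Matrix.neg_apply, H.secondForm_eq hx, H'.secondForm_eq hx', h, lorentz_neg_right, neg_neg]
  rw [key, neg_zero, zero_div]

theorem exists_eq_of_fderiv_inChart [PreconnectedSpace M] [Nonempty M] {W : Type*}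
    [NormedAddCommGroup W] [NormedSpace ℝ W] {F : M → W}
    (hF : ∀ p, DifferentiableOn ℝ (inChart F p) (extChartAt (𝓡 m) p).target)
    (h : ∀ p, ∀ x ∈ (extChartAt (𝓡 m) p).target, fderiv ℝ (inChart F p) x = 0) :
    ∃ w, ∀ p, F p = w := by
  have hloc : IsLocallyConstant F := by
    rw [IsLocallyConstant.iff_eventually_eq]
    intro p
    obtain ⟨ε, hε, hball⟩ := Metric.isOpen_iff.1 (isOpen_extChartAt_target (I := 𝓡 m) p) _
      (mem_extChartAt_target p)
    filter_upwards [extChartAt_source_mem_nhds (I := 𝓡 m) p,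
      (continuousAt_extChartAt (I := 𝓡 m) p).eventually_mem (Metric.ball_mem_nhds _ hε)]
      with q hq hq2
    have := Metric.isOpen_ball.is_const_of_fderiv_eq_zero (convex_ball _ ε).isPreconnected
      ((hF p).mono hball) (fun y hy => h p y (hball hy)) hq2 (Metric.mem_ball_self hε)
    rwa [inChart_self, inChart, Function.comp_apply, (extChartAt (𝓡 m) p).left_inv hq] at this
  obtain ⟨p0⟩ := ‹Nonempty M›
  exact ⟨F p0, fun p => hloc.apply_eq_of_preconnectedSpace p p0⟩

variable (hφ : IsSpacelikeHypersurface c φ) (hη : IsUnitNormalOn φ η Set.univ)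

include hφ hη

theorem partialDeriv_trace_inChart {τ : ℝ} (hτ : ∀ p, (shapeMatrix φ η p).trace = τ) (p : M)
    {x : EuclideanSpace ℝ (Fin m)} (hx : x ∈ (extChartAt (𝓡 m) p).target) (k : Fin m) :
    partialDeriv (fun y => (weingarten (inChart φ p) (inChart η p) y).trace) k x = 0 := by
  rw [partialDeriv_congr (G := fun _ => τ) (isOpen_extChartAt_target p) (fun y hy => ?_) hx,
    partialDeriv_const]
  rw [← trace_inChart hφ hη p hy]
  exact hτ _

/-- The maximum principle for vector fields `α φ + β η` along the hypersurface whose Laplacian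
is `k (α φ + β η) + w`. -/
theorem laplacian_eq_zero [CompactSpace M] (hc : 0 < c) {τ q : ℝ}
    (hτ : ∀ p, (shapeMatrix φ η p).trace = τ)
    (hq : ∀ p, (shapeMatrix φ η p * shapeMatrix φ η p).trace = q) {α β k : ℝ} (hk : 0 ≤ k)
    {w : EuclideanSpace ℝ (Fin (m + 2))}
    (hL : ∀ p, α • (-((m * c) • φ p) - τ • η p) + β • ((c * τ) • φ p + q • η p)
      = k • (α • φ p + β • η p) + w) (p : M) :
    k • (α • φ p + β • η p) + w = 0 := by
  -- Applied to (α, β) this bounds a coordinate of the Laplacian from above, and applied to (-α, -β)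
  -- from below. As k ≥ 0, the bound at the extremal point holds at every p.
  have hmax : ∀ (α β : ℝ) (i : Fin (m + 2)), ∃ p₀, (∀ p, (α • φ p + β • η p) i
      ≤ (α • φ p₀ + β • η p₀) i) ∧
      (α • (-((m * c) • φ p₀) - τ • η p₀) + β • ((c * τ) • φ p₀ + q • η p₀)) i ≤ 0 := by
    intro α β i
    have hcont : Continuous fun p => (α • φ p + β • η p) i :=
      (EuclideanSpace.proj (𝕜 := ℝ) i).continuous.comp
        ((hφ.smooth.continuous.const_smul α).add (hη.contMDiff.continuous.const_smul β))
    obtain ⟨p₀, -, hp⟩ := isCompact_univ.exists_isMaxOn ⟨p, Set.mem_univ p⟩ hcont.continuousOn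
    have hp' : ∀ p, (α • φ p + β • η p) i ≤ (α • φ p₀ + β • η p₀) i := fun q => hp (Set.mem_univ q)
    refine ⟨p₀, hp', ?_⟩
    have h1 := (hφ.inChart hη p₀).laplacian_nonpos hc (mem_extChartAt_target p₀)
      (fun y hy k => partialDeriv_trace_inChart hφ hη hτ p₀ hy k) α β i
      (isLocalMax_inChart (f := fun p => (α • φ p + β • η p) i) hp')
    have e1 := hτ p₀
    have e2 := hq p₀
    rw [shapeMatrix] at e1 e2
    rwa [e1, e2, inChart_self, inChart_self] at h1
  ext i
  rw [PiLp.zero_apply]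
  refine le_antisymm ?_ ?_
  · obtain ⟨p₀, h1, h2⟩ := hmax α β i
    rw [hL] at h2
    simp only [PiLp.add_apply, PiLp.smul_apply, smul_eq_mul] at h1 h2 ⊢
    nlinarith [mul_le_mul_of_nonneg_left (h1 p) hk]
  · obtain ⟨p₀, h1, h2⟩ := hmax (-α) (-β) i
    have h3 := congrFun (congrArg WithLp.ofLp (hL p₀)) i
    simp only [PiLp.add_apply, PiLp.smul_apply, PiLp.sub_apply, PiLp.neg_apply, smul_eq_mul]
      at h1 h2 h3 ⊢
    nlinarith [mul_le_mul_of_nonneg_left (h1 p) hk]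

/-- If mq > τ², the linear system for (Δφ, Δη) has negative determinant -c(mq-τ²), hence a positive
eigenvalue. The maximum principle then kills a combination of φ and η whose η-coefficient is
positive. -/
theorem mul_trace_sq_eq [CompactSpace M] [Nonempty M] (hc : 0 < c) (hm : m ≠ 0) {τ q : ℝ}
    (hτ : ∀ p, (shapeMatrix φ η p).trace = τ)
    (hq : ∀ p, (shapeMatrix φ η p * shapeMatrix φ η p).trace = q) : m * q = τ ^ 2 := by
  obtain ⟨p⟩ := ‹Nonempty M›
  have hle : τ ^ 2 ≤ m * q := by
    have := (hφ.inChart hη p).sq_trace_le (mem_extChartAt_target p)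
    rwa [← hτ p, ← hq p]
  refine le_antisymm (not_lt.1 fun hlt => ?_) hle
  have hm' : (0 : ℝ) < m := by exact_mod_cast Nat.pos_of_ne_zero hm
  have hpos : 0 < 4 * (c * (m * q - τ ^ 2)) := by
    have := sub_pos.2 hlt
    positivity
  set s := √((q - m * c) ^ 2 + 4 * (c * (m * q - τ ^ 2))) with hs
  have hs2 : s ^ 2 = (q - m * c) ^ 2 + 4 * (c * (m * q - τ ^ 2)) := Real.sq_sqrt (by positivity)
  have hs0 : 0 ≤ s := Real.sqrt_nonneg _
  -- The positive root of μ² - (q-mc)μ - c(mq-τ²) = 0, the characteristic equation of the system.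
  set μ := (q - m * c + s) / 2 with hμ
  have hμ0 : 0 < μ := by
    have : -(q - m * c) < s := by
      refine lt_of_pow_lt_pow_left₀ 2 hs0 ?_
      rw [hs2]
      nlinarith
    linarith
  have hroot : (μ + m * c) * (μ - q) + c * τ ^ 2 = 0 := by
    have : s = 2 * μ - (q - m * c) := by rw [hμ]; ring
    rw [this] at hs2
    linarith
  -- (cτ, mc+μ) is a left eigenvector of the coefficient matrix for the eigenvalue μ.
  have h := laplacian_eq_zero hφ hη hc hτ hq (α := c * τ) (β := m * c + μ) hμ0.le (w := 0)
    (fun p => by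
      rw [add_zero]
      have e1 : c * τ * -(m * c) + (m * c + μ) * (c * τ) = μ * (c * τ) := by ring
      have e2 : c * τ * -τ + (m * c + μ) * q = μ * (m * c + μ) := by linarith
      calc _ = (c * τ * -(m * c) + (m * c + μ) * (c * τ)) • φ p
            + (c * τ * -τ + (m * c + μ) * q) • η p := by module
        _ = _ := by rw [e1, e2]; module) p
  have h2 := congrArg (fun v => lorentz v (η p)) h
  simp only [add_zero, lorentz_smul_left, lorentz_add_left, lorentz_zero_left,
    hη.unit p (Set.mem_univ p), lorentz_comm (φ p) (η p), hη.tangent_deSitter p (Set.mem_univ p)] at h2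
  have : 0 < μ * (m * c + μ) := by positivity
  linarith

/-- A compact hypersurface with constant nonzero mean curvature and constant squared norm of the
second fundamental form lies in a spacelike hyperplane section of de Sitter space. -/
theorem exists_const_vector [CompactSpace M] [ConnectedSpace M] (hc : 0 < c) (hm : m ≠ 0) {τ q : ℝ}
    (hτ0 : τ ≠ 0) (hτ : ∀ p, (shapeMatrix φ η p).trace = τ)
    (hq : ∀ p, (shapeMatrix φ η p * shapeMatrix φ η p).trace = q) :
    ∃ (lam : ℝ) (a : EuclideanSpace ℝ (Fin (m + 2))), lam ≠ 0 ∧ lam ^ 2 < c ∧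
      lorentz a a = lam ^ 2 / c - 1 ∧ (∀ p, lorentz (φ p) a = lam / c) ∧
      ∀ p (v : TangentSpace (𝓡 m) p), lorentz (diff φ p v) a = 0 := by
  have hm' : (m : ℝ) ≠ 0 := by exact_mod_cast hm
  have hmq := mul_trace_sq_eq hφ hη hc hm hτ hq
  set lam := τ / m with hlam
  have hτm : τ = m * lam := by rw [hlam]; field_simp
  -- Umbilicity A = λ·1 turns the Weingarten formula into dη = -λ dφ.
  have hconst : ∃ a, ∀ p, η p + lam • φ p = a := by
    have hsm := fun p => (hφ.inChart hη p).smooth_normal.add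
      ((hφ.inChart hη p).smooth.const_smul lam)
    refine exists_eq_of_fderiv_inChart (F := fun p => η p + lam • φ p)
      (fun p => (hsm p).differentiableOn (by simp)) fun p x hx => ?_
    have H := hφ.inChart hη p
    have hW : weingarten (DeSitterHypersurface.inChart φ p) (DeSitterHypersurface.inChart η p) x
        = lam • 1 := by
      obtain ⟨J, -, -, h1, h2, -⟩ := exists_weingarten_inChart hφ hη p hx
      rw [hτ] at h1
      rw [hq] at h2
      rw [H.weingarten_eq_smul_one hx hm (by rw [h1, h2, hmq]), h1]
    ext1 v
    rw [fderiv_eq_sum_partialDeriv]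
    refine Finset.sum_eq_zero fun k _ => ?_
    have hk : partialDeriv (DeSitterHypersurface.inChart (fun p => η p + lam • φ p) p) k x = 0 := by
      change partialDeriv (fun y => DeSitterHypersurface.inChart η p y
        + lam • DeSitterHypersurface.inChart φ p y) k x = 0
      rw [partialDeriv_add (G := fun y => lam • DeSitterHypersurface.inChart φ p y) (H.smooth_normal.diffAt H.isOpen hx)
        ((differentiableAt_const lam).smul (H.smooth.diffAt H.isOpen hx)),
        partialDeriv_smul (differentiableAt_const _) (H.smooth.diffAt H.isOpen hx),
        partialDeriv_const, H.partialDeriv_normal hc hx, hW]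
      simp [Matrix.one_apply]
    rw [hk, smul_zero]
  obtain ⟨a, ha⟩ := hconst
  have h1 : ∀ p, lorentz (φ p) (η p) = 0 := fun p => by
    rw [lorentz_comm, hη.tangent_deSitter p (Set.mem_univ p)]
  have h2 : ∀ p, lorentz (φ p) (φ p) = 1 / c := hφ.mem_deSitter
  refine ⟨lam, a, div_ne_zero hτ0 hm', not_le.1 fun hle => ?_, ?_, fun p => ?_, fun p v => ?_⟩
  · obtain ⟨p⟩ := ‹ConnectedSpace M›.toNonempty
    -- If λ² ≥ c, then Δφ = m(λ²-c)φ - mλa must vanish. Its product with φ is -m, a contradiction.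
    have h := laplacian_eq_zero hφ hη hc hτ hq (α := 1) (β := 0) (k := m * (lam ^ 2 - c))
      (mul_nonneg (Nat.cast_nonneg m) (sub_nonneg.2 hle)) (w := -(m * lam) • a)
      (fun p => by rw [← ha p, hτm]; module) p
    have h3 := congrArg (lorentz (φ p)) h
    simp only [← ha p, lorentz_add_right, lorentz_smul_right, lorentz_zero_right, h1, h2] at h3
    refine hm' ?_
    have h4 : m * (lam ^ 2 - c) * (1 * (1 / c) + 0 * 0) + -(m * lam) * (0 + lam * (1 / c)) = 0 := h3
    calc (m : ℝ) = -(m * (lam ^ 2 - c) * (1 * (1 / c) + 0 * 0) + -(m * lam) * (0 + lam * (1 / c))) := by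
          field_simp; ring
      _ = 0 := by rw [h4, neg_zero]
  · obtain ⟨p⟩ := ‹ConnectedSpace M›.toNonempty
    rw [← ha p]
    simp only [lorentz_add_left, lorentz_add_right, lorentz_smul_left, lorentz_smul_right, h1, h2,
      hη.unit p (Set.mem_univ p), hη.tangent_deSitter p (Set.mem_univ p)]
    ring
  · rw [← ha p, lorentz_add_right, lorentz_smul_right, h1, h2]
    ring
  · rw [lorentz_comm, ← ha p, lorentz_add_left, lorentz_smul_left,
      hη.normal p (Set.mem_univ p), hφ.lorentz_position_diff]
    ring

end Umbilical

/-! ### Coverings of spheres -/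

section Sphere

open Real

variable {E : Type*} [NormedAddCommGroup E] [InnerProductSpace ℝ E] {R : ℝ} {y : E}

/-- Polar coordinates of the sphere of radius `R` around the point `y`. -/
def polarMap (R : ℝ) (y x : E) : E := cos ‖x‖ • y + (R * sinc ‖x‖) • x

theorem continuous_polarMap : Continuous (polarMap R y) :=
  ((continuous_cos.comp continuous_norm).smul continuous_const).add
    ((continuous_const.mul (continuous_sinc.comp continuous_norm)).smul continuous_id)

theorem sinc_mul_self (t : ℝ) : sinc t * t = sin t := by
  by_cases h : t = 0
  · simp [h]
  · rw [sinc_of_ne_zero h, div_mul_cancel₀ _ h]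

theorem norm_polarMap (hR : 0 < R) (hy : ‖y‖ = R) {x : E} (hx : inner ℝ y x = 0) :
    ‖polarMap R y x‖ = R := by
  have h : ‖polarMap R y x‖ ^ 2 = R ^ 2 := by
    rw [polarMap, norm_add_sq_real, inner_smul_left, inner_smul_right, hx, norm_smul, norm_smul, hy,
      mul_pow, mul_pow, Real.norm_eq_abs, Real.norm_eq_abs, sq_abs, sq_abs]
    have h1 := sinc_mul_self ‖x‖
    have h2 := sin_sq_add_cos_sq ‖x‖
    rw [← h1] at h2
    linear_combination R ^ 2 * h2
  exact (pow_left_inj₀ (norm_nonneg _) hR.le two_ne_zero).1 h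

theorem inner_polarMap (hy : ‖y‖ = R) {x : E} (hx : inner ℝ y x = 0) :
    inner ℝ y (polarMap R y x) = cos ‖x‖ * R ^ 2 := by
  rw [polarMap, inner_add_right, inner_smul_right, inner_smul_right, hx, mul_zero, add_zero,
    real_inner_self_eq_norm_sq, hy]

/-- The product with y determines cos‖x‖, hence ‖x‖ in [0, π]; below π the component orthogonal to y
then determines x. Only the boundary sphere is collapsed, to -y. -/
theorem polarMap_eq (hR : 0 < R) (hy : ‖y‖ = R) {x x' : E} (hx : inner ℝ y x = 0)
    (hx' : inner ℝ y x' = 0) (h : ‖x‖ ≤ π) (h' : ‖x'‖ ≤ π)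
    (he : polarMap R y x = polarMap R y x') : x = x' ∨ (‖x‖ = π ∧ ‖x'‖ = π) := by
  have h1 := congrArg (inner ℝ y) he
  rw [inner_polarMap hy hx, inner_polarMap hy hx'] at h1
  have h2 : ‖x‖ = ‖x'‖ := injOn_cos ⟨norm_nonneg _, h⟩ ⟨norm_nonneg _, h'⟩
    (mul_right_cancel₀ (pow_ne_zero 2 hR.ne') h1)
  rcases h.lt_or_eq with hlt | heq
  · left
    rw [polarMap, polarMap, ← h2, add_right_inj] at he
    refine smul_right_injective E (mul_ne_zero hR.ne' ?_) he
    by_cases h0 : ‖x‖ = 0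
    · rw [h0, sinc_zero]; exact one_ne_zero
    · rw [sinc_of_ne_zero h0]
      exact div_ne_zero (sin_pos_of_pos_of_lt_pi (lt_of_le_of_ne (norm_nonneg _) (Ne.symm h0)) hlt).ne' h0
  · exact Or.inr ⟨heq, h2 ▸ heq⟩

theorem exists_polarMap_eq (hR : 0 < R) (hy : ‖y‖ = R) {e₀ : E} (he₀ : inner ℝ y e₀ = 0)
    (he₁ : ‖e₀‖ = 1) {z : E} (hz : ‖z‖ = R) :
    ∃ x, inner ℝ y x = 0 ∧ ‖x‖ ≤ π ∧ polarMap R y x = z := by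
  set a := inner ℝ y z / R ^ 2 with ha
  have hR2 : 0 < R ^ 2 := by positivity
  have hyz : inner ℝ y z = a * R ^ 2 := by rw [ha]; field_simp
  have habs := abs_real_inner_le_norm y z
  rw [hy, hz, hyz, abs_mul, abs_of_pos hR2, ← pow_two] at habs
  have habs1 : |a| ≤ 1 := by
    by_contra! h
    nlinarith
  obtain ⟨ha1, ha2⟩ := abs_le.1 habs1
  set θ := arccos a with hθ
  have hcos : cos θ = a := cos_arccos ha1 ha2
  have hθ0 : 0 ≤ θ := arccos_nonneg a
  have hθπ : θ ≤ π := arccos_le_pi a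
  have hsin0 : 0 ≤ sin θ := sin_nonneg_of_nonneg_of_le_pi hθ0 hθπ
  have hyw : inner ℝ y (z - a • y) = 0 := by
    rw [inner_sub_right, inner_smul_right, real_inner_self_eq_norm_sq, hy, hyz, sub_self]
  have hw : ‖z - a • y‖ = R * sin θ := by
    refine (pow_left_inj₀ (norm_nonneg _) (by positivity) two_ne_zero).1 ?_
    rw [norm_sub_sq_real, inner_smul_right, real_inner_comm, hyz, norm_smul, hy, hz, mul_pow, mul_pow,
      sin_sq, hcos, Real.norm_eq_abs, sq_abs]
    ring
  -- When z = ±y no direction is determined, and the given unit vector e₀ is used.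
  obtain ⟨e, h1, h2, h3⟩ : ∃ e, inner ℝ y e = 0 ∧ ‖e‖ = 1 ∧ z - a • y = (R * sin θ) • e := by
    by_cases hs : sin θ = 0
    · rw [hs, mul_zero, norm_eq_zero] at hw
      exact ⟨e₀, he₀, he₁, by rw [hw, hs, mul_zero, zero_smul]⟩
    · have hne : R * sin θ ≠ 0 := mul_ne_zero hR.ne' hs
      refine ⟨(R * sin θ)⁻¹ • (z - a • y), ?_, ?_, ?_⟩
      · rw [inner_smul_right, hyw, mul_zero]
      · rw [norm_smul, hw, norm_inv, Real.norm_eq_abs, abs_of_nonneg (by positivity),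
          inv_mul_cancel₀ hne]
      · rw [smul_inv_smul₀ hne]
  have hx : ‖θ • e‖ = θ := by rw [norm_smul, h2, mul_one, Real.norm_eq_abs, abs_of_nonneg hθ0]
  refine ⟨θ • e, by rw [inner_smul_right, h1, mul_zero], hx.trans_le hθπ, ?_⟩
  rw [polarMap, hx, hcos, smul_smul, mul_assoc, sinc_mul_self, ← h3]
  abel

/-- A connected covering of a sphere of dimension at least two is trivial. -/
theorem injective_of_isCoveringMap_sphere [FiniteDimensional ℝ E] (hd : 2 < Module.finrank ℝ E)
    (hR : 0 < R) {X : Type*} [TopologicalSpace X] [PreconnectedSpace X]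
    {F : X → Metric.sphere (0 : E) R} (hF : IsCoveringMap F) : Function.Injective F := by
  intro p₁ p₂ hp
  obtain ⟨y, hy⟩ : ∃ y : E, y = F p₁ := ⟨_, rfl⟩
  have hyR : ‖y‖ = R := hy ▸ mem_sphere_zero_iff_norm.1 (F p₁).2
  have hy0 : y ≠ 0 := norm_ne_zero_iff.1 (hyR ▸ hR.ne')
  let V := (Submodule.span ℝ {y})ᗮ
  have hV : ∀ x : V, inner ℝ y (x : E) = 0 := fun x =>
    Submodule.mem_orthogonal_singleton_iff_inner_right.1 x.2
  have hrank : 1 < Module.finrank ℝ V := by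
    have := Submodule.finrank_add_finrank_orthogonal (Submodule.span ℝ {y})
    rw [finrank_span_singleton hy0] at this
    change 1 < Module.finrank ℝ ((Submodule.span ℝ {y})ᗮ : Submodule ℝ E)
    omega
  have hrank' : 1 < Module.rank ℝ V := by
    rw [← Module.finrank_eq_rank]
    exact_mod_cast hrank
  have : Nontrivial V := Module.nontrivial_of_finrank_pos (R := ℝ) (by omega)
  obtain ⟨e₀, he₀⟩ := exists_norm_eq V zero_le_one
  let e : C(V, Metric.sphere (0 : E) R) :=
    ⟨fun x => ⟨polarMap R y x, mem_sphere_zero_iff_norm.2 (norm_polarMap hR hyR (hV x))⟩,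
      (continuous_polarMap.comp continuous_subtype_val).subtype_mk _⟩
  have he0 : F p₁ = e 0 := Subtype.ext (by simp [e, polarMap, ← hy])
  -- The tangent space V is simply connected, so the polar map lifts through the covering.
  obtain ⟨f, ⟨hf0, hf⟩, -⟩ := hF.existsUnique_continuousMap_lifts e 0 p₁ he0
  have hf' : ∀ x, F (f x) = e x := congrFun hf
  let D := Metric.closedBall (0 : V) π
  have hD : ∀ x ∈ D, ‖(x : E)‖ ≤ π := fun x hx => mem_closedBall_zero_iff.1 hx
  have : CompactSpace D := isCompact_iff_compactSpace.1 (isCompact_closedBall _ _)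
  let eD : C(D, Metric.sphere (0 : E) R) := e.comp ⟨Subtype.val, continuous_subtype_val⟩
  have hsurj : Function.Surjective eD := by
    intro z
    obtain ⟨x, h1, h2, h3⟩ := exists_polarMap_eq hR hyR (hV e₀) he₀
      (mem_sphere_zero_iff_norm.1 z.2)
    exact ⟨⟨⟨x, Submodule.mem_orthogonal_singleton_iff_inner_right.2 h1⟩,
      mem_closedBall_zero_iff.2 h2⟩, Subtype.ext h3⟩
  -- The polar map sends the sphere of radius π in V to the single point -y. That sphere is
  -- connected because dim V ≥ 2, so the lift is constant on it.
  have hbd : ∀ x x' : V, ‖x‖ = π → ‖x'‖ = π → f x = f x' := by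
    intro x x' hx hx'
    have hval : ∀ v : V, ‖v‖ = π → (e v : E) = -y := fun v hv => by
      have hv' : ‖(v : E)‖ = π := hv
      change polarMap R y v = -y
      rw [polarMap, hv', cos_pi, sinc_of_ne_zero pi_ne_zero, sin_pi]
      simp
    refine hF.constOn_of_comp (isPreconnected_sphere hrank' (0 : V) π) f.continuous.continuousOn
      (fun a ha a' ha' => ?_) (mem_sphere_zero_iff_norm.2 hx) (mem_sphere_zero_iff_norm.2 hx')
    rw [hf', hf']
    exact Subtype.ext ((hval a (mem_sphere_zero_iff_norm.1 ha)).trans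
      (hval a' (mem_sphere_zero_iff_norm.1 ha')).symm)
  let fD : C(D, X) := f.comp ⟨Subtype.val, continuous_subtype_val⟩
  have hq : Topology.IsQuotientMap eD :=
    Topology.IsQuotientMap.of_surjective_continuous hsurj eD.continuous
  have hft : Function.FactorsThrough fD eD := by
    intro a b hab
    rcases polarMap_eq hR hyR (hV a) (hV b) (hD a a.2) (hD b b.2) (congrArg Subtype.val hab)
      with h | ⟨h, h'⟩
    · exact congrArg f (Subtype.ext h)
    · exact hbd _ _ h h'
  -- The lift is thus constant on the fibres of the quotient map from the closed ball to the sphere,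
  -- and descends to a section of F.
  obtain ⟨s, hs⟩ : ∃ s : C(Metric.sphere (0 : E) R, X), ∀ d : D, s (eD d) = f d :=
    ⟨hq.lift fD hft, fun d => DFunLike.congr_fun (hq.lift_comp fD hft) d⟩
  have hFs : ∀ z, F (s z) = z := by
    intro z
    obtain ⟨d, rfl⟩ := hsurj z
    rw [hs, hf']
    rfl
  -- Both maps lift F and they agree at p₁. Since X is connected they coincide, which makes F
  -- injective.
  have hsF : s ∘ F = id := by
    refine hF.eq_of_comp_eq (s.continuous.comp hF.continuous) continuous_id
      (funext fun p => hFs (F p)) p₁ ?_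
    have h0 := hs ⟨0, Metric.mem_closedBall_self pi_pos.le⟩
    change s (e 0) = f 0 at h0
    rw [Function.comp_apply, he0, h0, hf0, id]
  rw [← id_eq (a := p₁)]
  have h1 := congrFun hsF p₁
  have h2 := congrFun hsF p₂
  rw [Function.comp_apply] at h1 h2
  rw [id] at h1 h2
  rw [id, ← h1, ← h2, ← hp, h1]

/-- Compactness makes the local homeomorphism a covering map, and its range is both open and closed
in a connected sphere. -/
theorem bijective_of_isLocalHomeomorph_sphere [FiniteDimensional ℝ E]
    (hd : 2 < Module.finrank ℝ E) (hR : 0 < R) {X : Type*} [TopologicalSpace X] [CompactSpace X]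
    [T2Space X] [ConnectedSpace X] {F : X → Metric.sphere (0 : E) R} (hF : IsLocalHomeomorph F) :
    Function.Bijective F := by
  refine ⟨injective_of_isCoveringMap_sphere hd hR (isLocalHomeomorph_iff_isCoveringMap.1 hF), ?_⟩
  have hrank : 1 < Module.rank ℝ E := by
    rw [← Module.finrank_eq_rank]
    exact_mod_cast (by omega : 1 < Module.finrank ℝ E)
  have : PreconnectedSpace (Metric.sphere (0 : E) R) :=
    isPreconnected_iff_preconnectedSpace.1 (isPreconnected_sphere hrank 0 R)
  have hcl : IsClopen (Set.range F) :=
    ⟨(isCompact_range hF.continuous).isClosed, hF.isOpenMap.isOpen_range⟩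
  exact Set.range_eq_univ.1 (hcl.eq_univ (Set.range_nonempty F))

end Sphere

/-! ### Local isometries onto spheres -/

section LocalHomeomorph

open Topology

variable {m : ℕ} {M : Type*} [TopologicalSpace M]
  [ChartedSpace (EuclideanSpace ℝ (Fin m)) M] [IsManifold (𝓡 m) ∞ M]
  {E : Type*} [NormedAddCommGroup E] [InnerProductSpace ℝ E] [FiniteDimensional ℝ E]
  {R : ℝ} {F : M → E}

theorem _root_.Topology.isLocalHomeomorph_of_injOn {X Y : Type*} [TopologicalSpace X]
    [TopologicalSpace Y] {f : X → Y} (hc : Continuous f) (ho : IsOpenMap f)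
    (hi : ∀ x, ∃ U ∈ 𝓝 x, Set.InjOn f U) : IsLocalHomeomorph f := by
  rw [isLocalHomeomorph_iff_isOpenEmbedding_restrict]
  intro x
  obtain ⟨U, hU, hinj⟩ := hi x
  obtain ⟨V, hVU, hV, hxV⟩ := mem_nhds_iff.1 hU
  exact ⟨V, hV.mem_nhds hxV, .of_continuous_injective_isOpenMap (hc.comp continuous_subtype_val)
    (Set.injOn_iff_injective.1 (hinj.mono hVU)) (ho.domRestrict hV)⟩

/-- The radial extension of a codimension one immersion transversal to the position vector has
invertible derivative. -/
theorem exists_hasStrictFDerivAt_radial {ψ : EuclideanSpace ℝ (Fin m) → E}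
    {x : EuclideanSpace ℝ (Fin m)} (hE : Module.finrank ℝ E = m + 1) (hψ : ContDiffAt ℝ ∞ ψ x)
    (h0 : ψ x ≠ 0) (hinj : ∀ v, fderiv ℝ ψ x v = 0 → v = 0)
    (hperp : ∀ v, inner ℝ (fderiv ℝ ψ x v) (ψ x) = 0) :
    ∃ Φ : (EuclideanSpace ℝ (Fin m) × ℝ) ≃L[ℝ] E,
      HasStrictFDerivAt (fun z : EuclideanSpace ℝ (Fin m) × ℝ => z.2 • ψ z.1)
        (Φ : (EuclideanSpace ℝ (Fin m) × ℝ) →L[ℝ] E) (x, 1) := by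
  have h1 : HasStrictFDerivAt ψ (fderiv ℝ ψ x) x := hψ.hasStrictFDerivAt (by simp)
  have h2 := (hasStrictFDerivAt_snd (𝕜 := ℝ) (E := EuclideanSpace ℝ (Fin m)) (F := ℝ)
    (p := (x, 1))).smul (HasStrictFDerivAt.comp (x, (1 : ℝ)) h1 hasStrictFDerivAt_fst)
  set Φ := (1 : ℝ) • (fderiv ℝ ψ x).comp (ContinuousLinearMap.fst ℝ (EuclideanSpace ℝ (Fin m)) ℝ)
    + (ContinuousLinearMap.snd ℝ (EuclideanSpace ℝ (Fin m)) ℝ).smulRight (ψ x) with hΦ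
  have hΦa : ∀ z, Φ z = fderiv ℝ ψ x z.1 + z.2 • ψ x := fun z => by simp [hΦ]
  have hΦi : Function.Injective (Φ : EuclideanSpace ℝ (Fin m) × ℝ →ₗ[ℝ] E) := by
    rw [injective_iff_map_eq_zero]
    intro z hz
    have hz' : fderiv ℝ ψ x z.1 + z.2 • ψ x = 0 := (hΦa z).symm.trans hz
    have h3 := congrArg (fun w => inner ℝ w (ψ x)) hz'
    simp only [inner_add_left, hperp, inner_smul_left, inner_zero_left, zero_add,
      real_inner_self_eq_norm_sq] at h3
    have h4 : z.2 = 0 := by simpa [h0] using h3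
    rw [h4, zero_smul, add_zero] at hz'
    exact Prod.ext (hinj _ hz') h4
  have hdim : Module.finrank ℝ (EuclideanSpace ℝ (Fin m) × ℝ) = Module.finrank ℝ E := by
    rw [hE, Module.finrank_prod, finrank_euclideanSpace_fin, Module.finrank_self]
  refine ⟨((Φ : EuclideanSpace ℝ (Fin m) × ℝ →ₗ[ℝ] E).linearEquivOfInjective hΦi
    hdim).toContinuousLinearEquiv, ?_⟩
  have he : ((((Φ : EuclideanSpace ℝ (Fin m) × ℝ →ₗ[ℝ] E).linearEquivOfInjective hΦi
    hdim).toContinuousLinearEquiv : _ ≃L[ℝ] E) : EuclideanSpace ℝ (Fin m) × ℝ →L[ℝ] E) = Φ := by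
    exact ContinuousLinearMap.ext fun z => rfl
  rw [he]
  exact h2

/-- The extension (x, t) ↦ t F(x) maps between vector spaces of equal dimension, so the inverse
function theorem applies without charts on the sphere. -/
theorem isLocalHomeomorph_sphere (hE : Module.finrank ℝ E = m + 1) (hR : 0 < R)
    (hF : ContMDiff (𝓡 m) 𝓘(ℝ, E) ∞ F) (hmem : ∀ p, F p ∈ Metric.sphere (0 : E) R)
    (hinj : ∀ p (v : TangentSpace (𝓡 m) p), diff F p v = 0 → v = 0)
    (hperp : ∀ p (v : TangentSpace (𝓡 m) p), inner ℝ (diff F p v) (F p) = 0) :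
    IsLocalHomeomorph (fun p => (⟨F p, hmem p⟩ : Metric.sphere (0 : E) R)) := by
  have hnorm : ∀ p, ‖F p‖ = R := fun p => mem_sphere_zero_iff_norm.1 (hmem p)
  have key : ∀ p, ∃ Φ : (EuclideanSpace ℝ (Fin m) × ℝ) ≃L[ℝ] E,
      HasStrictFDerivAt (fun z : EuclideanSpace ℝ (Fin m) × ℝ => z.2 • inChart F p z.1)
        (Φ : (EuclideanSpace ℝ (Fin m) × ℝ) →L[ℝ] E) (extChartAt (𝓡 m) p p, 1) := by
    intro p
    have hd := diff_eq_fderiv (hF.mdifferentiableAt (x := p) (by simp))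
    refine exists_hasStrictFDerivAt_radial hE ((contDiffOn_inChart_univ hF p).contDiffAt
      (extChartAt_target_mem_nhds p)) ?_ (fun v hv => hinj p v ((hd v).trans hv)) (fun v => ?_)
    · rw [inChart_self]
      exact norm_ne_zero_iff.1 (by rw [hnorm]; exact hR.ne')
    · rw [inChart_self]
      exact (congrArg (inner ℝ · (F p)) (hd v)).symm.trans (hperp p v)
  refine isLocalHomeomorph_of_injOn (hF.continuous.subtype_mk _)
    (isOpenMap_iff_nhds_le.2 fun p N hN => ?_) fun p => ?_
  · obtain ⟨Φ, hΦ⟩ := key p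
    rw [Filter.mem_map] at hN
    have hA : {z : EuclideanSpace ℝ (Fin m) × ℝ | (extChartAt (𝓡 m) p).symm z.1 ∈
        (fun p => (⟨F p, hmem p⟩ : Metric.sphere (0 : E) R)) ⁻¹' N ∧ 0 < z.2}
        ∈ 𝓝 (extChartAt (𝓡 m) p p, (1 : ℝ)) := by
      have hA' : (extChartAt (𝓡 m) p).symm ⁻¹'
          ((fun p => (⟨F p, hmem p⟩ : Metric.sphere (0 : E) R)) ⁻¹' N)
          ∈ 𝓝 (extChartAt (𝓡 m) p p) :=
        (continuousAt_extChartAt_symm (I := 𝓡 m) p) (by rwa [extChartAt_to_inv])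
      rw [nhds_prod_eq]
      exact Filter.prod_mem_prod hA' (Ioi_mem_nhds (zero_lt_one' ℝ))
    have hB := Filter.image_mem_map (m := fun z : EuclideanSpace ℝ (Fin m) × ℝ =>
      z.2 • inChart F p z.1) hA
    rw [hΦ.map_nhds_eq_of_equiv, inChart_self, one_smul] at hB
    filter_upwards [(continuous_subtype_val (p := fun y => y ∈ Metric.sphere (0 : E) R)).continuousAt
      (x := ⟨F p, hmem p⟩) hB] with y hy
    obtain ⟨z, ⟨hz1, hz2⟩, hz⟩ := hy
    have hn := congrArg norm hz
    rw [norm_smul, mem_sphere_zero_iff_norm.1 y.2, inChart, Function.comp_apply, hnorm,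
      Real.norm_eq_abs, abs_of_pos hz2] at hn
    -- A point of the sphere of the form t F(q) with t > 0 has t = 1 by comparing norms, so it lies
    -- in the image of F.
    have ht : z.2 = 1 := mul_right_cancel₀ hR.ne' (hn.trans (one_mul R).symm)
    simp only [ht, one_smul] at hz
    have : y = ⟨F ((extChartAt (𝓡 m) p).symm z.1), hmem _⟩ := Subtype.ext hz.symm
    rw [this]
    exact hz1
  · obtain ⟨Φ, hΦ⟩ := key p
    set e := hΦ.toOpenPartialHomeomorph _
    refine ⟨(extChartAt (𝓡 m) p).source ∩ {q | (extChartAt (𝓡 m) p q, (1 : ℝ)) ∈ e.source},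
      Filter.inter_mem (extChartAt_source_mem_nhds p) ?_, ?_⟩
    · exact ((continuousAt_extChartAt (I := 𝓡 m) p).prodMk continuousAt_const)
        (e.open_source.mem_nhds hΦ.mem_toOpenPartialHomeomorph_source)
    · intro q hq q' hq' h
      have hval : ∀ q ∈ (extChartAt (𝓡 m) p).source, e (extChartAt (𝓡 m) p q, (1 : ℝ)) = F q := by
        intro q hq
        change (1 : ℝ) • inChart F p (extChartAt (𝓡 m) p q) = F q
        rw [one_smul, inChart, Function.comp_apply, (extChartAt (𝓡 m) p).left_inv hq]
      have h1 := e.injOn hq.2 hq'.2 (by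
        rw [hval q hq.1, hval q' hq'.1]
        exact congrArg Subtype.val h)
      exact (extChartAt (𝓡 m) p).injOn hq.1 hq'.1 (congrArg Prod.fst h1)

end LocalHomeomorph

/-! ### From a spacelike hyperplane section to the Euclidean sphere -/

section Isometry

variable {n : ℕ} {u : EuclideanSpace ℝ (Fin (n + 1))}

/-- The projection along the axis of the Lorentz boost that takes `u` to the time direction. -/
def spacePart (u : EuclideanSpace ℝ (Fin (n + 1))) :
    EuclideanSpace ℝ (Fin (n + 1)) →L[ℝ] EuclideanSpace ℝ (Fin n) :=
  LinearMap.toContinuousLinearMap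
    { toFun := fun v => WithLp.toLp 2 fun i => v i.succ - v 0 / (u 0 + 1) * u i.succ
      map_add' := fun v w => by ext i; simp only [PiLp.add_apply]; ring
      map_smul' := fun a v => by
        ext i
        simp only [PiLp.smul_apply, smul_eq_mul, RingHom.id_apply]
        ring }

theorem spacePart_apply (v : EuclideanSpace ℝ (Fin (n + 1))) (i : Fin n) :
    spacePart u v i = v i.succ - v 0 / (u 0 + 1) * u i.succ := rfl

/-- For v orthogonal to u, the boost taking u to e₀ sends v to v - v₀/(u₀+1)·(u+e₀), which has zero
time component. `spacePart` keeps the remaining coordinates, so it is isometric on the complement of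
u. -/
theorem inner_spacePart (hu : lorentz u u = -1) (hu0 : 0 < u 0)
    {v w : EuclideanSpace ℝ (Fin (n + 1))} (hv : lorentz v u = 0) (hw : lorentz w u = 0) :
    inner ℝ (spacePart u v) (spacePart u w) = lorentz v w := by
  have h : inner ℝ (spacePart u v) (spacePart u w) = ∑ i : Fin n, v i.succ * w i.succ
      - w 0 / (u 0 + 1) * ∑ i : Fin n, v i.succ * u i.succ
      - v 0 / (u 0 + 1) * ∑ i : Fin n, w i.succ * u i.succ
      + v 0 / (u 0 + 1) * (w 0 / (u 0 + 1)) * ∑ i : Fin n, u i.succ * u i.succ := by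
    rw [PiLp.inner_apply, Finset.mul_sum, Finset.mul_sum, Finset.mul_sum,
      ← Finset.sum_sub_distrib, ← Finset.sum_sub_distrib, ← Finset.sum_add_distrib]
    refine Finset.sum_congr rfl fun i _ => ?_
    rw [spacePart_apply, spacePart_apply]
    simp only [RCLike.inner_apply, conj_trivial]
    ring
  simp only [lorentz] at hu hv hw ⊢
  have h1 : ∑ i : Fin n, v i.succ * u i.succ = v 0 * u 0 := by linarith
  have h2 : ∑ i : Fin n, w i.succ * u i.succ = w 0 * u 0 := by linarith
  have h3 : ∑ i : Fin n, u i.succ * u i.succ = u 0 * u 0 - 1 := by linarith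
  rw [h, h1, h2, h3]
  have : u 0 + 1 ≠ 0 := by positivity
  field_simp
  ring

/-- The sign of k is chosen to make the time component positive, which keeps the denominator u₀ + 1
in `spacePart` non-zero. -/
theorem exists_smul_futureUnit {a : EuclideanSpace ℝ (Fin (n + 1))} (ha : lorentz a a < 0) :
    ∃ k : ℝ, lorentz (k • a) (k • a) = -1 ∧ 0 < (k • a) 0 := by
  have ha0 : a 0 ≠ 0 := by
    intro h0
    have : 0 ≤ ∑ i : Fin n, a i.succ * a i.succ :=
      Finset.sum_nonneg fun i _ => mul_self_nonneg _
    simp only [lorentz, h0] at ha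
    linarith
  obtain ⟨s, hs, hs2⟩ : ∃ s : ℝ, 0 < s ∧ s * s * -lorentz a a = 1 := by
    refine ⟨√(-lorentz a a)⁻¹, Real.sqrt_pos.2 (inv_pos.2 (neg_pos.2 ha)), ?_⟩
    rw [Real.mul_self_sqrt (inv_nonneg.2 (neg_pos.2 ha).le), inv_mul_cancel₀ (neg_pos.2 ha).ne']
  rcases lt_or_gt_of_ne ha0 with h | h
  · refine ⟨-s, ?_, ?_⟩
    · rw [lorentz_smul_left, lorentz_smul_right]
      linarith
    · rw [PiLp.smul_apply, smul_eq_mul]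
      nlinarith
  · refine ⟨s, ?_, ?_⟩
    · rw [lorentz_smul_left, lorentz_smul_right]
      linarith
    · rw [PiLp.smul_apply, smul_eq_mul]
      positivity

/-- A compact spacelike section of de Sitter space by a spacelike hyperplane is a round sphere. -/
theorem isometricToSphere_of_const_vector {m : ℕ} (hm : 2 ≤ m) {c : ℝ} (hc : 0 < c) {M : Type*}
    [TopologicalSpace M] [T2Space M] [CompactSpace M] [ConnectedSpace M]
    [ChartedSpace (EuclideanSpace ℝ (Fin m)) M] [IsManifold (𝓡 m) ∞ M]
    {φ : M → EuclideanSpace ℝ (Fin (m + 2))} (hφ : IsSpacelikeHypersurface c φ) {lam : ℝ}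
    {a : EuclideanSpace ℝ (Fin (m + 2))} (hlam : lam ^ 2 < c)
    (ha : lorentz a a = lam ^ 2 / c - 1) (hφa : ∀ p, lorentz (φ p) a = lam / c)
    (hda : ∀ p (v : TangentSpace (𝓡 m) p), lorentz (diff φ p v) a = 0) :
    IsometricToSphere φ (c - lam ^ 2) := by
  obtain ⟨c₁, hc₁⟩ : ∃ c₁, c₁ = c - lam ^ 2 := ⟨_, rfl⟩
  have hc1 : 0 < c₁ := by linarith
  rw [← hc₁]
  have ha' : lorentz a a = -(c₁ / c) := by rw [ha, hc₁]; field_simp; ring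
  obtain ⟨k, hk, hk0⟩ := exists_smul_futureUnit (a := a)
    (by rw [ha']; exact neg_lt_zero.2 (div_pos hc1 hc))
  set u := k • a with hu
  -- Translation by b moves the affine hyperplane into the complement of a, since ⟨a,a⟩ = -c₁/c and
  -- ⟨φ,a⟩ = λ/c. The translated position vector has square 1/c + λ²/(c c₁) = 1/c₁.
  set b := (lam / c₁) • a with hb
  have hba : ∀ p, lorentz (φ p + b) a = 0 := fun p => by
    rw [hb, lorentz_add_left, lorentz_smul_left, hφa, ha']
    field_simp
    ring
  have hbu : ∀ p, lorentz (φ p + b) u = 0 := fun p => by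
    rw [hu, lorentz_smul_right, hba, mul_zero]
  have hdu : ∀ p (v : TangentSpace (𝓡 m) p), lorentz (diff φ p v) u = 0 := fun p v => by
    rw [hu, lorentz_smul_right, hda, mul_zero]
  have hself : ∀ p, lorentz (φ p + b) (φ p + b) = 1 / c₁ := fun p => by
    have h1 : lorentz (φ p) (φ p) = 1 / c := hφ.mem_deSitter p
    have h2 : lorentz (φ p + b) b = 0 := by rw [hb, lorentz_smul_right, hba, mul_zero]
    have h3 : lam ^ 2 = c - c₁ := by linarith
    rw [lorentz_add_right, h2, hb, lorentz_add_left, lorentz_smul_left, h1, lorentz_comm a, hφa]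
    field_simp
    rw [h3]
    ring
  let F : M → EuclideanSpace ℝ (Fin (m + 1)) := fun p => spacePart u (φ p + b)
  have hF : ContMDiff (𝓡 m) 𝓘(ℝ, EuclideanSpace ℝ (Fin (m + 1))) ∞ F := by
    have h : ContDiff ℝ ∞ fun v => spacePart u (v + b) :=
      (spacePart u).contDiff.comp (contDiff_id.add contDiff_const)
    exact h.contMDiff.comp hφ.smooth
  have hdF : ∀ p (v : TangentSpace (𝓡 m) p), diff F p v = spacePart u (diff φ p v) := fun p v => by
    rw [diff_eq_fderiv (hF.mdifferentiableAt (by simp)), diff_eq_fderiv (hφ.mdifferentiableAt p)]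
    have hd : DifferentiableAt ℝ (inChart φ p) (extChartAt (𝓡 m) p p) :=
      (contDiffOn_inChart_univ hφ.smooth p).diffAt (isOpen_extChartAt_target p)
        (mem_extChartAt_target p)
    have h : HasFDerivAt (inChart F p)
        ((spacePart u).comp (fderiv ℝ (inChart φ p) (extChartAt (𝓡 m) p p)))
        (extChartAt (𝓡 m) p p) :=
      (spacePart u).hasFDerivAt.comp _ (hd.hasFDerivAt.add_const b)
    rw [h.fderiv]
    rfl
  have hiso : ∀ p (v w : TangentSpace (𝓡 m) p),
      inner ℝ (diff F p v) (diff F p w) = inducedMetric φ p v w := fun p v w => by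
    rw [hdF, hdF, inner_spacePart hk hk0 (hdu p v) (hdu p w)]
    rfl
  have hR : 0 < 1 / √c₁ := one_div_pos.2 (Real.sqrt_pos.2 hc1)
  have hmem : ∀ p, F p ∈ Metric.sphere (0 : EuclideanSpace ℝ (Fin (m + 1))) (1 / √c₁) := fun p => by
    rw [mem_sphere_zero_iff_norm]
    refine (pow_left_inj₀ (norm_nonneg _) hR.le two_ne_zero).1 ?_
    rw [← real_inner_self_eq_norm_sq, inner_spacePart hk hk0 (hbu p) (hbu p), hself, div_pow,
      one_pow, Real.sq_sqrt hc1.le]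
  have hloc := isLocalHomeomorph_sphere (by simp) hR hF hmem
    (fun p v hv => by
      by_contra hne
      have := hφ.spacelike p v hne
      rw [← hiso, hv, inner_zero_left] at this
      exact lt_irrefl _ this)
    (fun p v => by
      rw [hdF, inner_spacePart hk hk0 (hdu p v) (hbu p), lorentz_add_right, hb, lorentz_smul_right,
        hda, lorentz_comm, hφ.lorentz_position_diff]
      ring)
  obtain ⟨h1, h2⟩ := bijective_of_isLocalHomeomorph_sphere
    (by rw [finrank_euclideanSpace_fin]; omega) hR hloc
  refine ⟨F, hF, fun p q h => h1 (Subtype.ext h), ?_, hiso⟩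
  refine Set.Subset.antisymm (Set.range_subset_iff.2 hmem) fun z hz => ?_
  obtain ⟨p, hp⟩ := h2 ⟨z, hz⟩
  exact ⟨p, congrArg Subtype.val hp⟩

end Isometry

end DeSitterHypersurface

end

/-! ### Conclusion -/

theorem corollary1p2 {m : ℕ} (hm : 2 ≤ m) {M : Type*} [TopologicalSpace M] [T2Space M]
    [CompactSpace M] [ConnectedSpace M] [ChartedSpace (EuclideanSpace ℝ (Fin m)) M]
    [IsManifold (𝓡 m) ∞ M] (c r : ℝ) (hc : 0 < c)
    (φ : M → EuclideanSpace ℝ (Fin (m + 2)))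
    (hφ : DeSitterHypersurface.IsSpacelikeHypersurface c φ)
    (hscal : ∀ p : M, DeSitterHypersurface.scalarCurvature φ p = (m : ℝ) * ((m : ℝ) - 1) * r)
    (hsec : DeSitterHypersurface.NonnegSectionalCurvature φ)
    (hmin : ¬ DeSitterHypersurface.IsMinimal φ)
    (hbic : DeSitterHypersurface.IsBiconservative φ) :
    ∃ c₁ : ℝ, 0 < c₁ ∧ c₁ < c ∧ DeSitterHypersurface.IsometricToSphere φ c₁ := by
  have hm0 : m ≠ 0 := by omega
  obtain ⟨η, hη⟩ := hφ.exists_unitNormal hc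
  obtain ⟨τ, hτ0, hτ⟩ := DeSitterHypersurface.exists_trace_eq hφ hη hc hm0 hscal hsec hbic
    (DeSitterHypersurface.exists_trace_ne_zero hc hφ hη hmin)
  obtain ⟨lam, a, hlam0, hlam, ha, hφa, hda⟩ :=
    DeSitterHypersurface.exists_const_vector hφ hη hc hm0 hτ0 hτ
      -- Once the trace is constant, constant scalar curvature makes tr A² constant with this value.
      (q := τ ^ 2 + (m : ℝ) * ((m : ℝ) - 1) * (r - c))
      (fun p => by rw [DeSitterHypersurface.trace_sq_eq hφ hη hc hscal, hτ])
  -- The mean curvature is non-zero, hence λ ≠ 0, and this makes c₁ = c - λ² strictly smaller than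
  -- c.
  have hpos : 0 < lam ^ 2 := by positivity
  exact ⟨c - lam ^ 2, by linarith, by linarith,
    DeSitterHypersurface.isometricToSphere_of_const_vector hm hc hφ hlam ha hφa hda⟩
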